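/- **Setting.** Let $P\ge 2$ and let $\gamma_2,\dots,\gamma_P\in\mathbb R$ be not all zero; put $\xi(x)=\sum_{k=2}^P\gamma_k^2x^k$. For $N\ge 1$ let $G=(g_{i_1,\dots,i_k})_{2\le k\le P,\,1\le i_1,\dots,i_k\le N}$ be i.i.d. $N(0,1)$ variables, and for $\sigma\in\{-1,+1\}^N$ let $$H_N(\sigma;G)=\sum_{k=2}^P\frac{\gamma_k}{N^{(k-1)/2}}\sum_{1\le i_1,\dots,i_k\le N}g_{i_1,\dots,i_k}\sigma_{i_1}\cdots\sigma_{i_k},\qquad Z_N(\beta)=\sum_{\sigma}e^{\beta H_N(\sigma;G)},\qquad \mu_{\beta,G}(\sigma)=\frac{e^{\beta H_N(\sigma;G)}}{Z_N(\beta)}.$$ Let $S_\beta(G)=\{\sigma\in\{-1,+1\}^N: H_N(\sigma;G)\ge\beta\xi(1)N\}$. Let $G'$ be an independent copy of $G$ and, for $\tau\in[0,1]$, let $G_\tau=(1-\tau)G+\sqrt{2\tau-\tau^2}\,G'$. Let $\beta_c$ be the largest $\beta\ge0$ at which $\frac1N\mathbb E\log Z_N(\beta)\to\frac{\beta^2\xi(1)}2+\log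 2$ as $N\to\infty$, and let $$\bar\beta_d=\inf_{q\in(0,1)}\frac{2\sqrt{\xi'(1)}\,\varphi\big(\Phi^{-1}\big(\tfrac{1+q}2\big)\big)}{\xi(1)-\xi(q)},$$ where $\varphi$ and $\Phi$ are the standard normal density and distribution function. **Theorem.** (i) Let $\bar\beta_d<\beta<\beta_c$. There are $\varepsilon>0$, $c>0$ and $0<\underline q<\overline q<1$, depending on $\beta$ and $\xi$, such that for all $N\ge1$ and all $\tau\in[0,1]$ $$\mathbb E\,\mu_{\beta,G}\Big(\Big\{\sigma:\exists\,\sigma'\in S_{(1-\varepsilon)\beta}(G_\tau)\text{ with }\underline q\le\tfrac1N\langle\sigma,\sigma'\rangle\le\overline q\Big\}\Big)\le e^{-cN},\tag{1}$$ and (the case $\tau=1$) for all $N\ge1$ and every fixed $\sigma\in\{-1,+1\}^N$ $$\mathbb P\Big(\exists\,\sigma'\in S_\beta(G')\text{ with }\tfrac1N\langle\sigma,\sigma'\rangle\ge\underline q\Big)\le e^{-cN}.\tag{2}$$ (ii) For every $\varepsilon'>0$ there are $p_0$, $\delta>0$ and $c'>0$, depending only on $\varepsilon'$, such that for all $p\ge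 p_0$, in the pure $p$-spin case $\xi(x)=x^p$, the numbers $\underline q=1-\delta/p$ and $\overline q=1-p^{-1-\delta}$ satisfy $0<\underline q<\overline q<1$ and, for every $\beta\in\big((1+\varepsilon')\sqrt{(2\log p)/p},\ \sqrt{2\log2}\big)$, there is $c>0$ such that, for all $N\ge1$, (1) holds for all $\tau\in[0,1]$ and (2) holds for all $\sigma\in\{-1,+1\}^N$ with these $\underline q,\overline q$ and $\varepsilon=c'\sqrt{(\log p)/p}$. -/

import Mathlib

open MeasureTheory ProbabilityTheory Filter Topology Set

noncomputable section

namespace PSpin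

/-- Spin configurations `{-1,+1}^N`. -/
abbrev Config (N : ℕ) : Type := Fin N → ℤˣ

/-- The real value `±1` of the spin at site `i`. -/
def spin {N : ℕ} (σ : Config N) (i : Fin N) : ℝ := ((σ i : ℤ) : ℝ)

/-- The normalized overlap `⟨σ, σ'⟩ / N`. -/
def overlap {N : ℕ} (σ σ' : Config N) : ℝ := (∑ i, spin σ i * spin σ' i) / N

/-- Index set of the disorder: a degree `2 ≤ k ≤ P` and a tuple `(i₁, …, i_k)` of sites. -/
abbrev DisorderIndex (P N : ℕ) : Type := Σ k : Finset.Icc 2 P, (Fin (k : ℕ) → Fin N)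

/-- The disorder `G = (g_{i₁,…,i_k})`, a point of `ℝ^M` with `M = ∑_{k=2}^P N^k`. -/
abbrev Disorder (P N : ℕ) : Type := DisorderIndex P N → ℝ

/-- The law of the disorder: i.i.d. standard Gaussian entries. -/
def disorderLaw (P N : ℕ) : Measure (Disorder P N) :=
  Measure.pi fun _ => gaussianReal 0 1

/-- The mixture function `ξ(x) = ∑_{k=2}^P γ_k² x^k`. -/
def mixture (P : ℕ) (γ : ℕ → ℝ) (x : ℝ) : ℝ := ∑ k ∈ Finset.Icc 2 P, γ k ^ 2 * x ^ k

/-- The Hamiltonian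
`H_N(σ; G) = ∑_k γ_k N^{-(k-1)/2} ∑_{i₁,…,i_k} g_{i₁,…,i_k} σ_{i₁} ⋯ σ_{i_k}`. -/
def hamiltonian {P N : ℕ} (γ : ℕ → ℝ) (G : Disorder P N) (σ : Config N) : ℝ :=
  ∑ k : Finset.Icc 2 P, γ k / (N : ℝ) ^ ((((k : ℕ) : ℝ) - 1) / 2) *
    ∑ i : Fin (k : ℕ) → Fin N, G ⟨k, i⟩ * ∏ j, spin σ (i j)

/-- The partition function `Z_N(β)`. -/
def partitionFunction {P N : ℕ} (γ : ℕ → ℝ) (β : ℝ) (G : Disorder P N) : ℝ :=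
  ∑ σ : Config N, Real.exp (β * hamiltonian γ G σ)

open scoped Classical in
/-- The probability `μ_{β,G}(A)` of a set `A` of configurations under the Gibbs measure. -/
def gibbs {P N : ℕ} (γ : ℕ → ℝ) (β : ℝ) (G : Disorder P N) (A : Set (Config N)) : ℝ :=
  ∑ σ : Config N,
    if σ ∈ A then Real.exp (β * hamiltonian γ G σ) / partitionFunction γ β G else 0

/-- The super-level set `S_β(G) = {σ : H_N(σ; G) ≥ β ξ(1) N}`. -/
def superLevel {P N : ℕ} (γ : ℕ → ℝ) (β : ℝ) (G : Disorder P N) : Set (Config N) :=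
  {σ | β * mixture P γ 1 * N ≤ hamiltonian γ G σ}

/-- The correlated disorder `G_τ = (1 - τ) G + √(2τ - τ²) G'`. -/
def correlated {P N : ℕ} (τ : ℝ) (G G' : Disorder P N) : Disorder P N :=
  (1 - τ) • G + Real.sqrt (2 * τ - τ ^ 2) • G'

/-- The expected free energy per site `E log Z_N(β) / N`. -/
def freeEnergy (P : ℕ) (γ : ℕ → ℝ) (β : ℝ) (N : ℕ) : ℝ :=
  (∫ G, Real.log (partitionFunction γ β G) ∂(disorderLaw P N)) / N

/-- The static critical inverse temperature `β_c`: the largest `β ≥ 0` at which the expected free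
energy converges to its annealed value `β² ξ(1) / 2 + log 2`. -/
def betaC (P : ℕ) (γ : ℕ → ℝ) : ℝ :=
  sSup {β : ℝ | 0 ≤ β ∧
    Tendsto (freeEnergy P γ β) atTop (𝓝 (β ^ 2 * mixture P γ 1 / 2 + Real.log 2))}

/-- The inverse `Φ⁻¹(u)`, `0 < u < 1`, of the standard normal distribution function. -/
def gaussianQuantile (u : ℝ) : ℝ := sInf {x : ℝ | u ≤ cdf (gaussianReal 0 1) x}

/-- `β̄_d = inf_{0<q<1} 2 √ξ'(1) φ(Φ⁻¹((1+q)/2)) / (ξ(1) - ξ(q))`, where `φ` is the standard normal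
density. -/
def betaBarD (P : ℕ) (γ : ℕ → ℝ) : ℝ :=
  sInf ((fun q : ℝ =>
    2 * Real.sqrt (deriv (mixture P γ) 1) * gaussianPDFReal 0 1 (gaussianQuantile ((1 + q) / 2)) /
      (mixture P γ 1 - mixture P γ q)) '' Ioo 0 1)

/-- `E μ_{β,G}({σ : ∃ σ' ∈ S_{β'}(G_τ), q_lo ≤ ⟨σ,σ'⟩/N ≤ q_hi})`, the expectation being over
independent `G` and `G'`. -/
def gibbsOverlapMass (P : ℕ) (γ : ℕ → ℝ) (N : ℕ) (β β' τ qlo qhi : ℝ) : ℝ :=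
  ∫ ω : Disorder P N × Disorder P N,
    gibbs γ β ω.1
      {σ | ∃ σ' ∈ superLevel γ β' (correlated τ ω.1 ω.2), qlo ≤ overlap σ σ' ∧ overlap σ σ' ≤ qhi}
    ∂((disorderLaw P N).prod (disorderLaw P N))

/-- `P(∃ σ' ∈ S_β(G'), ⟨σ,σ'⟩/N ≥ q_lo)` for a fixed configuration `σ`. -/
def fixedOverlapProb (P : ℕ) (γ : ℕ → ℝ) {N : ℕ} (β qlo : ℝ) (σ : Config N) : ℝ :=
  (disorderLaw P N).real {G' | ∃ σ' ∈ superLevel γ β G', qlo ≤ overlap σ σ'}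

end PSpin

end

/-!
Fix `σ`. By the Cameron–Martin formula, weighting the disorder by `exp (β H(σ; G))` shifts it by `β`
times the coefficient vector of `H(σ; ·)`, that is, it plants a signal `β N ξ(⟨σ, σ'⟩ / N)` in the
Hamiltonian at `σ'`. If `log Z_N(β)` is with high probability within `N Δ` of its annealed value `N
(β² ξ(1) / 2 + log 2)`, the expected Gibbs mass of a random set of configurations is therefore at
most, up to smaller errors, `e^{N Δ}` times the planted probability of containing `σ`
(`integral_gibbs_le`). For the set in the theorem the planted disorder has to produce a `σ'` whose
overlap `v` with `σ` is in the window and at which an unplanted Hamiltonian exceeds `(β' ξ(1) - (1 -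
τ) β ξ(v)) N`; the correlated disorder without its signal is a standard Gaussian vector for every
`τ`, and `τ = 0` is the worst case.

The maximum of the Hamiltonian at overlap at least `v` with `σ` is compared with that of the linear
field `√ξ'(1) ∑ g_i σ_i σ'_i`: as `ξ` lies above its tangent at `1`, a Slepian–Kahane interpolation
applies (`integral_expSum_rpow_le`). It is carried out for a power `m ≤ 1` of an exponential sum, so
that it yields a tail bound directly and the entropy of the sum costs a factor `e^{N m}` only. For
the linear field a Lagrange multiplier `t` bounds the constrained maximum per site by `√ξ'(1) (E|g +
t| - t v)` (`prob_band_exceed_le`). Hence both bounds of the theorem hold whenever this quantity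
stays below the required level by a margin `η` and the free energy deficit `Δ` is smaller than `η² /
(8 ξ'(1))` (`exists_rate_of_margin`); finitely many small `N` are absorbed in the rate because the
super-level sets are empty with positive probability.

For general mixtures, `t = Φ⁻¹((1 + q) / 2)` turns `E|g + t| - t q` into `2 φ(t)`, so that `β̄_d <
β` provides a positive margin near some `q`, while `β < β_c` gives deficits as small as desired,
because the deficit is monotone in `β` (`freeEnergy_deficit_mono`).

In the pure model nothing is assumed on `β_c`, and the deficit is bounded by the second moment
method for the number of configurations with `H ≥ β N`. It succeeds with probability `e^{-N Δ'}`
only, but `log Z_N(β)` concentrates so well that a deficit of `Δ` would make this probability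
smaller than `e^{-N Δ² / (4 β²)}` (`eventually_freeEnergy_ge`). For large `p` one can take `Δ' =
p⁻⁶` (`secondMoment_loss_le`), far below what the margin in the window `[1 - δ / p, 1 - p^{-(1 +
δ)}]` requires.
-/

noncomputable section

namespace PSpin

/-- The standard Gaussian measure on `ℝ^I`. -/
abbrev gaussianPi (I : Type*) [Fintype I] : Measure (I → ℝ) :=
  Measure.pi fun _ => gaussianReal 0 1

/-! ### Cameron–Martin formula and Gaussian integration by parts -/

section GaussianCalculus

variable {I : Type*} [Fintype I]

lemma integrable_exp_mul_abs_gaussianReal (C : ℝ) :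
    Integrable (fun x : ℝ => Real.exp (C * |x|)) (gaussianReal 0 1) := by
  have h : Integrable (fun x : ℝ => Real.exp (C * x) + Real.exp (-C * x)) (gaussianReal 0 1) :=
    (integrable_exp_mul_gaussianReal C).add (integrable_exp_mul_gaussianReal (-C))
  refine h.mono' (by fun_prop) (ae_of_all _ fun x => ?_)
  rw [Real.norm_of_nonneg (Real.exp_pos _).le]
  rcases abs_cases x with ⟨hx, _⟩ | ⟨hx, _⟩ <;> rw [hx]
  · exact le_add_of_nonneg_right (Real.exp_pos _).le
  · rw [mul_neg, ← neg_mul]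
    exact le_add_of_nonneg_left (Real.exp_pos _).le

lemma integrable_exp_l1 (C : ℝ) :
    Integrable (fun w : I → ℝ => Real.exp (C * ∑ i, |w i|)) (gaussianPi I) := by
  simp_rw [Finset.mul_sum, Real.exp_sum]
  exact Integrable.fintype_prod (f := fun _ x => Real.exp (C * |x|))
    fun _ => integrable_exp_mul_abs_gaussianReal C

lemma integrable_of_le_exp_l1 {f : (I → ℝ) → ℝ} (hf : Continuous f) {K C : ℝ}
    (hb : ∀ w, |f w| ≤ K * Real.exp (C * ∑ i, |w i|)) : Integrable f (gaussianPi I) :=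
  ((integrable_exp_l1 C).const_mul K).mono' hf.aestronglyMeasurable (ae_of_all _ hb)

lemma gaussianReal_real_eq_integral_tilt (v : ℝ) (s : Set ℝ) (hs : MeasurableSet s) :
    gaussianReal v 1 s =
      ENNReal.ofReal (∫ x, s.indicator (fun x => Real.exp (v * x - v * v / 2)) x
        ∂(gaussianReal 0 1)) := by
  rw [gaussianReal_apply_eq_integral _ one_ne_zero, integral_gaussianReal_eq_integral_smul one_ne_zero,
    ← integral_indicator hs]
  congr 2 with x
  by_cases hx : x ∈ s
  · simp only [hx, indicator_of_mem, gaussianPDFReal, smul_eq_mul, NNReal.coe_one, mul_one, sub_zero]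
    rw [mul_assoc, ← Real.exp_add]
    congr 2
    ring
  · simp [hx]

lemma map_add_gaussianPi (v : I → ℝ) :
    (gaussianPi I).map (fun w => w + v) =
      (gaussianPi I).withDensity
        (fun w => ENNReal.ofReal (Real.exp (v ⬝ᵥ w - v ⬝ᵥ v / 2))) := by
  have h1 : (gaussianPi I).map (fun w => w + v) = Measure.pi fun i => gaussianReal (v i) 1 := by
    have h := Measure.pi_map_pi (μ := fun _ : I => gaussianReal 0 1)
      (f := fun i x => x + v i) (fun i => by fun_prop)
    simp only [gaussianReal_map_add_const, zero_add] at h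
    exact h
  rw [h1]
  refine Measure.pi_eq fun s hs => ?_
  rw [withDensity_apply _ (MeasurableSet.univ_pi hs), ← ofReal_integral_eq_lintegral_ofReal]
  · simp_rw [gaussianReal_real_eq_integral_tilt _ _ (hs _)]
    rw [← ENNReal.ofReal_prod_of_nonneg
      (fun i _ => integral_nonneg fun x => indicator_nonneg (fun _ _ => (Real.exp_pos _).le) _),
      ← integral_fintype_prod_eq_prod, ← integral_indicator (MeasurableSet.univ_pi hs)]
    congr 2 with w
    by_cases hw : w ∈ univ.pi s
    · rw [indicator_of_mem hw]
      rw [Finset.prod_congr rfl fun i _ => indicator_of_mem (hw i (mem_univ i)) _, ← Real.exp_sum]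
      simp only [dotProduct, Finset.sum_sub_distrib, Finset.sum_div]
    · rw [indicator_of_notMem hw]
      simp only [Set.mem_pi, mem_univ, true_imp_iff, not_forall] at hw
      obtain ⟨i, hi⟩ := hw
      exact (Finset.prod_eq_zero (Finset.mem_univ i) (indicator_of_notMem hi _)).symm
  · refine Integrable.integrableOn ?_
    have : (fun w : I → ℝ => Real.exp (v ⬝ᵥ w - v ⬝ᵥ v / 2)) =
        fun w => ∏ i, Real.exp (v i * w i) * Real.exp (-(v i * v i / 2)) := by
      ext w
      simp_rw [← Real.exp_add, ← Real.exp_sum, dotProduct, Finset.sum_div, ← Finset.sum_sub_distrib,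
        sub_eq_add_neg]
    rw [this]
    exact Integrable.fintype_prod (f := fun i x => Real.exp (v i * x) * Real.exp (-(v i * v i / 2)))
      fun i => (integrable_exp_mul_gaussianReal (v i)).mul_const _
  · exact ae_of_all _ fun _ => (Real.exp_pos _).le

/-- The Cameron–Martin formula for the standard Gaussian measure on `ℝ^I`. -/
lemma integral_add_gaussianPi (f : (I → ℝ) → ℝ) (v : I → ℝ) :
    ∫ w, f (w + v) ∂(gaussianPi I) =
      ∫ w, Real.exp (v ⬝ᵥ w - v ⬝ᵥ v / 2) * f w ∂(gaussianPi I) := by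
  have h := (MeasurableEquiv.addRight v).measurableEmbedding.integral_map (μ := gaussianPi I) f
  simp only [MeasurableEquiv.coe_addRight] at h
  rw [← h, map_add_gaussianPi, integral_withDensity_eq_integral_toReal_smul]
  · simp_rw [ENNReal.toReal_ofReal (Real.exp_pos _).le, smul_eq_mul]
  · simp only [dotProduct]; fun_prop
  · exact ae_of_all _ fun _ => ENNReal.ofReal_lt_top

/-- Differentiation under the integral sign against a Gaussian measure, for derivatives growing at
most exponentially. -/
lemma hasDerivAt_integral_gaussianPi {F F' : ℝ → (I → ℝ) → ℝ} {t₀ K C : ℝ}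
    (hF : ∀ t, Continuous (F t)) (hF' : Continuous (F' t₀)) (hint : Integrable (F t₀) (gaussianPi I))
    (hb : ∀ t ∈ Metric.ball t₀ 1, ∀ w, |F' t w| ≤ K * Real.exp (C * ∑ i, |w i|))
    (hd : ∀ t ∈ Metric.ball t₀ 1, ∀ w, HasDerivAt (fun t => F t w) (F' t w) t) :
    HasDerivAt (fun t => ∫ w, F t w ∂(gaussianPi I)) (∫ w, F' t₀ w ∂(gaussianPi I)) t₀ :=
  (hasDerivAt_integral_of_dominated_loc_of_deriv_le (Metric.ball_mem_nhds t₀ one_pos)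
    (Eventually.of_forall fun t => (hF t).aestronglyMeasurable) hint hF'.aestronglyMeasurable
    (ae_of_all _ fun w t ht => hb t ht w) ((integrable_exp_l1 C).const_mul K)
    (ae_of_all _ fun w t ht => hd t ht w)).2

lemma abs_dotProduct_le_l1 (v w : I → ℝ) : |v ⬝ᵥ w| ≤ (∑ i, |v i|) * ∑ i, |w i| := by
  calc |v ⬝ᵥ w| ≤ ∑ i, |v i| * |w i| := by
        simpa only [dotProduct, abs_mul] using Finset.abs_sum_le_sum_abs (fun i => v i * w i) _
    _ ≤ ∑ i, (∑ j, |v j|) * |w i| := by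
        gcongr with i
        exact Finset.single_le_sum (f := fun j => |v j|) (fun j _ => abs_nonneg _) (Finset.mem_univ i)
    _ = _ := by rw [Finset.mul_sum]

lemma l1_nonneg (w : I → ℝ) : 0 ≤ ∑ i, |w i| := Finset.sum_nonneg fun _ _ => abs_nonneg _

/-- Gaussian integration by parts: `∫ ⟨v, w⟩ f(w) = ∫ ∂_v f(w)`. Both sides are the derivative at
`t = 0` of `∫ f(w + t v)`, computed with and without the Cameron–Martin formula. -/
lemma integral_dotProduct_mul {f f' : (I → ℝ) → ℝ} {v : I → ℝ} (hf : Continuous f)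
    (hf' : Continuous f') (hd : ∀ w, HasDerivAt (fun t : ℝ => f (w + t • v)) (f' w) 0) {K C : ℝ}
    (hb : ∀ w, |f w| ≤ K * Real.exp (C * ∑ i, |w i|))
    (hb' : ∀ w, |f' w| ≤ K * Real.exp (C * ∑ i, |w i|)) :
    ∫ w, (v ⬝ᵥ w) * f w ∂(gaussianPi I) = ∫ w, f' w ∂(gaussianPi I) := by
  have hK : 0 ≤ K := by
    have h := (abs_nonneg _).trans (hb 0)
    exact nonneg_of_mul_nonneg_left h (Real.exp_pos _)
  set V := ∑ i, |v i| with hV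
  have hV0 : 0 ≤ V := l1_nonneg v
  have hball : ∀ t ∈ Metric.ball (0 : ℝ) 1, |t| ≤ 1 := fun t ht => by
    simpa using (Metric.mem_ball.1 ht).le
  have hd' : ∀ (t : ℝ) w, HasDerivAt (fun t : ℝ => f (w + t • v)) (f' (w + t • v)) t := by
    intro t w
    have h := hd (w + t • v)
    have h2 : HasDerivAt (fun u : ℝ => u - t) 1 t := (hasDerivAt_id t).sub_const t
    have h3 := HasDerivAt.comp t (h₂ := fun u : ℝ => f (w + t • v + u • v)) (by simpa using h) h2
    rw [mul_one] at h3
    refine h3.congr_of_eventuallyEq (Eventually.of_forall fun u => ?_)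
    simp only [Function.comp]
    congr 1
    rw [add_assoc, ← add_smul, add_sub_cancel]
  have h1 : HasDerivAt (fun t : ℝ => ∫ w, f (w + t • v) ∂(gaussianPi I))
      (∫ w, f' w ∂(gaussianPi I)) 0 := by
    have := hasDerivAt_integral_gaussianPi (I := I) (F := fun t w => f (w + t • v))
      (F' := fun t w => f' (w + t • v)) (t₀ := 0) (K := K * Real.exp (|C| * V)) (C := |C|)
      (fun t => by fun_prop) (by fun_prop)
      (by simpa using integrable_of_le_exp_l1 hf hb) ?_ (fun t _ w => hd' t w)
    · simpa using this
    · intro t ht w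
      refine (hb' _).trans ?_
      rw [mul_assoc, ← Real.exp_add]
      gcongr
      calc C * ∑ i, |(w + t • v) i| ≤ |C| * ∑ i, |(w + t • v) i| := by
            gcongr
            exact le_abs_self C
        _ ≤ |C| * ∑ i, (|w i| + |v i|) := by
            gcongr with i
            simp only [Pi.add_apply, Pi.smul_apply, smul_eq_mul]
            refine (abs_add_le _ _).trans ?_
            rw [abs_mul]
            gcongr
            exact mul_le_of_le_one_left (abs_nonneg _) (hball t ht)
        _ = |C| * V + |C| * ∑ i, |w i| := by rw [Finset.sum_add_distrib, hV]; ring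
  have h2 : HasDerivAt (fun t : ℝ => ∫ w, f (w + t • v) ∂(gaussianPi I))
      (∫ w, (v ⬝ᵥ w) * f w ∂(gaussianPi I)) 0 := by
    have hfun : (fun t : ℝ => ∫ w, f (w + t • v) ∂(gaussianPi I)) = fun t : ℝ =>
        ∫ w, Real.exp (t * (v ⬝ᵥ w) - t ^ 2 * (v ⬝ᵥ v) / 2) * f w ∂(gaussianPi I) := by
      ext t
      rw [integral_add_gaussianPi]
      congr 1 with w
      simp only [smul_dotProduct, dotProduct_smul, smul_eq_mul]
      ring_nf
    rw [hfun]
    have := hasDerivAt_integral_gaussianPi (I := I)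
      (F := fun t w => Real.exp (t * (v ⬝ᵥ w) - t ^ 2 * (v ⬝ᵥ v) / 2) * f w)
      (F' := fun t w => Real.exp (t * (v ⬝ᵥ w) - t ^ 2 * (v ⬝ᵥ v) / 2) *
        (v ⬝ᵥ w - t * (v ⬝ᵥ v)) * f w) (t₀ := 0)
      (K := K * (V + v ⬝ᵥ v)) (C := V + 1 + C)
      (fun t => by simp only [dotProduct]; fun_prop) (by simp only [dotProduct]; fun_prop)
      (by simpa using integrable_of_le_exp_l1 hf hb) ?_ ?_
    · simpa using this
    · intro t ht w
      have ht1 := hball t ht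
      have hw0 := l1_nonneg w
      have hvv : 0 ≤ v ⬝ᵥ v := Finset.sum_nonneg fun i _ => mul_self_nonneg _
      have hvw := abs_dotProduct_le_l1 v w
      have e1 : Real.exp (t * (v ⬝ᵥ w) - t ^ 2 * (v ⬝ᵥ v) / 2) ≤ Real.exp (V * ∑ i, |w i|) := by
        gcongr
        have : t * (v ⬝ᵥ w) ≤ V * ∑ i, |w i| := by
          refine (le_abs_self _).trans ?_
          rw [abs_mul]
          exact (mul_le_of_le_one_left (abs_nonneg _) ht1).trans hvw
        have : 0 ≤ t ^ 2 * (v ⬝ᵥ v) / 2 := by positivity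
        linarith
      have e2 : |v ⬝ᵥ w - t * (v ⬝ᵥ v)| ≤ (V + v ⬝ᵥ v) * Real.exp (1 * ∑ i, |w i|) := by
        have h1 : ∑ i, |w i| ≤ Real.exp (1 * ∑ i, |w i|) := by
          have := Real.add_one_le_exp (1 * ∑ i, |w i|)
          linarith
        have h2 : (1 : ℝ) ≤ Real.exp (1 * ∑ i, |w i|) := Real.one_le_exp (by linarith)
        calc |v ⬝ᵥ w - t * (v ⬝ᵥ v)| ≤ |v ⬝ᵥ w| + |t * (v ⬝ᵥ v)| := abs_sub _ _
          _ ≤ V * ∑ i, |w i| + v ⬝ᵥ v := by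
              gcongr
              rw [abs_mul, abs_of_nonneg hvv]
              exact mul_le_of_le_one_left hvv ht1
          _ ≤ V * Real.exp (1 * ∑ i, |w i|) + (v ⬝ᵥ v) * Real.exp (1 * ∑ i, |w i|) := by
              gcongr
              exact le_mul_of_one_le_right hvv h2
          _ = _ := by ring
      rw [abs_mul, abs_mul, abs_of_pos (Real.exp_pos _)]
      calc _ ≤ Real.exp (V * ∑ i, |w i|) * ((V + v ⬝ᵥ v) * Real.exp (1 * ∑ i, |w i|)) *
            (K * Real.exp (C * ∑ i, |w i|)) := by
            gcongr
            exact hb w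
        _ = _ := by
            rw [show (V + 1 + C) * ∑ i, |w i| = V * ∑ i, |w i| + 1 * ∑ i, |w i| + C * ∑ i, |w i| by
              ring, Real.exp_add, Real.exp_add]
            ring
    · intro t ht w
      have h : HasDerivAt (fun t : ℝ => t * (v ⬝ᵥ w) - t ^ 2 * (v ⬝ᵥ v) / 2)
          (v ⬝ᵥ w - t * (v ⬝ᵥ v)) t := by
        have := ((hasDerivAt_id t).mul_const (v ⬝ᵥ w)).sub
          (((hasDerivAt_pow 2 t).mul_const (v ⬝ᵥ v)).div_const 2)
        convert! this using 1
        simp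
        ring
      exact (h.exp).mul_const (f w)
  exact h2.unique h1

end GaussianCalculus

/-! ### Comparison of powers of Gaussian exponential sums -/

section Comparison

variable {I J : Type*} [Fintype I] [Fintype J]

/-- The exponential sum `∑_j exp ⟨c_j, w⟩` of the linear forms with coefficient vectors `c_j`. -/
def expSum (c : J → I → ℝ) (w : I → ℝ) : ℝ := ∑ j, Real.exp (c j ⬝ᵥ w)

lemma continuous_expSum (c : J → I → ℝ) : Continuous (expSum c) := by
  unfold expSum dotProduct
  fun_prop

lemma exp_le_expSum (c : J → I → ℝ) (w : I → ℝ) (j : J) : Real.exp (c j ⬝ᵥ w) ≤ expSum c w :=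
  Finset.single_le_sum (f := fun j => Real.exp (c j ⬝ᵥ w)) (fun _ _ => (Real.exp_pos _).le)
    (Finset.mem_univ j)

lemma expSum_pos [Nonempty J] (c : J → I → ℝ) (w : I → ℝ) : 0 < expSum c w :=
  (Real.exp_pos _).trans_le (exp_le_expSum c w (Classical.arbitrary J))

lemma expSum_nonneg (c : J → I → ℝ) (w : I → ℝ) : 0 ≤ expSum c w :=
  Finset.sum_nonneg fun _ _ => (Real.exp_pos _).le

lemma expSum_rpow_le {c : J → I → ℝ} {C m : ℝ} (hC : ∀ j, ∑ i, |c j i| ≤ C) (hC0 : 0 ≤ C)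
    (hm0 : 0 < m) (hm1 : m ≤ 1) (w : I → ℝ) :
    expSum c w ^ m ≤ (1 + Fintype.card J) * Real.exp (C * ∑ i, |w i|) := by
  have hw := l1_nonneg w
  have h1 : expSum c w ≤ Fintype.card J * Real.exp (C * ∑ i, |w i|) := by
    rw [← nsmul_eq_mul]
    refine Finset.sum_le_card_nsmul _ _ _ fun j _ => Real.exp_le_exp.2 ?_
    exact (le_abs_self _).trans ((abs_dotProduct_le_l1 _ _).trans (by gcongr; exact hC j))
  have h2 : (1 : ℝ) ≤ Real.exp (C * ∑ i, |w i|) := Real.one_le_exp (by positivity)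
  have h3 : expSum c w ^ m ≤ 1 + expSum c w := by
    rcases le_total (expSum c w) 1 with h | h
    · exact (Real.rpow_le_one (expSum_nonneg c w) h hm0.le).trans
        (le_add_of_nonneg_right (expSum_nonneg c w))
    · calc expSum c w ^ m ≤ expSum c w ^ (1 : ℝ) := Real.rpow_le_rpow_of_exponent_le h hm1
        _ = expSum c w := Real.rpow_one _
        _ ≤ _ := by linarith
  linarith

lemma integrable_expSum_rpow (c : J → I → ℝ) {m : ℝ} (hm0 : 0 < m) (hm1 : m ≤ 1) :
    Integrable (fun w => expSum c w ^ m) (gaussianPi I) := by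
  refine integrable_of_le_exp_l1 ((continuous_expSum c).rpow_const fun w => Or.inr hm0.le)
    (K := 1 + Fintype.card J) (C := ∑ j, ∑ i, |c j i|) fun w => ?_
  rw [abs_of_nonneg (Real.rpow_nonneg (expSum_nonneg c w) m)]
  exact expSum_rpow_le
    (fun j => Finset.single_le_sum (f := fun j => ∑ i, |c j i|) (fun j _ => l1_nonneg _)
      (Finset.mem_univ j)) (Finset.sum_nonneg fun j _ => l1_nonneg _) hm0 hm1 w

lemma rpow_sub_one_mul_le {x y m : ℝ} (hy : 0 < y) (hx : x ≤ y) : y ^ (m - 1) * x ≤ y ^ m := by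
  calc y ^ (m - 1) * x ≤ y ^ (m - 1) * y := by gcongr
    _ = y ^ m := by rw [← Real.rpow_add_one hy.ne']; ring_nf

lemma rpow_sub_two_mul_le {x z y m : ℝ} (hy : 0 < y) (hx0 : 0 ≤ x) (hx : x ≤ y) (hz : z ≤ y) :
    y ^ (m - 2) * (x * z) ≤ y ^ m := by
  calc y ^ (m - 2) * (x * z) ≤ y ^ (m - 2) * (y * y) :=
        mul_le_mul_of_nonneg_left ((mul_le_mul_of_nonneg_left hz hx0).trans
          (mul_le_mul_of_nonneg_right hx hy.le)) (Real.rpow_nonneg hy.le _)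
    _ = y ^ m := by
        rw [← sq, ← Real.rpow_natCast y 2, ← Real.rpow_add hy]
        norm_num

lemma hasDerivAt_expSum_line (c : J → I → ℝ) (w v : I → ℝ) :
    HasDerivAt (fun t : ℝ => expSum c (w + t • v))
      (∑ j, Real.exp (c j ⬝ᵥ w) * (c j ⬝ᵥ v)) 0 := by
  refine HasDerivAt.fun_sum fun j _ => ?_
  have h : HasDerivAt (fun t : ℝ => c j ⬝ᵥ (w + t • v)) (c j ⬝ᵥ v) 0 := by
    simp only [dotProduct_add, dotProduct_smul, smul_eq_mul]
    simpa using ((hasDerivAt_id (0 : ℝ)).mul_const (c j ⬝ᵥ v)).const_add (c j ⬝ᵥ w)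
  simpa using h.exp

/-- Gaussian integration by parts for the partial derivatives of `(∑_j exp ⟨c_j, w⟩) ^ m`. -/
lemma integral_dotProduct_mul_expSum [Nonempty J] (c : J → I → ℝ) (v : I → ℝ) (j : J) {m : ℝ}
    (hm0 : 0 < m) (hm1 : m ≤ 1) :
    ∫ w, (v ⬝ᵥ w) * (expSum c w ^ (m - 1) * Real.exp (c j ⬝ᵥ w)) ∂(gaussianPi I) =
      ∫ w, (expSum c w ^ (m - 1) * Real.exp (c j ⬝ᵥ w) * (c j ⬝ᵥ v) +
        (m - 1) * expSum c w ^ (m - 2) * Real.exp (c j ⬝ᵥ w) *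
          ∑ k, Real.exp (c k ⬝ᵥ w) * (c k ⬝ᵥ v)) ∂(gaussianPi I) := by
  have hpos := expSum_pos c
  have hcont := continuous_expSum c
  have hrp : ∀ r : ℝ, Continuous fun w => expSum c w ^ r := fun r =>
    hcont.rpow_const fun w => Or.inl (hpos w).ne'
  have hdot : ∀ u : I → ℝ, Continuous fun w : I → ℝ => u ⬝ᵥ w := fun u => by
    unfold dotProduct; fun_prop
  set C := ∑ j, ∑ i, |c j i| with hCdef
  have hC : ∀ j, ∑ i, |c j i| ≤ C := fun j =>
    Finset.single_le_sum (f := fun j => ∑ i, |c j i|) (fun j _ => l1_nonneg _) (Finset.mem_univ j)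
  have hC0 : 0 ≤ C := Finset.sum_nonneg fun j _ => l1_nonneg _
  set M := ∑ k, |c k ⬝ᵥ v| with hM
  have hM0 : 0 ≤ M := Finset.sum_nonneg fun _ _ => abs_nonneg _
  have hMk : ∀ k, |c k ⬝ᵥ v| ≤ M := fun k =>
    Finset.single_le_sum (f := fun k => |c k ⬝ᵥ v|) (fun _ _ => abs_nonneg _) (Finset.mem_univ k)
  have hZ := expSum_rpow_le hC hC0 hm0 hm1
  refine integral_dotProduct_mul (K := (1 + Fintype.card J) * (1 + M + M)) (C := C)
    ((hrp _).mul (hdot _).rexp)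
    (by
      refine (((hrp _).mul (hdot _).rexp).mul_const _).add
        (((continuous_const.mul (hrp _)).mul (hdot _).rexp).mul ?_)
      exact continuous_finsetSum _ fun k _ => ((hdot _).rexp).mul_const _) ?_ ?_ ?_
  · intro w
    have h1 := (hasDerivAt_expSum_line c w v).rpow_const (p := m - 1) (Or.inl (by simpa using (hpos w).ne'))
    have h2 : HasDerivAt (fun t : ℝ => Real.exp (c j ⬝ᵥ (w + t • v)))
        (Real.exp (c j ⬝ᵥ w) * (c j ⬝ᵥ v)) 0 := by
      have h : HasDerivAt (fun t : ℝ => c j ⬝ᵥ (w + t • v)) (c j ⬝ᵥ v) 0 := by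
        simp only [dotProduct_add, dotProduct_smul, smul_eq_mul]
        simpa using ((hasDerivAt_id (0 : ℝ)).mul_const (c j ⬝ᵥ v)).const_add (c j ⬝ᵥ w)
      simpa using h.exp
    convert! h1.mul h2 using 1
    simp only [zero_smul, add_zero]
    rw [show m - 1 - 1 = m - 2 by ring]
    ring
  · intro w
    have hE := Real.exp_pos (C * ∑ i, |w i|)
    rw [abs_of_nonneg (by have := hpos w; positivity)]
    refine (rpow_sub_one_mul_le (hpos w) (exp_le_expSum c w j)).trans ((hZ w).trans ?_)
    rw [mul_right_comm]
    exact le_mul_of_one_le_right (by positivity) (by linarith)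
  · intro w
    have hw := hpos w
    have hE := Real.exp_pos (C * ∑ i, |w i|)
    have hZ0 : 0 ≤ expSum c w ^ m := Real.rpow_nonneg hw.le _
    have b1 : |expSum c w ^ (m - 1) * Real.exp (c j ⬝ᵥ w) * (c j ⬝ᵥ v)| ≤ expSum c w ^ m * M := by
      rw [abs_mul, abs_of_nonneg (by positivity)]
      exact mul_le_mul (rpow_sub_one_mul_le hw (exp_le_expSum c w j)) (hMk j) (abs_nonneg _) hZ0
    have b0 : |∑ k, Real.exp (c k ⬝ᵥ w) * (c k ⬝ᵥ v)| ≤ expSum c w * M := by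
      refine (Finset.abs_sum_le_sum_abs _ _).trans ?_
      rw [expSum, Finset.sum_mul]
      gcongr with k
      rw [abs_mul, abs_of_pos (Real.exp_pos _)]
      gcongr
      exact hMk k
    have b2 : |(m - 1) * expSum c w ^ (m - 2) * Real.exp (c j ⬝ᵥ w) *
        ∑ k, Real.exp (c k ⬝ᵥ w) * (c k ⬝ᵥ v)| ≤ expSum c w ^ m * M := by
      rw [abs_mul, abs_mul, abs_mul, abs_of_pos (Real.exp_pos _),
        abs_of_nonneg (Real.rpow_nonneg hw.le _)]
      have hm' : |m - 1| ≤ 1 := by rw [abs_le]; constructor <;> linarith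
      calc _ ≤ 1 * expSum c w ^ (m - 2) * Real.exp (c j ⬝ᵥ w) * (expSum c w * M) := by gcongr
        _ = expSum c w ^ (m - 2) * (Real.exp (c j ⬝ᵥ w) * expSum c w) * M := by ring
        _ ≤ _ := by
            gcongr
            exact rpow_sub_two_mul_le hw (Real.exp_pos _).le (exp_le_expSum c w j) le_rfl
    calc _ ≤ expSum c w ^ m * M + expSum c w ^ m * M := (abs_add_le _ _).trans (add_le_add b1 b2)
      _ ≤ expSum c w ^ m * (1 + M + M) := by nlinarith
      _ ≤ ((1 + Fintype.card J) * Real.exp (C * ∑ i, |w i|)) * (1 + M + M) := by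
          gcongr
          exact hZ w
      _ = _ := by ring

/-- A Gaussian comparison inequality of Slepian–Kahane type for the concave power of an exponential
sum. The families `⟨a_j, ·⟩` and `⟨b_j, ·⟩` are independent, the variances of the first are smaller
by the same amount `-D`, and no covariance drops by more than that. Along the interpolation
`cos θ a_j + sin θ b_j` the integral of the power is then monotone. -/
theorem integral_expSum_rpow_le [Nonempty J] {a b : J → I → ℝ} {D m : ℝ}
    (horth : ∀ j k, a j ⬝ᵥ b k = 0) (hD : D ≤ 0)
    (hdiag : ∀ j, a j ⬝ᵥ a j - b j ⬝ᵥ b j = D) (hoff : ∀ j k, D ≤ a j ⬝ᵥ a k - b j ⬝ᵥ b k)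
    (hm0 : 0 < m) (hm1 : m ≤ 1) :
    ∫ w, expSum a w ^ m ∂(gaussianPi I) ≤ ∫ w, expSum b w ^ m ∂(gaussianPi I) := by
  set c : ℝ → J → I → ℝ := fun θ j => Real.cos θ • a j + Real.sin θ • b j with hc
  set c' : ℝ → J → I → ℝ := fun θ j => -Real.sin θ • a j + Real.cos θ • b j with hc'
  set φ : ℝ → ℝ := fun θ => ∫ w, expSum (c θ) w ^ m ∂(gaussianPi I) with hφ
  have hcc' : ∀ θ j k, c θ k ⬝ᵥ c' θ j =
      -(Real.sin θ * Real.cos θ) * (a j ⬝ᵥ a k - b j ⬝ᵥ b k) := by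
    intro θ j k
    simp only [hc, hc', add_dotProduct, dotProduct_add, smul_dotProduct, dotProduct_smul,
      smul_eq_mul, horth]
    rw [dotProduct_comm (b k) (a j), horth, dotProduct_comm (a k), dotProduct_comm (b k)]
    ring
  set C := ∑ j, ∑ i, (|a j i| + |b j i|) with hCdef
  have hC0 : 0 ≤ C := by positivity
  have hl1 : ∀ (x y : ℝ) j, |x| ≤ 1 → |y| ≤ 1 → ∑ i, |(x • a j + y • b j) i| ≤ C := by
    intro x y j hx hy
    calc ∑ i, |(x • a j + y • b j) i| ≤ ∑ i, (|a j i| + |b j i|) := by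
          gcongr with i
          simp only [Pi.add_apply, Pi.smul_apply, smul_eq_mul]
          refine (abs_add_le _ _).trans ?_
          rw [abs_mul, abs_mul]
          gcongr
          · exact mul_le_of_le_one_left (abs_nonneg _) hx
          · exact mul_le_of_le_one_left (abs_nonneg _) hy
      _ ≤ C := Finset.single_le_sum (f := fun j => ∑ i, (|a j i| + |b j i|))
          (fun _ _ => by positivity) (Finset.mem_univ j)
  have hcC : ∀ θ j, ∑ i, |c θ j i| ≤ C := fun θ j =>
    hl1 _ _ j (Real.abs_cos_le_one θ) (Real.abs_sin_le_one θ)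
  have hc'C : ∀ θ j, ∑ i, |c' θ j i| ≤ C := fun θ j =>
    hl1 _ _ j (by simpa using Real.abs_sin_le_one θ) (Real.abs_cos_le_one θ)
  have hdot : ∀ u : I → ℝ, Continuous fun w : I → ℝ => u ⬝ᵥ w := fun u => by
    unfold dotProduct; fun_prop
  have hrp : ∀ θ (r : ℝ), Continuous fun w => expSum (c θ) w ^ r := fun θ r =>
    (continuous_expSum _).rpow_const fun w => Or.inl (expSum_pos _ w).ne'
  have hderiv : ∀ θ, HasDerivAt φ (∫ w, m * expSum (c θ) w ^ (m - 1) *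
      ∑ j, Real.exp (c θ j ⬝ᵥ w) * (c' θ j ⬝ᵥ w) ∂(gaussianPi I)) θ := by
    intro θ
    refine hasDerivAt_integral_gaussianPi (F := fun θ w => expSum (c θ) w ^ m)
      (F' := fun θ w => m * expSum (c θ) w ^ (m - 1) *
        ∑ j, Real.exp (c θ j ⬝ᵥ w) * (c' θ j ⬝ᵥ w)) (K := (1 + Fintype.card J) * C)
      (C := C + 1) (fun t => hrp t m) ?_ (integrable_expSum_rpow _ hm0 hm1) ?_ ?_
    · exact (continuous_const.mul (hrp _ _)).mul
        (continuous_finsetSum _ fun j _ => (hdot _).rexp.mul (hdot _))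
    · intro t _ w
      have hw := expSum_pos (c t) w
      have hw0 := l1_nonneg w
      have b0 : |∑ j, Real.exp (c t j ⬝ᵥ w) * (c' t j ⬝ᵥ w)| ≤
          expSum (c t) w * (C * ∑ i, |w i|) := by
        refine (Finset.abs_sum_le_sum_abs _ _).trans ?_
        rw [expSum, Finset.sum_mul]
        gcongr with k
        rw [abs_mul, abs_of_pos (Real.exp_pos _)]
        gcongr
        exact (abs_dotProduct_le_l1 _ _).trans (by gcongr; exact hc'C t k)
      rw [abs_mul, abs_mul, abs_of_pos hm0, abs_of_nonneg (Real.rpow_nonneg hw.le _)]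
      calc _ ≤ 1 * expSum (c t) w ^ (m - 1) * (expSum (c t) w * (C * ∑ i, |w i|)) := by gcongr
        _ = expSum (c t) w ^ (m - 1) * expSum (c t) w * (C * ∑ i, |w i|) := by ring
        _ ≤ ((1 + Fintype.card J) * Real.exp (C * ∑ i, |w i|)) * (C * Real.exp (∑ i, |w i|)) := by
            refine mul_le_mul ((rpow_sub_one_mul_le hw le_rfl).trans
                (expSum_rpow_le (hcC t) hC0 hm0 hm1 w)) ?_ (by positivity) (by positivity)
            gcongr
            linarith [Real.add_one_le_exp (∑ i, |w i|)]
        _ = _ := by rw [add_mul C, one_mul, Real.exp_add]; ring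
    · intro t _ w
      have h1 : HasDerivAt (fun θ => expSum (c θ) w)
          (∑ j, Real.exp (c t j ⬝ᵥ w) * (c' t j ⬝ᵥ w)) t := by
        refine HasDerivAt.fun_sum fun j _ => ?_
        have h : HasDerivAt (fun θ : ℝ => c θ j ⬝ᵥ w) (c' t j ⬝ᵥ w) t := by
          simp only [hc, hc', add_dotProduct, smul_dotProduct, smul_eq_mul]
          exact ((Real.hasDerivAt_cos t).mul_const _).add ((Real.hasDerivAt_sin t).mul_const _)
        exact h.exp
      convert! h1.rpow_const (p := m) (Or.inl (expSum_pos _ w).ne') using 1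
      ring
  have hpart : ∀ θ j, Integrable (fun w => (c' θ j ⬝ᵥ w) *
      (expSum (c θ) w ^ (m - 1) * Real.exp (c θ j ⬝ᵥ w))) (gaussianPi I) := by
    intro θ j
    refine integrable_of_le_exp_l1 ((hdot _).mul ((hrp _ _).mul (hdot _).rexp))
      (K := C * (1 + Fintype.card J)) (C := 1 + C) fun w => ?_
    have hw := expSum_pos (c θ) w
    have hw0 := l1_nonneg w
    rw [abs_mul, abs_of_nonneg (a := _ * Real.exp _) (by positivity)]
    calc _ ≤ (C * ∑ i, |w i|) * ((1 + Fintype.card J) * Real.exp (C * ∑ i, |w i|)) := by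
          refine mul_le_mul ((abs_dotProduct_le_l1 _ _).trans (by gcongr; exact hc'C θ j))
            ((rpow_sub_one_mul_le hw (exp_le_expSum _ w j)).trans
              (expSum_rpow_le (hcC θ) hC0 hm0 hm1 w)) (by positivity) (by positivity)
      _ ≤ (C * Real.exp (∑ i, |w i|)) * ((1 + Fintype.card J) * Real.exp (C * ∑ i, |w i|)) := by
          gcongr
          linarith [Real.add_one_le_exp (∑ i, |w i|)]
      _ = _ := by rw [add_mul 1 C, one_mul, Real.exp_add]; ring
  have hint2 : ∀ θ j, Integrable (fun w =>
      (expSum (c θ) w ^ (m - 1) * Real.exp (c θ j ⬝ᵥ w) * (c θ j ⬝ᵥ c' θ j) +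
        (m - 1) * expSum (c θ) w ^ (m - 2) * Real.exp (c θ j ⬝ᵥ w) *
          ∑ k, Real.exp (c θ k ⬝ᵥ w) * (c θ k ⬝ᵥ c' θ j))) (gaussianPi I) := by
    intro θ j
    have hI : Integrable (fun w => (1 + Fintype.card J) * Real.exp (C * ∑ i, |w i|)) (gaussianPi I) :=
      (integrable_exp_l1 C).const_mul _
    refine Integrable.add ?_ ?_
    · refine Integrable.mul_const ?_ _
      refine hI.mono' ((hrp _ _).mul (hdot _).rexp).aestronglyMeasurable (ae_of_all _ fun w => ?_)
      have hw := expSum_pos (c θ) w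
      rw [Real.norm_of_nonneg (by positivity)]
      exact (rpow_sub_one_mul_le hw (exp_le_expSum _ w j)).trans
              (expSum_rpow_le (hcC θ) hC0 hm0 hm1 w)
    · simp_rw [Finset.mul_sum]
      refine integrable_finsetSum _ fun k _ => ?_
      have : Integrable (fun w => expSum (c θ) w ^ (m - 2) *
          (Real.exp (c θ j ⬝ᵥ w) * Real.exp (c θ k ⬝ᵥ w))) (gaussianPi I) := by
        refine hI.mono' ((hrp _ _).mul ((hdot _).rexp.mul (hdot _).rexp)).aestronglyMeasurable
          (ae_of_all _ fun w => ?_)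
        have hw := expSum_pos (c θ) w
        rw [Real.norm_of_nonneg (by positivity)]
        exact (rpow_sub_two_mul_le hw (Real.exp_pos _).le (exp_le_expSum _ w j)
          (exp_le_expSum _ w k)).trans (expSum_rpow_le (hcC θ) hC0 hm0 hm1 w)
      refine (this.const_mul ((m - 1) * (c θ k ⬝ᵥ c' θ j))).congr (ae_of_all _ fun w => ?_)
      simp only
      ring
  have hnonneg : ∀ θ ∈ Icc 0 (Real.pi / 2), 0 ≤ ∫ w, m * expSum (c θ) w ^ (m - 1) *
      ∑ j, Real.exp (c θ j ⬝ᵥ w) * (c' θ j ⬝ᵥ w) ∂(gaussianPi I) := by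
    intro θ hθ
    have hs : 0 ≤ Real.sin θ := Real.sin_nonneg_of_nonneg_of_le_pi hθ.1 (by linarith [hθ.2, hθ.1])
    have hcs : 0 ≤ Real.cos θ := Real.cos_nonneg_of_mem_Icc ⟨by linarith [hθ.1, Real.pi_pos], hθ.2⟩
    have e1 : ∀ w : I → ℝ, m * expSum (c θ) w ^ (m - 1) *
        ∑ j, Real.exp (c θ j ⬝ᵥ w) * (c' θ j ⬝ᵥ w) =
        m * ∑ j, (c' θ j ⬝ᵥ w) * (expSum (c θ) w ^ (m - 1) * Real.exp (c θ j ⬝ᵥ w)) := by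
      intro w
      rw [mul_assoc, Finset.mul_sum]
      congr 1
      exact Finset.sum_congr rfl fun j _ => by ring
    simp_rw [e1]
    rw [integral_const_mul, integral_finsetSum _ fun j _ => hpart θ j]
    simp_rw [integral_dotProduct_mul_expSum (c θ) (c' θ _) _ hm0 hm1]
    rw [← integral_finsetSum _ fun j _ => hint2 θ j]
    refine mul_nonneg hm0.le (integral_nonneg fun w => ?_)
    have hw := expSum_pos (c θ) w
    simp only [hcc', hdiag, Pi.zero_apply]
    set E : J → ℝ := fun j => Real.exp (c θ j ⬝ᵥ w) with hE
    set Z := expSum (c θ) w with hZ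
    have hZE : Z = ∑ j, E j := rfl
    have hquad : D * (Z * Z) ≤ ∑ j, ∑ k, E j * E k * (a j ⬝ᵥ a k - b j ⬝ᵥ b k) := by
      rw [hZE, Finset.sum_mul_sum, Finset.mul_sum]
      refine Finset.sum_le_sum fun j _ => ?_
      rw [Finset.mul_sum]
      refine Finset.sum_le_sum fun k _ => ?_
      rw [mul_comm]
      exact mul_le_mul_of_nonneg_left (hoff j k) (mul_pos (Real.exp_pos _) (Real.exp_pos _)).le
    have hsum : ∑ j, (Z ^ (m - 1) * E j * (-(Real.sin θ * Real.cos θ) * D) +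
        (m - 1) * Z ^ (m - 2) * E j *
          ∑ k, E k * (-(Real.sin θ * Real.cos θ) * (a j ⬝ᵥ a k - b j ⬝ᵥ b k))) =
        Real.sin θ * Real.cos θ * (-D * (Z ^ (m - 1) * Z) + (1 - m) * (Z ^ (m - 2) *
          ∑ j, ∑ k, E j * E k * (a j ⬝ᵥ a k - b j ⬝ᵥ b k))) := by
      have h1 : ∑ j, Z ^ (m - 1) * E j * (-(Real.sin θ * Real.cos θ) * D) =
          Real.sin θ * Real.cos θ * (-D * (Z ^ (m - 1) * Z)) := by
        rw [← Finset.sum_mul, ← Finset.mul_sum, ← hZE]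
        ring
      rw [Finset.sum_add_distrib, h1, mul_add]
      congr 1
      simp only [Finset.mul_sum]
      exact Finset.sum_congr rfl fun j _ => Finset.sum_congr rfl fun k _ => by ring
    rw [hsum]
    have hp1 : Z ^ (m - 1) * Z = Z ^ (m - 2) * (Z * Z) := by
      rw [show m - 1 = m - 2 + 1 by ring, Real.rpow_add_one hw.ne', mul_assoc]
    refine mul_nonneg (mul_nonneg hs hcs) ?_
    rw [hp1]
    have h1 : 0 ≤ Z ^ (m - 2) := Real.rpow_nonneg hw.le _
    have h2 : Z ^ (m - 2) * (D * (Z * Z)) ≤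
        Z ^ (m - 2) * ∑ j, ∑ k, E j * E k * (a j ⬝ᵥ a k - b j ⬝ᵥ b k) :=
      mul_le_mul_of_nonneg_left hquad h1
    have h3 := mul_le_mul_of_nonneg_left h2 (sub_nonneg.2 hm1)
    have h4 : 0 ≤ -D * m * (Z ^ (m - 2) * (Z * Z)) := by
      have : 0 ≤ -D := by linarith
      positivity
    nlinarith
  have hmono : MonotoneOn φ (Icc 0 (Real.pi / 2)) := by
    refine monotoneOn_of_deriv_nonneg (convex_Icc _ _)
      (fun θ _ => (hderiv θ).continuousAt.continuousWithinAt)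
      (fun θ _ => (hderiv θ).differentiableAt.differentiableWithinAt) fun θ hθ => ?_
    rw [(hderiv θ).deriv]
    exact hnonneg θ (interior_subset hθ)
  have h := hmono (left_mem_Icc.2 (by positivity)) (right_mem_Icc.2 (by positivity))
    (by positivity : (0 : ℝ) ≤ Real.pi / 2)
  simpa [hφ, hc] using h

end Comparison

section IndependentFamilies

variable {I J K : Type*} [Fintype I] [Fintype J] [Fintype K]

/-- The comparison inequality `integral_expSum_rpow_le` for Gaussian families carried by two
different standard Gaussian vectors. -/
theorem integral_expSum_rpow_le_of_indep [Nonempty J] {a : J → I → ℝ} {b : J → K → ℝ} {D m : ℝ}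
    (hD : D ≤ 0) (hdiag : ∀ j, a j ⬝ᵥ a j - b j ⬝ᵥ b j = D)
    (hoff : ∀ j k, D ≤ a j ⬝ᵥ a k - b j ⬝ᵥ b k) (hm0 : 0 < m) (hm1 : m ≤ 1) :
    ∫ w, expSum a w ^ m ∂(gaussianPi I) ≤ ∫ w, expSum b w ^ m ∂(gaussianPi K) := by
  have h := integral_expSum_rpow_le (I := I ⊕ K) (a := fun j => Sum.elim (a j) 0)
    (b := fun j => Sum.elim 0 (b j)) (D := D) (m := m)
    (fun j k => by simp [dotProduct, Fintype.sum_sum_type]) hD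
    (fun j => by simpa [dotProduct, Fintype.sum_sum_type] using hdiag j)
    (fun j k => by simpa [dotProduct, Fintype.sum_sum_type] using hoff j k) hm0 hm1
  have hmp := measurePreserving_sumPiEquivProdPi (X := fun _ : I ⊕ K => ℝ)
    (fun _ => gaussianReal 0 1)
  have ha : ∫ w, expSum (fun j => Sum.elim (a j) 0) w ^ m ∂(gaussianPi (I ⊕ K)) =
      ∫ w, expSum a w ^ m ∂(gaussianPi I) := by
    have h1 := hmp.integral_comp' (fun z : (I → ℝ) × (K → ℝ) => expSum a z.1 ^ m)
    have h2 := integral_fun_fst (μ := gaussianPi I) (ν := gaussianPi K) (fun w => expSum a w ^ m)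
    simp only [probReal_univ, one_smul] at h2
    rw [← h2, ← h1]
    congr 1 with w
    simp [expSum, dotProduct, Fintype.sum_sum_type, MeasurableEquiv.coe_sumPiEquivProdPi,
      Equiv.sumPiEquivProdPi]
  have hb : ∫ w, expSum (fun j => Sum.elim 0 (b j)) w ^ m ∂(gaussianPi (I ⊕ K)) =
      ∫ w, expSum b w ^ m ∂(gaussianPi K) := by
    have h1 := hmp.integral_comp' (fun z : (I → ℝ) × (K → ℝ) => expSum b z.2 ^ m)
    have h2 := integral_fun_snd (μ := gaussianPi I) (ν := gaussianPi K) (fun w => expSum b w ^ m)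
    simp only [probReal_univ, one_smul] at h2
    rw [← h2, ← h1]
    congr 1 with w
    simp [expSum, dotProduct, Fintype.sum_sum_type, MeasurableEquiv.coe_sumPiEquivProdPi,
      Equiv.sumPiEquivProdPi]
  rwa [ha, hb] at h

end IndependentFamilies

/-! ### Gaussian concentration -/

section Concentration

lemma abs_le_of_lipschitz {f : ℝ → ℝ} {L : ℝ} (hf : ∀ x y, |f x - f y| ≤ L * |x - y|) (x : ℝ) :
    |f x| ≤ |f 0| + L * |x| := by
  have h := hf x 0
  rw [sub_zero] at h
  calc |f x| = |f 0 + (f x - f 0)| := by ring_nf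
    _ ≤ |f 0| + |f x - f 0| := abs_add_le _ _
    _ ≤ _ := by linarith

lemma continuous_of_lipschitz {f : ℝ → ℝ} {L : ℝ} (hf : ∀ x y, |f x - f y| ≤ L * |x - y|) :
    Continuous f :=
  (LipschitzWith.of_dist_le_mul (K := L.toNNReal) fun x y => by
    rw [Real.dist_eq, Real.dist_eq]
    exact (hf x y).trans (by gcongr; exact Real.le_coe_toNNReal L)).continuous

lemma integrable_of_lipschitz {f : ℝ → ℝ} {L : ℝ} (hf : ∀ x y, |f x - f y| ≤ L * |x - y|) :
    Integrable f (gaussianReal 0 1) := by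
  have h : Integrable (fun x : ℝ => |f 0| + L * |x|) (gaussianReal 0 1) :=
    (integrable_const _).add (((memLp_id_gaussianReal (1 : NNReal)).integrable (by simp)).abs.const_mul L)
  exact h.mono' (continuous_of_lipschitz hf).aestronglyMeasurable
    (ae_of_all _ (abs_le_of_lipschitz hf))

lemma integrable_exp_of_lipschitz {f : ℝ → ℝ} {L : ℝ} (hf : ∀ x y, |f x - f y| ≤ L * |x - y|) :
    Integrable (fun x => Real.exp (f x)) (gaussianReal 0 1) := by
  refine ((integrable_exp_mul_abs_gaussianReal L).const_mul (Real.exp |f 0|)).mono'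
    (continuous_of_lipschitz hf).rexp.aestronglyMeasurable (ae_of_all _ fun x => ?_)
  rw [Real.norm_of_nonneg (Real.exp_pos _).le, ← Real.exp_add]
  exact Real.exp_le_exp.2 ((le_abs_self _).trans (abs_le_of_lipschitz hf x))

lemma exp_integral_le_integral_exp {Ω : Type*} [MeasurableSpace Ω] {μ : Measure Ω}
    [IsProbabilityMeasure μ] {f : Ω → ℝ} (hf : Integrable f μ)
    (hexp : Integrable (fun x => Real.exp (f x)) μ) :
    Real.exp (∫ x, f x ∂μ) ≤ ∫ x, Real.exp (f x) ∂μ :=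
  convexOn_exp.map_integral_le Real.continuous_exp.continuousOn isClosed_univ
    (ae_of_all _ fun _ => mem_univ _) hf hexp

/-- A Lipschitz function of a standard Gaussian variable is sub-Gaussian. By Jensen's inequality the
mean can be replaced by an independent copy, and the symmetrised exponential is a hyperbolic cosine,
which is monotone in the Lipschitz bound. -/
lemma integral_exp_le_of_lipschitz {f : ℝ → ℝ} {L : ℝ} (hf : ∀ x y, |f x - f y| ≤ L * |x - y|) :
    ∫ x, Real.exp (f x) ∂(gaussianReal 0 1) ≤
      Real.exp (∫ x, f x ∂(gaussianReal 0 1) + L ^ 2) := by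
  set μ := gaussianReal 0 1 with hμ
  have hL : 0 ≤ L := by
    have := (abs_nonneg _).trans (hf 1 0)
    simpa using this
  have hf' : ∀ x y, |(-f x) - (-f y)| ≤ L * |x - y| := fun x y => by
    rw [neg_sub_neg, abs_sub_comm]
    exact hf x y
  have hneg : Real.exp (-∫ x, f x ∂μ) ≤ ∫ x, Real.exp (-f x) ∂μ := by
    rw [← integral_neg]
    exact exp_integral_le_integral_exp (integrable_of_lipschitz hf') (integrable_exp_of_lipschitz hf')
  have hprod : (∫ x, Real.exp (f x) ∂μ) * ∫ x, Real.exp (-f x) ∂μ =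
      ∫ z, Real.exp (f z.1) * Real.exp (-f z.2) ∂(μ.prod μ) := (integral_prod_mul _ _).symm
  have hswap : ∫ z, Real.exp (f z.1) * Real.exp (-f z.2) ∂(μ.prod μ) =
      ∫ z, Real.exp (-f z.1) * Real.exp (f z.2) ∂(μ.prod μ) := by
    rw [integral_prod_mul (fun x => Real.exp (f x)) (fun x => Real.exp (-f x)),
      integral_prod_mul (fun x => Real.exp (-f x)) (fun x => Real.exp (f x)), mul_comm]
  have hi1 : Integrable (fun z : ℝ × ℝ => Real.exp (f z.1) * Real.exp (-f z.2)) (μ.prod μ) :=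
    (integrable_exp_of_lipschitz hf).mul_prod (integrable_exp_of_lipschitz hf')
  have hi2 : Integrable (fun z : ℝ × ℝ => Real.exp (-f z.1) * Real.exp (f z.2)) (μ.prod μ) :=
    (integrable_exp_of_lipschitz hf').mul_prod (integrable_exp_of_lipschitz hf)
  have hj1 : Integrable (fun z : ℝ × ℝ => Real.exp (L * z.1) * Real.exp (-L * z.2)) (μ.prod μ) :=
    (integrable_exp_mul_gaussianReal L).mul_prod (integrable_exp_mul_gaussianReal (-L))
  have hj2 : Integrable (fun z : ℝ × ℝ => Real.exp (-L * z.1) * Real.exp (L * z.2)) (μ.prod μ) :=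
    (integrable_exp_mul_gaussianReal (-L)).mul_prod (integrable_exp_mul_gaussianReal L)
  have hmgf : ∀ t : ℝ, ∫ x, Real.exp (t * x) ∂μ = Real.exp (t ^ 2 / 2) := fun t => by
    have := congrFun (mgf_fun_id_gaussianReal (μ := 0) (v := 1)) t
    simpa [mgf] using this
  have hmain : ∫ z, Real.exp (f z.1) * Real.exp (-f z.2) ∂(μ.prod μ) ≤ Real.exp (L ^ 2) := by
    have h2 : (∫ z, Real.exp (f z.1) * Real.exp (-f z.2) ∂(μ.prod μ)) +
        ∫ z, Real.exp (-f z.1) * Real.exp (f z.2) ∂(μ.prod μ) ≤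
        (∫ z, Real.exp (L * z.1) * Real.exp (-L * z.2) ∂(μ.prod μ)) +
        ∫ z, Real.exp (-L * z.1) * Real.exp (L * z.2) ∂(μ.prod μ) := by
      rw [← integral_add hi1 hi2, ← integral_add hj1 hj2]
      refine integral_mono (hi1.add hi2) (hj1.add hj2) fun z => ?_
      have hc : Real.cosh (f z.1 - f z.2) ≤ Real.cosh (L * (z.1 - z.2)) := by
        rw [Real.cosh_le_cosh, abs_mul, abs_of_nonneg hL]
        exact hf _ _
      rw [Real.cosh_eq, Real.cosh_eq] at hc
      rw [← Real.exp_add, ← Real.exp_add, ← Real.exp_add, ← Real.exp_add]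
      ring_nf at hc ⊢
      linarith
    rw [← hswap, integral_prod_mul (fun x => Real.exp (L * x)) (fun x => Real.exp (-L * x)),
      integral_prod_mul (fun x => Real.exp (-L * x)) (fun x => Real.exp (L * x)), hmgf, hmgf,
      ← Real.exp_add, ← Real.exp_add] at h2
    ring_nf at h2 ⊢
    linarith
  rw [← hprod] at hmain
  have hpos : 0 ≤ ∫ x, Real.exp (f x) ∂μ := integral_nonneg fun _ => (Real.exp_pos _).le
  have h := (mul_le_mul_of_nonneg_left hneg hpos).trans hmain
  rw [Real.exp_neg, ← div_eq_mul_inv, div_le_iff₀ (Real.exp_pos _), ← Real.exp_add] at h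
  rwa [add_comm]

variable {I : Type*} [Fintype I]

lemma continuous_of_coord_lipschitz {F : (I → ℝ) → ℝ} {L : I → ℝ}
    (hF : ∀ w w', |F w - F w'| ≤ ∑ i, L i * |w i - w' i|) : Continuous F := by
  rw [continuous_iff_continuousAt]
  intro w'
  have h : Tendsto (fun w : I → ℝ => ∑ i, L i * |w i - w' i|) (𝓝 w') (𝓝 0) := by
    have : Continuous fun w : I → ℝ => ∑ i, L i * |w i - w' i| := by fun_prop
    simpa using this.tendsto w'
  rw [ContinuousAt, tendsto_iff_dist_tendsto_zero]
  exact squeeze_zero (fun _ => dist_nonneg) (fun w => by rw [Real.dist_eq]; exact hF w w') h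

lemma abs_le_of_coord_lipschitz {F : (I → ℝ) → ℝ} {L : I → ℝ} (hL : ∀ i, 0 ≤ L i)
    (hF : ∀ w w', |F w - F w'| ≤ ∑ i, L i * |w i - w' i|) (w : I → ℝ) :
    |F w| ≤ |F 0| + (∑ i, L i) * ∑ i, |w i| := by
  have h := hF w 0
  simp only [Pi.zero_apply, sub_zero] at h
  have h2 : ∑ i, L i * |w i| ≤ (∑ i, L i) * ∑ i, |w i| := by
    rw [Finset.mul_sum]
    gcongr with i
    exact Finset.single_le_sum (f := L) (fun j _ => hL j) (Finset.mem_univ i)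
  calc |F w| = |F 0 + (F w - F 0)| := by ring_nf
    _ ≤ |F 0| + |F w - F 0| := abs_add_le _ _
    _ ≤ _ := by linarith

lemma integrable_of_coord_lipschitz {F : (I → ℝ) → ℝ} {L : I → ℝ} (hL : ∀ i, 0 ≤ L i)
    (hF : ∀ w w', |F w - F w'| ≤ ∑ i, L i * |w i - w' i|) : Integrable F (gaussianPi I) := by
  have hS : 0 ≤ ∑ i, L i := Finset.sum_nonneg fun i _ => hL i
  refine integrable_of_le_exp_l1 (continuous_of_coord_lipschitz hF) (K := |F 0| + ∑ i, L i) (C := 1)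
    fun w => (abs_le_of_coord_lipschitz hL hF w).trans ?_
  have hw := l1_nonneg w
  have h1 : (1 : ℝ) ≤ Real.exp (1 * ∑ i, |w i|) := Real.one_le_exp (by linarith)
  have h2 : ∑ i, |w i| ≤ Real.exp (1 * ∑ i, |w i|) := by
    linarith [Real.add_one_le_exp (1 * ∑ i, |w i|)]
  rw [add_mul]
  exact add_le_add (le_mul_of_one_le_right (abs_nonneg _) h1) (mul_le_mul_of_nonneg_left h2 hS)

lemma integrable_exp_of_coord_lipschitz {F : (I → ℝ) → ℝ} {L : I → ℝ} (hL : ∀ i, 0 ≤ L i)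
    (hF : ∀ w w', |F w - F w'| ≤ ∑ i, L i * |w i - w' i|) :
    Integrable (fun w => Real.exp (F w)) (gaussianPi I) := by
  refine integrable_of_le_exp_l1 (continuous_of_coord_lipschitz hF).rexp (K := Real.exp |F 0|)
    (C := ∑ i, L i) fun w => ?_
  rw [abs_of_pos (Real.exp_pos _), ← Real.exp_add]
  exact Real.exp_le_exp.2 ((le_abs_self _).trans (abs_le_of_coord_lipschitz hL hF w))

lemma integral_exp_le_of_coord_lipschitz_fin (n : ℕ) : ∀ {F : (Fin n → ℝ) → ℝ} {L : Fin n → ℝ},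
    (∀ i, 0 ≤ L i) → (∀ w w', |F w - F w'| ≤ ∑ i, L i * |w i - w' i|) →
    ∫ w, Real.exp (F w) ∂(gaussianPi (Fin n)) ≤
      Real.exp (∫ w, F w ∂(gaussianPi (Fin n)) + ∑ i, L i ^ 2) := by
  induction n with
  | zero =>
    intro F L _ _
    have : ∀ w, F w = F 0 := fun w => congrArg F (Subsingleton.elim _ _)
    simp [this]
  | succ n ih =>
    intro F L hL hF
    set μ := gaussianReal 0 1 with hμ
    have hmp := (measurePreserving_piFinSuccAbove (fun _ : Fin (n + 1) => μ) 0).symm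
    have hfub : ∀ g : (Fin (n + 1) → ℝ) → ℝ, Integrable g (gaussianPi (Fin (n + 1))) →
        Integrable (fun u => ∫ x, g (Fin.cons x u) ∂μ) (gaussianPi (Fin n)) ∧
        ∫ w, g w ∂(gaussianPi (Fin (n + 1))) =
          ∫ u, ∫ x, g (Fin.cons x u) ∂μ ∂(gaussianPi (Fin n)) := by
      intro g hg
      have h1 : ∫ w, g w ∂(gaussianPi (Fin (n + 1))) = _ := (hmp.integral_comp' g).symm
      have h2 := (hmp.integrable_comp_emb (MeasurableEquiv.measurableEmbedding _)).2 hg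
      have h3 : ∀ z : ℝ × (Fin n → ℝ),
          (MeasurableEquiv.piFinSuccAbove (fun _ : Fin (n + 1) => ℝ) 0).symm z =
            Fin.cons z.1 z.2 := by
        intro z
        simp [MeasurableEquiv.piFinSuccAbove_symm_apply]
        rfl
      refine ⟨?_, ?_⟩
      · simpa only [Function.comp_def, h3] using h2.integral_prod_right
      · rw [h1]
        refine (integral_prod_symm _ h2).trans ?_
        simp only [Function.comp_def, h3]
        rfl
    have hcons : ∀ u (x y : ℝ), |F (Fin.cons x u) - F (Fin.cons y u)| ≤ L 0 * |x - y| := by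
      intro u x y
      simpa [Fin.sum_univ_succ] using hF (Fin.cons x u) (Fin.cons y u)
    have hcons' : ∀ x u u', |F (Fin.cons x u) - F (Fin.cons x u')| ≤
        ∑ i, L (Fin.succ i) * |u i - u' i| := by
      intro x u u'
      simpa [Fin.sum_univ_succ] using hF (Fin.cons x u) (Fin.cons x u')
    set F₁ : (Fin n → ℝ) → ℝ := fun u => ∫ x, F (Fin.cons x u) ∂μ with hF₁
    have hF₁L : ∀ u u', |F₁ u - F₁ u'| ≤ ∑ i, L (Fin.succ i) * |u i - u' i| := by
      intro u u'
      rw [hF₁, ← integral_sub (integrable_of_lipschitz (hcons u)) (integrable_of_lipschitz (hcons u'))]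
      have := norm_integral_le_of_norm_le_const (μ := μ)
        (f := fun x => F (Fin.cons x u) - F (Fin.cons x u')) (ae_of_all _ fun x => hcons' x u u')
      simpa using this
    obtain ⟨_, hI1⟩ := hfub F (integrable_of_coord_lipschitz hL hF)
    obtain ⟨hint, hI2⟩ := hfub _ (integrable_exp_of_coord_lipschitz hL hF)
    rw [hI1, hI2]
    calc _ ≤ ∫ u, Real.exp (L 0 ^ 2) * Real.exp (F₁ u) ∂(gaussianPi (Fin n)) := by
          refine integral_mono hint ((integrable_exp_of_coord_lipschitz
            (fun i => hL (Fin.succ i)) hF₁L).const_mul _) fun u => ?_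
          refine (integral_exp_le_of_lipschitz (hcons u)).trans ?_
          rw [← Real.exp_add, add_comm]
      _ ≤ Real.exp (L 0 ^ 2) * Real.exp (∫ u, F₁ u ∂(gaussianPi (Fin n)) +
            ∑ i, L (Fin.succ i) ^ 2) := by
          rw [integral_const_mul]
          gcongr
          exact ih (fun i => hL (Fin.succ i)) hF₁L
      _ = _ := by
          rw [← Real.exp_add, Fin.sum_univ_succ]
          congr 1
          ring

/-- Sub-Gaussian concentration of a function on `ℝ^I` that is `L_i`-Lipschitz in the `i`-th
coordinate, by integrating out one coordinate at a time. -/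
theorem integral_exp_le_of_coord_lipschitz {F : (I → ℝ) → ℝ} {L : I → ℝ} (hL : ∀ i, 0 ≤ L i)
    (hF : ∀ w w', |F w - F w'| ≤ ∑ i, L i * |w i - w' i|) :
    ∫ w, Real.exp (F w) ∂(gaussianPi I) ≤
      Real.exp (∫ w, F w ∂(gaussianPi I) + ∑ i, L i ^ 2) := by
  let e := (Fintype.equivFin I).symm
  have hmp := measurePreserving_piCongrLeft (fun _ : I => gaussianReal 0 1) e
  have happ : ∀ (w : Fin (Fintype.card I) → ℝ) i,
      MeasurableEquiv.piCongrLeft (fun _ : I => ℝ) e w (e i) = w i := fun w i => by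
    rw [MeasurableEquiv.coe_piCongrLeft, Equiv.piCongrLeft_apply_apply]
  have h1 := hmp.integral_comp' F
  have h2 := hmp.integral_comp' fun w => Real.exp (F w)
  rw [← e.sum_comp, ← h1, ← h2]
  refine integral_exp_le_of_coord_lipschitz_fin _ (L := fun i => L (e i)) (fun i => hL _)
    fun w w' => (hF _ _).trans (le_of_eq ?_)
  rw [← e.sum_comp]
  simp only [happ]

lemma prob_le_integral_sub_le {F : (I → ℝ) → ℝ} {L : I → ℝ} {V : ℝ} (hL : ∀ i, 0 ≤ L i)
    (hF : ∀ w w', |F w - F w'| ≤ ∑ i, L i * |w i - w' i|) (hV : ∑ i, L i ^ 2 = V) (hV0 : 0 < V)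
    {r : ℝ} (hr : 0 ≤ r) :
    (gaussianPi I).real {w | ∫ w, F w ∂(gaussianPi I) + r ≤ F w} ≤ Real.exp (-(r ^ 2 / (4 * V))) := by
  set M := ∫ w, F w ∂(gaussianPi I) with hM
  set l := r / (2 * V) with hl
  have hl0 : 0 ≤ l := by positivity
  have hLl : ∀ i, 0 ≤ l * L i := fun i => mul_nonneg hl0 (hL i)
  have hFl : ∀ w w', |l * F w - l * F w'| ≤ ∑ i, (l * L i) * |w i - w' i| := fun w w' => by
    rw [← mul_sub, abs_mul, abs_of_nonneg hl0]
    simp_rw [mul_assoc]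
    rw [← Finset.mul_sum]
    exact mul_le_mul_of_nonneg_left (hF w w') hl0
  have h := integral_exp_le_of_coord_lipschitz hLl hFl
  simp_rw [mul_pow] at h
  rw [integral_const_mul, ← Finset.mul_sum, hV, ← hM] at h
  have hmarkov := mul_meas_ge_le_integral_of_nonneg (μ := gaussianPi I)
    (f := fun w => Real.exp (l * F w)) (ae_of_all _ fun _ => (Real.exp_pos _).le)
    (integrable_exp_of_coord_lipschitz hLl hFl) (Real.exp (l * (M + r)))
  have hset : {w | M + r ≤ F w} ⊆ {w | Real.exp (l * (M + r)) ≤ Real.exp (l * F w)} := fun w hw =>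
    Real.exp_le_exp.2 (mul_le_mul_of_nonneg_left hw hl0)
  have h2 : Real.exp (l * (M + r)) * (gaussianPi I).real {w | M + r ≤ F w} ≤
      Real.exp (l * M + l ^ 2 * V) :=
    (mul_le_mul_of_nonneg_left (measureReal_mono hset) (Real.exp_pos _).le).trans
      (hmarkov.trans h)
  rw [mul_comm, ← le_div_iff₀ (Real.exp_pos _), ← Real.exp_sub] at h2
  refine h2.trans (Real.exp_le_exp.2 (le_of_eq ?_))
  rw [hl]
  field_simp
  ring

lemma prob_le_integral_add_le {F : (I → ℝ) → ℝ} {L : I → ℝ} {V : ℝ} (hL : ∀ i, 0 ≤ L i)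
    (hF : ∀ w w', |F w - F w'| ≤ ∑ i, L i * |w i - w' i|) (hV : ∑ i, L i ^ 2 = V) (hV0 : 0 < V)
    {r : ℝ} (hr : 0 ≤ r) :
    (gaussianPi I).real {w | F w + r ≤ ∫ w, F w ∂(gaussianPi I)} ≤ Real.exp (-(r ^ 2 / (4 * V))) := by
  have h := prob_le_integral_sub_le (F := fun w => -F w) hL
    (fun w w' => by rw [neg_sub_neg, abs_sub_comm]; exact hF w w') hV hV0 hr
  convert h using 3
  ext w
  simp only [integral_neg]
  constructor <;> intro h <;> linarith

end Concentration

/-! ### Linear forms and rotations of Gaussian vectors -/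

section Laws

variable {I : Type*} [Fintype I]

/-- A linear form of a standard Gaussian vector is Gaussian. -/
lemma map_dotProduct_gaussianPi (a : I → ℝ) :
    (gaussianPi I).map (fun w => a ⬝ᵥ w) = gaussianReal 0 (a ⬝ᵥ a).toNNReal := by
  have ha : 0 ≤ a ⬝ᵥ a := Finset.sum_nonneg fun i _ => mul_self_nonneg _
  have hm : Measurable fun w : I → ℝ => a ⬝ᵥ w := by unfold dotProduct; fun_prop
  have := Measure.isProbabilityMeasure_map (μ := gaussianPi I) hm.aemeasurable
  refine Measure.ext_of_charFun (funext fun t => ?_)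
  rw [charFun_gaussianReal, charFun_apply_real, integral_map hm.aemeasurable (by fun_prop)]
  have h1 : ∀ w : I → ℝ, Complex.exp (t * ((a ⬝ᵥ w : ℝ) : ℂ) * Complex.I) =
      ∏ i, Complex.exp (((t * a i : ℝ) : ℂ) * (w i : ℂ) * Complex.I) := fun w => by
    rw [← Complex.exp_sum, dotProduct]
    push_cast
    rw [Finset.mul_sum, Finset.sum_mul]
    congr 1
    exact Finset.sum_congr rfl fun i _ => by ring
  simp_rw [h1]
  rw [integral_fintype_prod_eq_prod
    (f := fun i (x : ℝ) => Complex.exp (((t * a i : ℝ) : ℂ) * (x : ℂ) * Complex.I))]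
  simp_rw [← charFun_apply_real, charFun_gaussianReal]
  rw [← Complex.exp_sum, Real.coe_toNNReal _ ha]
  congr 1
  simp only [dotProduct]
  push_cast
  simp only [mul_zero, zero_mul, zero_sub, one_mul, Finset.sum_neg_distrib, Finset.sum_mul,
    Finset.sum_div]
  congr 1
  exact Finset.sum_congr rfl fun i _ => by ring

lemma integral_exp_dotProduct (a : I → ℝ) :
    ∫ w, Real.exp (a ⬝ᵥ w) ∂(gaussianPi I) = Real.exp (a ⬝ᵥ a / 2) := by
  have h := integral_add_gaussianPi (fun _ : I → ℝ => Real.exp (a ⬝ᵥ a / 2)) a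
  have h2 : ∀ w, Real.exp (a ⬝ᵥ w - a ⬝ᵥ a / 2) * Real.exp (a ⬝ᵥ a / 2) = Real.exp (a ⬝ᵥ w) :=
    fun w => by rw [← Real.exp_add, sub_add_cancel]
  simp only [h2, integral_const, probReal_univ, one_smul] at h
  exact h.symm

lemma integrable_exp_dotProduct (a : I → ℝ) :
    Integrable (fun w => Real.exp (a ⬝ᵥ w)) (gaussianPi I) := by
  refine integrable_of_le_exp_l1 (by unfold dotProduct; fun_prop) (K := 1) (C := ∑ i, |a i|)
    fun w => ?_
  rw [abs_of_pos (Real.exp_pos _), one_mul]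
  exact Real.exp_le_exp.2 ((le_abs_self _).trans (abs_dotProduct_le_l1 _ _))

/-- Rotation invariance: `c w + s w'` with `c² + s² = 1` is again a standard Gaussian vector. -/
lemma measurePreserving_rotation {c s : ℝ} (hcs : c ^ 2 + s ^ 2 = 1) :
    MeasurePreserving (fun z : (I → ℝ) × (I → ℝ) => c • z.1 + s • z.2)
      ((gaussianPi I).prod (gaussianPi I)) (gaussianPi I) := by
  have h1 : MeasurePreserving (fun p : ℝ × ℝ => c * p.1 + s * p.2)
      ((gaussianReal 0 1).prod (gaussianReal 0 1)) (gaussianReal 0 1) := by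
    refine ⟨by fun_prop, ?_⟩
    have h2 : (fun p : ℝ × ℝ => c * p.1 + s * p.2) =
        (fun p : ℝ × ℝ => p.1 + p.2) ∘ Prod.map (fun x => c * x) (fun x => s * x) := rfl
    rw [h2, ← Measure.map_map (by fun_prop) (by fun_prop),
      ← Measure.map_prod_map _ _ (by fun_prop) (by fun_prop), gaussianReal_map_const_mul,
      gaussianReal_map_const_mul]
    have h3 := gaussianReal_conv_gaussianReal (m₁ := c * 0) (m₂ := s * 0)
      (v₁ := .mk (c ^ 2) (sq_nonneg c) * 1) (v₂ := .mk (s ^ 2) (sq_nonneg s) * 1)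
    rw [Measure.conv] at h3
    rw [h3]
    congr 1
    · simp
    · ext
      simpa using hcs
  have h2 := measurePreserving_pi (fun _ : I => (gaussianReal 0 1).prod (gaussianReal 0 1))
    (fun _ : I => gaussianReal 0 1) (fun _ => h1)
  have h3 := (measurePreserving_arrowProdEquivProdArrow ℝ ℝ I (fun _ => gaussianReal 0 1)
    (fun _ => gaussianReal 0 1)).symm
  exact h2.comp h3

end Laws

/-! ### Overlaps, mixtures and the covariance of the Hamiltonian -/

section Model

variable {P N : ℕ} {γ : ℕ → ℝ}

lemma spin_mul_self (σ : Config N) (i : Fin N) : spin σ i * spin σ i = 1 := by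
  rcases Int.units_eq_one_or (σ i) with h | h <;> simp [spin, h]

lemma abs_spin (σ : Config N) (i : Fin N) : |spin σ i| = 1 := by
  rcases Int.units_eq_one_or (σ i) with h | h <;> simp [spin, h]

lemma mul_overlap (hN : 1 ≤ N) (σ σ' : Config N) :
    N * overlap σ σ' = ∑ i, spin σ i * spin σ' i := by
  have : (N : ℝ) ≠ 0 := by positivity
  rw [overlap]
  field_simp

lemma overlap_self (hN : 1 ≤ N) (σ : Config N) : overlap σ σ = 1 := by
  have : (N : ℝ) ≠ 0 := by positivity
  simp [overlap, spin_mul_self, this]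

lemma overlap_comm (σ σ' : Config N) : overlap σ σ' = overlap σ' σ := by
  simp only [overlap, mul_comm]

lemma abs_overlap_le_one (hN : 1 ≤ N) (σ σ' : Config N) : |overlap σ σ'| ≤ 1 := by
  have hN' : (0 : ℝ) < N := by positivity
  rw [overlap, abs_div, abs_of_pos hN', div_le_one hN']
  refine (Finset.abs_sum_le_sum_abs _ _).trans ?_
  simp [abs_mul, abs_spin]

/-- The coefficient vector of the linear form `G ↦ H_N(σ; G)`. -/
def fieldCoeff (P : ℕ) (γ : ℕ → ℝ) (σ : Config N) : DisorderIndex P N → ℝ :=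
  fun x => γ x.1 / (N : ℝ) ^ ((((x.1 : ℕ) : ℝ) - 1) / 2) * ∏ j, spin σ (x.2 j)

lemma hamiltonian_eq_dotProduct (G : Disorder P N) (σ : Config N) :
    hamiltonian γ G σ = fieldCoeff P γ σ ⬝ᵥ G := by
  simp only [hamiltonian, fieldCoeff, dotProduct, Fintype.sum_sigma, Finset.mul_sum]
  exact Finset.sum_congr rfl fun k _ => Finset.sum_congr rfl fun i _ => by ring

/-- The covariance of the Hamiltonian is `N ξ(⟨σ, σ'⟩ / N)`. -/
lemma fieldCoeff_dotProduct (hN : 1 ≤ N) (σ σ' : Config N) :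
    fieldCoeff P γ σ ⬝ᵥ fieldCoeff P γ σ' = N * mixture P γ (overlap σ σ') := by
  have hN' : (0 : ℝ) < N := by positivity
  simp only [fieldCoeff, dotProduct, Fintype.sum_sigma]
  rw [mixture, Finset.mul_sum, ← Finset.sum_coe_sort (Finset.Icc 2 P)]
  refine Finset.sum_congr rfl fun k _ => ?_
  have hk : 1 ≤ (k : ℕ) := (by norm_num : 1 ≤ 2).trans (Finset.mem_Icc.1 k.2).1
  have h1 : ∀ i : Fin (k : ℕ) → Fin N,
      γ k / (N : ℝ) ^ ((((k : ℕ) : ℝ) - 1) / 2) * (∏ j, spin σ (i j)) *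
        (γ k / (N : ℝ) ^ ((((k : ℕ) : ℝ) - 1) / 2) * ∏ j, spin σ' (i j)) =
      γ k ^ 2 / (N : ℝ) ^ (((k : ℕ) : ℝ) - 1) * ∏ j, spin σ (i j) * spin σ' (i j) := by
    intro i
    have h2 : (N : ℝ) ^ (((k : ℕ) : ℝ) - 1) =
        (N : ℝ) ^ ((((k : ℕ) : ℝ) - 1) / 2) * (N : ℝ) ^ ((((k : ℕ) : ℝ) - 1) / 2) := by
      rw [← Real.rpow_add hN']
      ring_nf
    rw [Finset.prod_mul_distrib, h2]
    have : (N : ℝ) ^ ((((k : ℕ) : ℝ) - 1) / 2) ≠ 0 := (Real.rpow_pos_of_pos hN' _).ne'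
    field_simp
  simp_rw [h1]
  rw [← Finset.mul_sum, ← Fintype.sum_pow (fun a => spin σ a * spin σ' a), ← mul_overlap hN, mul_pow,
    Real.rpow_sub_one hN'.ne', Real.rpow_natCast]
  field_simp

lemma mixture_zero : mixture P γ 0 = 0 := by
  refine Finset.sum_eq_zero fun k hk => ?_
  have : k ≠ 0 := by have := (Finset.mem_Icc.1 hk).1; omega
  simp [this]

lemma mixture_nonneg {x : ℝ} (hx : 0 ≤ x) : 0 ≤ mixture P γ x :=
  Finset.sum_nonneg fun k _ => by positivity

lemma mixture_mono {x y : ℝ} (hx : 0 ≤ x) (hxy : x ≤ y) : mixture P γ x ≤ mixture P γ y :=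
  Finset.sum_le_sum fun k _ => by gcongr

lemma continuous_mixture : Continuous (mixture P γ) := by
  unfold mixture
  fun_prop

lemma mixture_one_pos (h : ∃ k ∈ Finset.Icc 2 P, γ k ≠ 0) : 0 < mixture P γ 1 := by
  obtain ⟨k, hk, hγ⟩ := h
  exact Finset.sum_pos' (fun _ _ => by positivity) ⟨k, hk, by positivity⟩

lemma deriv_mixture_one : deriv (mixture P γ) 1 = ∑ k ∈ Finset.Icc 2 P, γ k ^ 2 * k := by
  refine HasDerivAt.deriv ?_
  unfold mixture
  refine HasDerivAt.fun_sum fun k _ => ?_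
  simpa using (hasDerivAt_pow k (1 : ℝ)).const_mul (γ k ^ 2)

/-- The tangent line of `ξ` at `1` lies below `ξ` on `[-1, ∞)`. -/
lemma mixture_one_sub_le {x : ℝ} (hx : -1 ≤ x) :
    mixture P γ 1 - mixture P γ x ≤ deriv (mixture P γ) 1 * (1 - x) := by
  rw [deriv_mixture_one, mixture, mixture, ← Finset.sum_sub_distrib, Finset.sum_mul]
  refine Finset.sum_le_sum fun k _ => ?_
  have h := one_add_mul_le_pow (a := x - 1) (by linarith) k
  rw [add_sub_cancel] at h
  rw [one_pow, ← mul_sub, mul_assoc]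
  exact mul_le_mul_of_nonneg_left (by linarith) (sq_nonneg _)

lemma mixture_one_le_deriv : mixture P γ 1 ≤ deriv (mixture P γ) 1 := by
  have h := mixture_one_sub_le (P := P) (γ := γ) (x := 0) (by norm_num)
  rwa [mixture_zero, sub_zero, sub_zero, mul_one] at h

end Model

instance (P N : ℕ) : IsProbabilityMeasure (disorderLaw P N) :=
  inferInstanceAs (IsProbabilityMeasure (gaussianPi (DisorderIndex P N)))

/-! ### Maximum of the Hamiltonian at given overlap -/

section Band

variable {P N : ℕ} {γ : ℕ → ℝ}

/-- The mean `E |g + t|` for a standard Gaussian variable `g`. -/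
def meanAbs (t : ℝ) : ℝ := ∫ x, |x + t| ∂(gaussianReal 0 1)

lemma abs_add_lipschitz (t x y : ℝ) : |(|x + t| - |y + t|)| ≤ |x - y| := by
  have := abs_abs_sub_abs_le (x + t) (y + t)
  rwa [add_sub_add_right_eq_sub] at this

lemma integral_exp_mul_abs_add_le {l : ℝ} (hl : 0 ≤ l) (t : ℝ) :
    ∫ x, Real.exp (l * |x + t|) ∂(gaussianReal 0 1) ≤ Real.exp (l * meanAbs t + l ^ 2) := by
  have h := integral_exp_le_of_lipschitz (f := fun x => l * |x + t|) (L := l) fun x y => by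
    rw [← mul_sub, abs_mul, abs_of_nonneg hl]
    exact mul_le_mul_of_nonneg_left (abs_add_lipschitz t x y) hl
  rwa [integral_const_mul] at h

lemma integrable_exp_mul_abs_add {l : ℝ} (hl : 0 ≤ l) (t : ℝ) :
    Integrable (fun x => Real.exp (l * |x + t|)) (gaussianReal 0 1) :=
  integrable_exp_of_lipschitz (f := fun x => l * |x + t|) (L := l) fun x y => by
    rw [← mul_sub, abs_mul, abs_of_nonneg hl]
    exact mul_le_mul_of_nonneg_left (abs_add_lipschitz t x y) hl

/-- The fractional moment of the partition function restricted to configurations of overlap at least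
`q` with `σ`. The Hamiltonian is compared with the linear field `√ξ'(1) ∑ g_i σ_i σ'_i`, and the
maximum of the latter under the overlap constraint is bounded with the Lagrange multiplier `t`. -/
lemma integral_bandSum_le (hN : 1 ≤ N) (σ : Config N) {q t l m : ℝ} (ht : 0 ≤ t) (hl : 0 < l)
    (hm0 : 0 < m) (hm1 : m ≤ 1) (T : Finset (Config N)) (hT : ∀ σ' ∈ T, q ≤ overlap σ σ') :
    ∫ G, (∑ σ' ∈ T, Real.exp (l / m * hamiltonian γ G σ')) ^ m ∂(disorderLaw P N) ≤
      Real.exp (N * (m + l * Real.sqrt (deriv (mixture P γ) 1) * (meanAbs t - t * q) +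
        l ^ 2 * deriv (mixture P γ) 1)) := by
  rcases T.eq_empty_or_nonempty with rfl | hTne
  · simp only [Finset.sum_empty, Real.zero_rpow hm0.ne', integral_zero]
    positivity
  have : Nonempty T := hTne.to_subtype
  set d := deriv (mixture P γ) 1 with hd
  have hd0 : 0 ≤ d := (mixture_nonneg zero_le_one).trans mixture_one_le_deriv
  set s := l / m with hs
  have hs0 : 0 < s := by positivity
  have hsm : s * m = l := by rw [hs]; field_simp
  set τ : Config N → Fin N → ℝ := fun σ' i => spin σ i * spin σ' i with hτ
  have hττ : ∀ σ₁ σ₂ : Config N, τ σ₁ ⬝ᵥ τ σ₂ = N * overlap σ₁ σ₂ := fun σ₁ σ₂ => by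
    rw [mul_overlap hN]
    refine Finset.sum_congr rfl fun i _ => ?_
    simp only [hτ]
    linear_combination (spin σ₁ i * spin σ₂ i) * spin_mul_self σ i
  have hN' : (0 : ℝ) < N := by positivity
  have hcov : ∀ σ₁ σ₂ : Config N, (s • fieldCoeff P γ σ₁) ⬝ᵥ (s • fieldCoeff P γ σ₂) -
      ((s * √d) • τ σ₁) ⬝ᵥ ((s * √d) • τ σ₂) =
      s ^ 2 * N * (mixture P γ (overlap σ₁ σ₂) - d * overlap σ₁ σ₂) := fun σ₁ σ₂ => by
    simp only [smul_dotProduct, dotProduct_smul, smul_eq_mul, hττ, fieldCoeff_dotProduct hN]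
    linear_combination (-(s ^ 2 * N * overlap σ₁ σ₂)) * Real.mul_self_sqrt hd0
  have hcomp := integral_expSum_rpow_le_of_indep (I := DisorderIndex P N) (K := Fin N) (J := T)
    (a := fun σ' => s • fieldCoeff P γ σ'.1) (b := fun σ' => (s * √d) • τ σ'.1)
    (D := s ^ 2 * N * (mixture P γ 1 - d)) (m := m)
    (mul_nonpos_of_nonneg_of_nonpos (by positivity) (sub_nonpos.2 mixture_one_le_deriv))
    (fun σ' => by rw [hcov, overlap_self hN, mul_one])
    (fun σ₁ σ₂ => by
      rw [hcov]
      refine mul_le_mul_of_nonneg_left ?_ (by positivity)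
      have := mixture_one_sub_le (P := P) (γ := γ)
        (neg_le_of_abs_le (abs_overlap_le_one hN σ₁.1 σ₂.1))
      rw [← hd] at this
      linarith) hm0 hm1
  have hlhs : ∀ G : Disorder P N, ∑ σ' ∈ T, Real.exp (s * hamiltonian γ G σ') =
      expSum (fun σ' : T => s • fieldCoeff P γ σ'.1) G := fun G => by
    rw [expSum, ← Finset.sum_coe_sort T]
    simp only [hamiltonian_eq_dotProduct, smul_dotProduct, smul_eq_mul]
  simp_rw [hlhs]
  refine hcomp.trans ?_
  set μ := l * √d with hμ
  have hμ0 : 0 ≤ μ := by positivity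
  have hcard : (T.card : ℝ) ^ m ≤ Real.exp (N * m) := by
    have h1 : (T.card : ℝ) ≤ 2 ^ N := by
      have := Finset.card_le_univ T
      rw [Fintype.card_fun, Fintype.card_units_int, Fintype.card_fin] at this
      exact_mod_cast this
    have h2 : (2 : ℝ) ^ N ≤ Real.exp N := by
      rw [← mul_one (N : ℝ), Real.exp_nat_mul]
      gcongr
      linarith [Real.exp_one_gt_d9]
    rw [Real.exp_mul]
    exact Real.rpow_le_rpow (by positivity) (h1.trans h2) hm0.le
  have hpt : ∀ w : Fin N → ℝ, expSum (fun σ' : T => (s * √d) • τ σ'.1) w ^ m ≤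
      Real.exp (N * m - N * (μ * (t * q))) * ∏ i, Real.exp (μ * |w i + t|) := by
    intro w
    have h1 : expSum (fun σ' : T => (s * √d) • τ σ'.1) w ≤
        T.card * Real.exp (s * √d * (∑ i, |w i + t| - N * (t * q))) := by
      rw [← Fintype.card_coe T, ← nsmul_eq_mul]
      refine Finset.sum_le_card_nsmul _ _ _ fun σ' _ => Real.exp_le_exp.2 ?_
      rw [smul_dotProduct, smul_eq_mul]
      gcongr
      have h2 : τ σ'.1 ⬝ᵥ w = ∑ i, τ σ'.1 i * (w i + t) - t * (N * overlap σ σ'.1) := by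
        rw [mul_overlap hN, Finset.mul_sum, ← Finset.sum_sub_distrib]
        exact Finset.sum_congr rfl fun i _ => by simp only [hτ]; ring
      have h3 : ∑ i, τ σ'.1 i * (w i + t) ≤ ∑ i, |w i + t| := by
        gcongr with i
        refine (le_abs_self _).trans ?_
        simp only [hτ, abs_mul, abs_spin, one_mul, le_refl]
      have h4 : N * (t * q) ≤ t * (N * overlap σ σ'.1) := by
        rw [mul_left_comm]
        gcongr
        exact hT _ σ'.2
      linarith
    calc _ ≤ (T.card * Real.exp (s * √d * (∑ i, |w i + t| - N * (t * q)))) ^ m :=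
          Real.rpow_le_rpow (expSum_nonneg _ _) h1 hm0.le
      _ = (T.card : ℝ) ^ m * Real.exp (μ * (∑ i, |w i + t| - N * (t * q))) := by
          rw [Real.mul_rpow (by positivity) (Real.exp_pos _).le, ← Real.exp_mul, hμ, ← hsm]
          congr 2
          ring
      _ ≤ Real.exp (N * m) * Real.exp (μ * (∑ i, |w i + t| - N * (t * q))) := by gcongr
      _ = _ := by
          rw [← Real.exp_sum, ← Real.exp_add, ← Real.exp_add, ← Finset.mul_sum]
          congr 1
          ring
  have hint : Integrable (fun w : Fin N → ℝ => ∏ i, Real.exp (μ * |w i + t|)) (gaussianPi (Fin N)) :=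
    Integrable.fintype_prod (f := fun _ x => Real.exp (μ * |x + t|))
      fun _ => integrable_exp_mul_abs_add hμ0 t
  refine (integral_mono (integrable_expSum_rpow _ hm0 hm1) (hint.const_mul _) hpt).trans ?_
  rw [integral_const_mul,
    integral_fintype_prod_eq_pow (ι := Fin N) (fun x : ℝ => Real.exp (μ * |x + t|)),
    Fintype.card_fin]
  calc _ ≤ Real.exp (N * m - N * (μ * (t * q))) * Real.exp (μ * meanAbs t + μ ^ 2) ^ N := by
        refine mul_le_mul_of_nonneg_left (pow_le_pow_left₀ ?_ ?_ N) (Real.exp_pos _).le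
        · exact integral_nonneg fun x => (Real.exp_pos (μ * |x + t|)).le
        · exact integral_exp_mul_abs_add_le hμ0 t
    _ = _ := by
        rw [← Real.exp_nat_mul, ← Real.exp_add]
        congr 1
        rw [hμ, mul_pow, Real.sq_sqrt hd0]
        ring

lemma measurable_hamiltonian (σ : Config N) :
    Measurable fun G : Disorder P N => hamiltonian γ G σ := by
  simp only [hamiltonian_eq_dotProduct, dotProduct]
  fun_prop

/-- The level `a N` is exceeded within overlap at least `q` of `σ` with exponentially small
probability once `a` is above the maximum `√ξ'(1) (E|g + t| - t q)` of the linear comparison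
field. -/
theorem prob_band_exceed_le (hN : 1 ≤ N) (σ : Config N) {q t a η : ℝ} (ht : 0 ≤ t) (hη : 0 < η)
    (hξ : 0 < mixture P γ 1)
    (ha : η ≤ a - Real.sqrt (deriv (mixture P γ) 1) * (meanAbs t - t * q))
    (T : Finset (Config N)) (hT : ∀ σ' ∈ T, q ≤ overlap σ σ') :
    (disorderLaw P N).real {G | ∃ σ' ∈ T, a * N ≤ hamiltonian γ G σ'} ≤
      Real.exp (-(η ^ 2 / (8 * deriv (mixture P γ) 1) * N)) := by
  set d := deriv (mixture P γ) 1 with hd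
  have hd0 : 0 < d := hξ.trans_le mixture_one_le_deriv
  set l := η / (2 * d) with hl
  have hl0 : 0 < l := by positivity
  -- the number of configurations costs `e^{N m}`, which this `m` makes at most half of the gain
  set m := min 1 (η ^ 2 / (8 * d)) with hm
  have hm0 : 0 < m := lt_min one_pos (by positivity)
  have hm1 : m ≤ 1 := min_le_left _ _
  have hm2 : m ≤ η ^ 2 / (8 * d) := min_le_right _ _
  have hN' : (0 : ℝ) < N := by positivity
  rcases T.eq_empty_or_nonempty with rfl | hTne
  · simp only [Finset.notMem_empty, false_and, exists_false, Set.ofPred_false, measureReal_empty]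
    positivity
  have : Nonempty T := hTne.to_subtype
  have hbd := integral_bandSum_le (P := P) (γ := γ) hN σ ht hl0 hm0 hm1 T hT
  set Φ : Disorder P N → ℝ := fun G =>
    (∑ σ' ∈ T, Real.exp (l / m * hamiltonian γ G σ')) ^ m with hΦ
  have hint : Integrable Φ (disorderLaw P N) := by
    refine (integrable_expSum_rpow (J := T) (fun σ' => (l / m) • fieldCoeff P γ σ'.1) hm0 hm1).congr
      (ae_of_all _ fun G => ?_)
    simp only [hΦ, expSum, ← Finset.sum_coe_sort T, hamiltonian_eq_dotProduct, smul_dotProduct,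
      smul_eq_mul]
  have hΦ0 : ∀ G, 0 ≤ Φ G := fun G =>
    Real.rpow_nonneg (Finset.sum_nonneg fun _ _ => (Real.exp_pos _).le) _
  have hmarkov := mul_meas_ge_le_integral_of_nonneg (ae_of_all _ hΦ0) hint (Real.exp (l * (a * N)))
  have hset : {G : Disorder P N | ∃ σ' ∈ T, a * N ≤ hamiltonian γ G σ'} ⊆
      {G | Real.exp (l * (a * N)) ≤ Φ G} := by
    rintro G ⟨σ', hσ', h⟩
    have h1 : Real.exp (l / m * (a * N)) ≤ ∑ σ' ∈ T, Real.exp (l / m * hamiltonian γ G σ') :=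
      (Real.exp_le_exp.2 (by gcongr)).trans (Finset.single_le_sum
        (f := fun σ' => Real.exp (l / m * hamiltonian γ G σ')) (fun _ _ => (Real.exp_pos _).le) hσ')
    have h2 := Real.rpow_le_rpow (Real.exp_pos _).le h1 hm0.le
    rw [← Real.exp_mul] at h2
    refine le_trans (le_of_eq ?_) h2
    congr 1
    field_simp
  have h := (mul_le_mul_of_nonneg_left (measureReal_mono hset) (Real.exp_pos _).le).trans
    (hmarkov.trans hbd)
  rw [mul_comm, ← le_div_iff₀ (Real.exp_pos _), ← Real.exp_sub] at h
  refine h.trans (Real.exp_le_exp.2 ?_)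
  have h1 : l * η ≤ l * (a - √d * (meanAbs t - t * q)) := by gcongr
  have h2 : l * η - l ^ 2 * d = 2 * (η ^ 2 / (8 * d)) := by
    rw [hl]
    field_simp
    ring
  have h3 : m + l * √d * (meanAbs t - t * q) + l ^ 2 * d - l * a ≤ -(η ^ 2 / (8 * d)) := by
    linarith
  calc _ = N * (m + l * √d * (meanAbs t - t * q) + l ^ 2 * d - l * a) := by ring
    _ ≤ N * (-(η ^ 2 / (8 * d))) := by gcongr
    _ = _ := by ring

end Band

/-! ### Mean absolute value of a shifted Gaussian variable -/

section MeanAbs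

/-- `E |g + t| = 2 φ(t) + t (2 Φ(t) - 1)`. -/
lemma meanAbs_eq (t : ℝ) :
    meanAbs t = 2 * gaussianPDFReal 0 1 t + t * (2 * cdf (gaussianReal 0 1) t - 1) := by
  set μ := gaussianReal 0 1 with hμ
  set φ : ℝ → ℝ := gaussianPDFReal 0 1 with hφ
  have hid : Integrable (fun x : ℝ => x) μ := (memLp_id_gaussianReal (1 : NNReal)).integrable (by simp)
  have hid' : Integrable (fun x => φ x * x) := by
    have := hid
    rw [hμ, gaussianReal_of_var_ne_zero _ one_ne_zero, integrable_withDensity_iff_integrable_smul'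
      (measurable_gaussianPDF _ _) (ae_of_all _ fun _ => gaussianPDF_lt_top)] at this
    simpa [toReal_gaussianPDF] using this
  have hφint : Integrable φ := integrable_gaussianPDFReal 0 1
  have hφd : ∀ x, HasDerivAt (fun x => -φ x) (φ x * x) x := by
    intro x
    have h1 : HasDerivAt (fun x : ℝ => -(x ^ 2) / 2) (-x) x := by
      have := ((hasDerivAt_pow 2 x).neg).div_const 2
      convert! this using 1
      simp
      ring
    have h2 := ((h1.exp).const_mul ((√(2 * Real.pi))⁻¹)).neg
    convert! h2 using 1
    · ext y
      simp [hφ, gaussianPDFReal]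
    · simp [hφ, gaussianPDFReal]
      ring
  have hlim : Tendsto (fun x => -φ x) atTop (𝓝 0) := by
    have h1 : Tendsto (fun x : ℝ => -(x ^ 2) / 2) atTop atBot := by
      have : Tendsto (fun x : ℝ => x ^ 2) atTop atTop := tendsto_pow_atTop (by norm_num)
      exact (tendsto_neg_atTop_atBot.comp this).atBot_div_const (by norm_num)
    have h2 := ((Real.tendsto_exp_atBot.comp h1).const_mul ((√(2 * Real.pi))⁻¹)).neg
    simp only [mul_zero, neg_zero] at h2
    refine h2.congr fun x => ?_
    simp [hφ, gaussianPDFReal]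
  have hI1 : ∀ c, ∫ x in Ioi c, φ x * x = φ c := fun c => by
    rw [integral_Ioi_of_hasDerivAt_of_tendsto' (fun x _ => hφd x) hid'.integrableOn hlim]
    ring
  have hcdf : ∀ c, cdf μ c = 1 - ∫ x in Ioi c, φ x := fun c => by
    rw [cdf_eq_real, ← compl_Ioi, probReal_compl_eq_one_sub measurableSet_Ioi, measureReal_def, hμ,
      gaussianReal_apply_eq_integral _ one_ne_zero, ENNReal.toReal_ofReal]
    exact integral_nonneg fun _ => gaussianPDFReal_nonneg _ _ _
  have hpos : ∫ x, max (x - t) 0 ∂μ = φ t - t * (1 - cdf μ t) := by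
    rw [hμ, integral_gaussianReal_eq_integral_smul one_ne_zero, ← hμ, hcdf]
    have h1 : ∀ x, gaussianPDFReal 0 1 x • max (x - t) 0 =
        (Ioi t).indicator (fun x => φ x * x - t * φ x) x := fun x => by
      by_cases hx : t < x
      · rw [indicator_of_mem (mem_Ioi.2 hx), max_eq_left (by linarith), smul_eq_mul]
        ring
      · rw [indicator_of_notMem (by simpa using hx), max_eq_right (by linarith), smul_zero]
    simp_rw [h1]
    rw [integral_indicator measurableSet_Ioi, integral_sub hid'.integrableOn
      (hφint.const_mul t).integrableOn, hI1, integral_const_mul]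
    ring
  have hsymm : ∫ x, |x + t| ∂μ = ∫ x, |x - t| ∂μ := by
    have h := integral_map (μ := μ) (φ := fun x : ℝ => -x) (by fun_prop) (f := fun x => |x + t|)
      (by fun_prop)
    rw [hμ, gaussianReal_map_neg, neg_zero] at h
    rw [hμ, h]
    congr 1 with x
    rw [← abs_neg]
    ring_nf
  have habs : ∀ x, |x - t| = 2 * max (x - t) 0 - (x - t) := fun x => by
    rcases le_total 0 (x - t) with h | h
    · rw [abs_of_nonneg h, max_eq_left h]; ring
    · rw [abs_of_nonpos h, max_eq_right h]; ring
  have hmaxint : Integrable (fun x => max (x - t) 0) μ := (hid.sub (integrable_const t)).pos_part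
  rw [meanAbs, hsymm]
  have hsub : Integrable (fun x => x - t) μ := hid.sub (integrable_const t)
  simp_rw [habs]
  rw [integral_sub (hmaxint.const_mul 2) hsub, integral_const_mul, hpos,
    integral_sub hid (integrable_const t), integral_const, probReal_univ, integral_id_gaussianReal]
  simp only [one_smul]
  ring

end MeanAbs

/-! ### Concentration of the partition function -/

section Partition

variable {P N : ℕ} {γ : ℕ → ℝ}

lemma partitionFunction_pos (β : ℝ) (G : Disorder P N) : 0 < partitionFunction γ β G :=
  Finset.sum_pos (fun _ _ => Real.exp_pos _) ⟨fun _ => 1, Finset.mem_univ _⟩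

lemma measurable_partitionFunction (β : ℝ) :
    Measurable fun G : Disorder P N => partitionFunction γ β G :=
  Finset.measurable_sum _ fun σ _ => ((measurable_hamiltonian σ).const_mul β).exp

lemma smul_fieldCoeff_dotProduct_self (hN : 1 ≤ N) (β : ℝ) (σ : Config N) :
    (β • fieldCoeff P γ σ) ⬝ᵥ (β • fieldCoeff P γ σ) = N * (β ^ 2 * mixture P γ 1) := by
  rw [smul_dotProduct, dotProduct_smul, fieldCoeff_dotProduct hN, overlap_self hN]
  simp only [smul_eq_mul]
  ring

lemma log_sum_exp_le {ι : Type*} [Fintype ι] [Nonempty ι] {f g : ι → ℝ} {c : ℝ}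
    (h : ∀ i, f i ≤ g i + c) :
    Real.log (∑ i, Real.exp (f i)) ≤ Real.log (∑ i, Real.exp (g i)) + c := by
  have hpos : ∀ f : ι → ℝ, 0 < ∑ i, Real.exp (f i) := fun f =>
    Finset.sum_pos (fun _ _ => Real.exp_pos _) Finset.univ_nonempty
  rw [← Real.log_exp c, ← Real.log_mul (hpos g).ne' (Real.exp_pos c).ne',
    Finset.sum_mul]
  refine Real.log_le_log (hpos f) (Finset.sum_le_sum fun i _ => ?_)
  rw [← Real.exp_add]
  exact Real.exp_le_exp.2 (h i)

/-- The Lipschitz constants of `log Z_N(β)` in the individual disorder variables. -/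
def logPartitionLip (P N : ℕ) (γ : ℕ → ℝ) (β : ℝ) (x : DisorderIndex P N) : ℝ :=
  |β| * |fieldCoeff P γ (fun _ => 1 : Config N) x|

lemma abs_fieldCoeff (σ σ' : Config N) (x : DisorderIndex P N) :
    |fieldCoeff P γ σ x| = |fieldCoeff P γ σ' x| := by
  simp only [fieldCoeff, abs_mul, Finset.abs_prod, abs_spin, Finset.prod_const_one]

lemma logPartitionLip_nonneg (β : ℝ) (x : DisorderIndex P N) : 0 ≤ logPartitionLip P N γ β x := by
  unfold logPartitionLip
  positivity

lemma sum_logPartitionLip_sq (hN : 1 ≤ N) (β : ℝ) :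
    ∑ x, logPartitionLip P N γ β x ^ 2 = N * (β ^ 2 * mixture P γ 1) := by
  rw [← smul_fieldCoeff_dotProduct_self hN β (fun _ => 1)]
  simp only [logPartitionLip, dotProduct, Pi.smul_apply, smul_eq_mul]
  refine Finset.sum_congr rfl fun x _ => ?_
  rw [mul_pow, sq_abs, sq_abs]
  ring

lemma abs_log_partitionFunction_sub_le (β : ℝ) (G G' : Disorder P N) :
    |Real.log (partitionFunction γ β G) - Real.log (partitionFunction γ β G')| ≤
      ∑ x, logPartitionLip P N γ β x * |G x - G' x| := by
  have h : ∀ G G' : Disorder P N, Real.log (partitionFunction γ β G) ≤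
      Real.log (partitionFunction γ β G') + ∑ x, logPartitionLip P N γ β x * |G x - G' x| := by
    intro G G'
    refine log_sum_exp_le fun σ => ?_
    have h1 : β * hamiltonian γ G σ - β * hamiltonian γ G' σ =
        ∑ x, β * fieldCoeff P γ σ x * (G x - G' x) := by
      rw [hamiltonian_eq_dotProduct, hamiltonian_eq_dotProduct, ← mul_sub, ← dotProduct_sub,
        dotProduct, Finset.mul_sum]
      exact Finset.sum_congr rfl fun x _ => by simp only [Pi.sub_apply]; ring
    have h2 : ∑ x, β * fieldCoeff P γ σ x * (G x - G' x) ≤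
        ∑ x, logPartitionLip P N γ β x * |G x - G' x| := by
      refine Finset.sum_le_sum fun x _ => (le_abs_self _).trans (le_of_eq ?_)
      rw [abs_mul, abs_mul, abs_fieldCoeff σ (fun _ => 1), logPartitionLip]
    linarith
  rw [abs_le]
  have h1 := h G G'
  have h2 := h G' G
  simp only [abs_sub_comm (G' _)] at h2
  constructor <;> linarith

lemma integrable_log_partitionFunction (β : ℝ) :
    Integrable (fun G : Disorder P N => Real.log (partitionFunction γ β G)) (disorderLaw P N) :=
  integrable_of_coord_lipschitz (logPartitionLip_nonneg β) (abs_log_partitionFunction_sub_le β)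

/-- The lower tail of the partition function, given a lower bound on the free energy. -/
lemma prob_partitionFunction_le (hN : 1 ≤ N) {β : ℝ} (hβ : 0 < β) (hξ : 0 < mixture P γ 1)
    {f r : ℝ} (hr : 0 ≤ r) (hf : f ≤ freeEnergy P γ β N) :
    (disorderLaw P N).real {G | partitionFunction γ β G ≤ Real.exp (N * (f - r))} ≤
      Real.exp (-(r ^ 2 / (4 * (β ^ 2 * mixture P γ 1)) * N)) := by
  have hN' : (0 : ℝ) < N := by positivity
  have h := prob_le_integral_add_le (logPartitionLip_nonneg (P := P) (N := N) (γ := γ) β)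
    (abs_log_partitionFunction_sub_le β) (sum_logPartitionLip_sq hN β) (by positivity)
    (r := N * r) (by positivity)
  refine (measureReal_mono ?_).trans (h.trans (Real.exp_le_exp.2 (le_of_eq ?_)))
  · intro G hG
    have h1 : Real.log (partitionFunction γ β G) ≤ N * (f - r) := by
      rw [← Real.log_exp (N * (f - r))]
      exact Real.log_le_log (partitionFunction_pos β G) hG
    rw [freeEnergy, le_div_iff₀ hN'] at hf
    change Real.log (partitionFunction γ β G) + N * r ≤
      ∫ G, Real.log (partitionFunction γ β G) ∂(disorderLaw P N)
    linarith
  · field_simp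

end Partition

/-! ### Planted disorder -/

section Planting

variable {P N : ℕ} {γ : ℕ → ℝ}

lemma gibbs_nonneg (β : ℝ) (G : Disorder P N) (A : Set (Config N)) : 0 ≤ gibbs γ β G A :=
  Finset.sum_nonneg fun σ _ => by
    split_ifs
    · exact div_nonneg (Real.exp_pos _).le (partitionFunction_pos β G).le
    · exact le_rfl

lemma gibbs_le_one (β : ℝ) (G : Disorder P N) (A : Set (Config N)) : gibbs γ β G A ≤ 1 := by
  have hZ := partitionFunction_pos (γ := γ) β G
  calc gibbs γ β G A ≤ ∑ σ, Real.exp (β * hamiltonian γ G σ) / partitionFunction γ β G := by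
        refine Finset.sum_le_sum fun σ _ => ?_
        split_ifs
        · exact le_rfl
        · positivity
    _ = 1 := by rw [← Finset.sum_div]; exact div_self hZ.ne'

lemma gibbs_empty (β : ℝ) (G : Disorder P N) : gibbs γ β G ∅ = 0 := by
  simp [gibbs]

/-- The annealed comparison with the planted model: up to the event that the partition function is
below `z`, the expected Gibbs mass of a random set is bounded by its probability of containing a
configuration `σ` when the disorder is shifted by the signal `β ∇H(σ)`. -/
lemma integral_gibbs_le (hN : 1 ≤ N) (β : ℝ) {z : ℝ} (hz : 0 < z)
    (A : Disorder P N × Disorder P N → Set (Config N))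
    (hA : ∀ σ, MeasurableSet {ω | σ ∈ A ω}) :
    ∫ ω, gibbs γ β ω.1 (A ω) ∂((disorderLaw P N).prod (disorderLaw P N)) ≤
      (disorderLaw P N).real {G | partitionFunction γ β G ≤ z} +
        z⁻¹ * ∑ σ : Config N, Real.exp (N * (β ^ 2 * mixture P γ 1 / 2)) *
          ((disorderLaw P N).prod (disorderLaw P N)).real
            {ω | σ ∈ A (ω.1 + β • fieldCoeff P γ σ, ω.2)} := by
  set ν := disorderLaw P N with hν
  set B : Set (Disorder P N) := {G | partitionFunction γ β G ≤ z} with hB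
  have hBm : MeasurableSet B := measurableSet_le (measurable_partitionFunction β) measurable_const
  set f : Config N → Disorder P N × Disorder P N → ℝ := fun σ ω =>
    Real.exp (β * hamiltonian γ ω.1 σ) * {ω | σ ∈ A ω}.indicator 1 ω with hf
  have hexpint : ∀ σ, Integrable (fun ω : Disorder P N × Disorder P N =>
      Real.exp (β * hamiltonian γ ω.1 σ)) (ν.prod ν) := fun σ => by
    have h : Integrable (fun ω : Disorder P N × Disorder P N =>
        Real.exp ((β • fieldCoeff P γ σ) ⬝ᵥ ω.1)) (ν.prod ν) :=
      (integrable_exp_dotProduct (β • fieldCoeff P γ σ)).comp_fst ν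
    simpa only [hamiltonian_eq_dotProduct, smul_dotProduct, smul_eq_mul] using h
  have hfint : ∀ σ, Integrable (f σ) (ν.prod ν) := fun σ => by
    refine (hexpint σ).mul_bdd (c := 1) ?_ (ae_of_all _ fun ω => ?_)
    · exact (measurable_one.indicator (hA σ)).aestronglyMeasurable
    · by_cases h : ω ∈ {ω | σ ∈ A ω}
      · simp [indicator_of_mem h]
      · simp [indicator_of_notMem h]
  have hBint : Integrable (fun ω : Disorder P N × Disorder P N => B.indicator (1 : Disorder P N → ℝ) ω.1)
      (ν.prod ν) :=
    ((integrable_const (1 : ℝ)).indicator hBm : Integrable (B.indicator (1 : Disorder P N → ℝ)) ν).comp_fst ν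
  have hsumint : Integrable (fun ω => z⁻¹ * ∑ σ, f σ ω) (ν.prod ν) :=
    (integrable_finsetSum _ fun σ _ => hfint σ).const_mul _
  have hpt : ∀ ω : Disorder P N × Disorder P N, gibbs γ β ω.1 (A ω) ≤
      B.indicator (1 : Disorder P N → ℝ) ω.1 + z⁻¹ * ∑ σ, f σ ω := by
    intro ω
    have hf0 : ∀ σ, 0 ≤ f σ ω := fun σ =>
      mul_nonneg (Real.exp_pos _).le (indicator_nonneg (fun _ _ => zero_le_one) _)
    by_cases hω : ω.1 ∈ B
    · rw [indicator_of_mem hω]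
      have : 0 ≤ z⁻¹ * ∑ σ, f σ ω := mul_nonneg (by positivity) (Finset.sum_nonneg fun σ _ => hf0 σ)
      have h1 := gibbs_le_one (γ := γ) β ω.1 (A ω)
      simp only [Pi.one_apply]
      linarith
    · rw [indicator_of_notMem hω, zero_add, Finset.mul_sum]
      refine Finset.sum_le_sum fun σ _ => ?_
      have hzZ : z ≤ partitionFunction γ β ω.1 := (not_le.1 hω).le
      split_ifs with h
      · have : ω ∈ {ω | σ ∈ A ω} := h
        simp only [hf, indicator_of_mem this, Pi.one_apply, mul_one]
        rw [div_eq_inv_mul]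
        gcongr
      · exact mul_nonneg (by positivity) (hf0 σ)
  have hfi : ∀ σ, ∫ ω, f σ ω ∂(ν.prod ν) = Real.exp (N * (β ^ 2 * mixture P γ 1 / 2)) *
      (ν.prod ν).real {ω | σ ∈ A (ω.1 + β • fieldCoeff P γ σ, ω.2)} := by
    intro σ
    set v := β • fieldCoeff P γ σ with hv
    have hvv : v ⬝ᵥ v / 2 = N * (β ^ 2 * mixture P γ 1 / 2) := by
      rw [hv, smul_fieldCoeff_dotProduct_self hN]
      ring
    have hS : MeasurableSet {ω : Disorder P N × Disorder P N | σ ∈ A (ω.1 + v, ω.2)} :=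
      (by fun_prop : Measurable fun ω : Disorder P N × Disorder P N => (ω.1 + v, ω.2)) (hA σ)
    have hSint : Integrable ({ω : Disorder P N × Disorder P N | σ ∈ A (ω.1 + v, ω.2)}.indicator
        (1 : Disorder P N × Disorder P N → ℝ)) (ν.prod ν) := (integrable_const (1 : ℝ)).indicator hS
    rw [← integral_indicator_one hS, integral_prod_symm _ (hfint σ), integral_prod_symm _ hSint,
      ← integral_const_mul]
    congr 1 with G'
    have h := integral_add_gaussianPi (fun G => {ω | σ ∈ A ω}.indicator (1 : Disorder P N × Disorder P N → ℝ) (G, G')) v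
    have h2 : ∀ G : Disorder P N, f σ (G, G') = Real.exp (v ⬝ᵥ v / 2) *
        (Real.exp (v ⬝ᵥ G - v ⬝ᵥ v / 2) * {ω | σ ∈ A ω}.indicator (1 : Disorder P N × Disorder P N → ℝ) (G, G')) := fun G => by
      rw [← mul_assoc, ← Real.exp_add, add_sub_cancel, hv, smul_dotProduct, smul_eq_mul,
        ← hamiltonian_eq_dotProduct]
    simp_rw [h2]
    rw [integral_const_mul, hvv]
    rw [hvv] at h
    exact congrArg _ h.symm
  calc _ ≤ ∫ ω, (B.indicator (1 : Disorder P N → ℝ) ω.1 + z⁻¹ * ∑ σ, f σ ω) ∂(ν.prod ν) :=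
        integral_mono_of_nonneg (ae_of_all _ fun ω => gibbs_nonneg _ _ _) (hBint.add hsumint)
          (ae_of_all _ hpt)
    _ = _ := by
        rw [integral_add hBint hsumint, integral_const_mul, integral_finsetSum _ fun σ _ => hfint σ,
          integral_fun_fst (fun G => B.indicator (1 : Disorder P N → ℝ) G), integral_indicator_one hBm]
        simp only [hfi, probReal_univ, one_smul]

/-- The values taken by the overlap lie in `{k / N : |k| ≤ N}`. -/
lemma card_image_overlap_le (hN : 1 ≤ N) (σ : Config N) (T : Finset (Config N)) :
    (T.image (overlap σ)).card ≤ 2 * N + 1 := by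
  have hN' : (0 : ℝ) < N := by positivity
  have hsub : T.image (overlap σ) ⊆
      (Finset.Icc (-(N : ℤ)) N).image fun k : ℤ => (k : ℝ) / N := by
    intro v hv
    obtain ⟨σ', _, rfl⟩ := Finset.mem_image.1 hv
    refine Finset.mem_image.2 ⟨∑ i, (σ i : ℤ) * (σ' i : ℤ), ?_, ?_⟩
    · have h := abs_overlap_le_one hN σ σ'
      rw [overlap, abs_div, abs_of_pos hN', div_le_one hN'] at h
      have h2 : |∑ i, (σ i : ℤ) * (σ' i : ℤ)| ≤ (N : ℤ) := by
        have : |((∑ i, (σ i : ℤ) * (σ' i : ℤ) : ℤ) : ℝ)| ≤ N := by simpa [spin] using h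
        exact_mod_cast this
      exact Finset.mem_Icc.2 (abs_le.1 h2)
    · simp [overlap, spin]
  refine (Finset.card_le_card hsub).trans (Finset.card_image_le.trans ?_)
  rw [Int.card_Icc]
  omega

/-- A level depending on the overlap with `σ`: the overlap takes at most `2 N + 1` values, and
`prob_band_exceed_le` applies to each of them with its own multiplier. -/
lemma prob_exists_overlap_le (hN : 1 ≤ N) (hξ : 0 < mixture P γ 1) {η : ℝ} (hη : 0 < η)
    (σ : Config N) (a : ℝ → ℝ) (T : Finset (Config N))
    (hT : ∀ σ' ∈ T, ∃ t, 0 ≤ t ∧ η ≤ a (overlap σ σ') -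
      Real.sqrt (deriv (mixture P γ) 1) * (meanAbs t - t * overlap σ σ')) :
    (disorderLaw P N).real {G | ∃ σ' ∈ T, a (overlap σ σ') * N ≤ hamiltonian γ G σ'} ≤
      (2 * N + 1) * Real.exp (-(η ^ 2 / (8 * deriv (mixture P γ) 1) * N)) := by
  classical
  have hsub : {G : Disorder P N | ∃ σ' ∈ T, a (overlap σ σ') * N ≤ hamiltonian γ G σ'} ⊆
      ⋃ v ∈ T.image (overlap σ),
        {G | ∃ σ' ∈ T.filter (fun σ' => overlap σ σ' = v), a v * N ≤ hamiltonian γ G σ'} := by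
    rintro G ⟨σ', hσ', h⟩
    exact mem_biUnion (x := overlap σ σ') (Finset.mem_image_of_mem _ hσ')
      ⟨σ', Finset.mem_filter.2 ⟨hσ', rfl⟩, h⟩
  refine (measureReal_mono hsub (measure_ne_top _ _)).trans
    ((measureReal_biUnion_finset_le _ _).trans ?_)
  have hcard : ((T.image (overlap σ)).card : ℝ) ≤ 2 * N + 1 := by
    exact_mod_cast card_image_overlap_le hN σ T
  refine le_trans (Finset.sum_le_card_nsmul _ _
    (Real.exp (-(η ^ 2 / (8 * deriv (mixture P γ) 1) * N))) fun v hv => ?_) ?_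
  · obtain ⟨σ', hσ', rfl⟩ := Finset.mem_image.1 hv
    obtain ⟨t, ht, h⟩ := hT σ' hσ'
    exact prob_band_exceed_le hN σ ht hη hξ h _ fun σ'' hσ'' => (Finset.mem_filter.1 hσ'').2.ge
  · rw [nsmul_eq_mul]
    gcongr

lemma measurable_correlated (τ : ℝ) :
    Measurable fun ω : Disorder P N × Disorder P N => correlated τ ω.1 ω.2 := by
  unfold correlated
  fun_prop

lemma measurePreserving_correlated {τ : ℝ} (hτ : τ ∈ Icc (0 : ℝ) 1) :
    MeasurePreserving (fun ω : Disorder P N × Disorder P N => correlated τ ω.1 ω.2)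
      ((disorderLaw P N).prod (disorderLaw P N)) (disorderLaw P N) := by
  refine measurePreserving_rotation ?_
  rw [Real.sq_sqrt (by nlinarith [hτ.1, hτ.2])]
  ring

/-- Under the planted shift the Hamiltonian gains the signal `(1 - τ) β N ξ(⟨σ, σ'⟩ / N)`. -/
lemma hamiltonian_correlated_shift (hN : 1 ≤ N) (τ β : ℝ) (G G' : Disorder P N) (σ σ' : Config N) :
    hamiltonian γ (correlated τ (G + β • fieldCoeff P γ σ) G') σ' =
      hamiltonian γ (correlated τ G G') σ' + (1 - τ) * β * mixture P γ (overlap σ σ') * N := by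
  simp only [hamiltonian_eq_dotProduct, correlated, dotProduct_add, dotProduct_smul, smul_eq_mul,
    fieldCoeff_dotProduct hN, overlap_comm σ' σ]
  ring

/-- The bound on the expected Gibbs mass of configurations having a correlated near-optimum in the
overlap window, in terms of the deficit of the free energy and of the margin `η` by which the
planted level exceeds the linear comparison field in the window. -/
theorem gibbsOverlapMass_le (hN : 1 ≤ N) (hξ : 0 < mixture P γ 1) {β β' η Δ r qlo qhi τ : ℝ}
    (hβ : 0 < β) (hη : 0 < η) (hr : 0 ≤ r) (hqlo : 0 ≤ qlo) (hτ : τ ∈ Icc (0 : ℝ) 1)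
    (hband : ∀ v, qlo ≤ v → v ≤ qhi → ∃ t, 0 ≤ t ∧ η ≤ β' * mixture P γ 1 - β * mixture P γ v -
      Real.sqrt (deriv (mixture P γ) 1) * (meanAbs t - t * v))
    (hf : β ^ 2 * mixture P γ 1 / 2 + Real.log 2 - Δ ≤ freeEnergy P γ β N) :
    gibbsOverlapMass P γ N β β' τ qlo qhi ≤
      Real.exp (-(r ^ 2 / (4 * (β ^ 2 * mixture P γ 1)) * N)) +
        Real.exp ((Δ + r) * N) *
          ((2 * N + 1) * Real.exp (-(η ^ 2 / (8 * deriv (mixture P γ) 1) * N))) := by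
  classical
  set f := β ^ 2 * mixture P γ 1 / 2 + Real.log 2 - Δ with hfdef
  set A : Disorder P N × Disorder P N → Set (Config N) := fun ω =>
    {σ | ∃ σ' ∈ superLevel γ β' (correlated τ ω.1 ω.2), qlo ≤ overlap σ σ' ∧ overlap σ σ' ≤ qhi}
    with hA
  have hAmeas : ∀ σ, MeasurableSet {ω | σ ∈ A ω} := by
    intro σ
    have : {ω | σ ∈ A ω} = ⋃ σ' ∈ Finset.univ.filter
        (fun σ' : Config N => qlo ≤ overlap σ σ' ∧ overlap σ σ' ≤ qhi),
        {ω : Disorder P N × Disorder P N |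
          β' * mixture P γ 1 * N ≤ hamiltonian γ (correlated τ ω.1 ω.2) σ'} := by
      ext ω
      simp only [hA, superLevel, Set.mem_ofPred_eq, mem_iUnion, Finset.mem_filter, Finset.mem_univ,
        true_and, exists_prop]
      constructor
      · rintro ⟨σ', h1, h2⟩; exact ⟨σ', h2, h1⟩
      · rintro ⟨σ', h1, h2⟩; exact ⟨σ', h2, h1⟩
    rw [this]
    exact Finset.measurableSet_biUnion _ fun σ' _ =>
      measurableSet_le measurable_const ((measurable_hamiltonian σ').comp (measurable_correlated τ))
  have h := integral_gibbs_le (γ := γ) hN β (Real.exp_pos (N * (f - r))) A hAmeas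
  refine h.trans (add_le_add (prob_partitionFunction_le hN hβ hξ hr hf) ?_)
  have hplant : ∀ σ : Config N, ((disorderLaw P N).prod (disorderLaw P N)).real
      {ω | σ ∈ A (ω.1 + β • fieldCoeff P γ σ, ω.2)} ≤
      (2 * N + 1) * Real.exp (-(η ^ 2 / (8 * deriv (mixture P γ) 1) * N)) := by
    intro σ
    set T := Finset.univ.filter
        (fun σ' : Config N => qlo ≤ overlap σ σ' ∧ overlap σ σ' ≤ qhi) with hT
    set a : ℝ → ℝ := fun v => β' * mixture P γ 1 - β * mixture P γ v with ha
    set S : Set (Disorder P N) := {G | ∃ σ' ∈ T, a (overlap σ σ') * N ≤ hamiltonian γ G σ'} with hS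
    have hSm : MeasurableSet S := by
      have : S = ⋃ σ' ∈ T, {G | a (overlap σ σ') * N ≤ hamiltonian γ G σ'} := by
        ext G
        simp [hS]
      rw [this]
      exact Finset.measurableSet_biUnion _ fun σ' _ =>
        measurableSet_le measurable_const (measurable_hamiltonian σ')
    have hsub : {ω | σ ∈ A (ω.1 + β • fieldCoeff P γ σ, ω.2)} ⊆
        (fun ω : Disorder P N × Disorder P N => correlated τ ω.1 ω.2) ⁻¹' S := by
      rintro ω ⟨σ', hσ', h1, h2⟩
      refine ⟨σ', Finset.mem_filter.2 ⟨Finset.mem_univ _, h1, h2⟩, ?_⟩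
      have h3 : β' * mixture P γ 1 * N ≤ _ := hσ'
      rw [hamiltonian_correlated_shift hN] at h3
      -- the signal is strongest at `τ = 0`
      have h4 : (1 - τ) * β * mixture P γ (overlap σ σ') * N ≤
          1 * β * mixture P γ (overlap σ σ') * N := by
        have := mixture_nonneg (P := P) (γ := γ) (hqlo.trans h1)
        gcongr
        linarith [hτ.1]
      simp only [ha]
      linarith
    refine (measureReal_mono hsub).trans ?_
    rw [(measurePreserving_correlated hτ).measureReal_preimage hSm.nullMeasurableSet]
    refine prob_exists_overlap_le hN hξ hη σ a T fun σ' hσ' => ?_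
    obtain ⟨h1, h2⟩ := (Finset.mem_filter.1 hσ').2
    exact hband _ h1 h2
  calc _ ≤ (Real.exp (N * (f - r)))⁻¹ * ∑ σ : Config N,
        Real.exp (N * (β ^ 2 * mixture P γ 1 / 2)) *
          ((2 * N + 1) * Real.exp (-(η ^ 2 / (8 * deriv (mixture P γ) 1) * N))) := by
        gcongr with σ
        exact hplant σ
    _ = _ := by
        rw [Finset.sum_const, Finset.card_univ, Fintype.card_fun, Fintype.card_units_int,
          Fintype.card_fin, nsmul_eq_mul, ← mul_assoc, ← mul_assoc]
        congr 1
        have h2 : ((2 ^ N : ℕ) : ℝ) = Real.exp (N * Real.log 2) := by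
          rw [Real.exp_nat_mul, Real.exp_log (by norm_num)]
          norm_num
        rw [h2, ← Real.exp_neg, ← Real.exp_add, ← Real.exp_add, hfdef]
        congr 1
        ring

/-- For a fixed configuration there is no signal, so the whole level `β ξ(1)` has to exceed the linear
comparison field. -/
theorem fixedOverlapProb_le (hN : 1 ≤ N) (hξ : 0 < mixture P γ 1) {β η qlo : ℝ} (hη : 0 < η)
    (hband : ∀ v, qlo ≤ v → v ≤ 1 → ∃ t, 0 ≤ t ∧ η ≤ β * mixture P γ 1 -
      Real.sqrt (deriv (mixture P γ) 1) * (meanAbs t - t * v)) (σ : Config N) :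
    fixedOverlapProb P γ β qlo σ ≤
      (2 * N + 1) * Real.exp (-(η ^ 2 / (8 * deriv (mixture P γ) 1) * N)) := by
  classical
  have h := prob_exists_overlap_le hN hξ hη σ (fun _ => β * mixture P γ 1)
    (Finset.univ.filter fun σ' : Config N => qlo ≤ overlap σ σ') fun σ' hσ' =>
      hband _ (Finset.mem_filter.1 hσ').2 ((le_abs_self _).trans (abs_overlap_le_one hN σ σ'))
  refine (measureReal_mono ?_).trans h
  rintro G ⟨σ', hσ', h1⟩
  exact ⟨σ', Finset.mem_filter.2 ⟨Finset.mem_univ _, h1⟩, hσ'⟩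

end Planting

/-! ### Uniform exponential rates -/

section SmallSystems

variable {P N : ℕ} {γ : ℕ → ℝ}

/-- A positive level is avoided by all configurations with positive probability. -/
lemma prob_superLevel_nonempty_lt_one (hN : 1 ≤ N) (hξ : 0 < mixture P γ 1) {β : ℝ} (hβ : 0 < β) :
    (disorderLaw P N).real {G | (superLevel γ β G).Nonempty} < 1 := by
  have hN' : (0 : ℝ) < N := by positivity
  have hpos : (gaussianReal 0 1).IsOpenPosMeasure :=
    (gaussianReal_absolutelyContinuous' 0 one_ne_zero).isOpenPosMeasure
  have hpos' : (disorderLaw P N).IsOpenPosMeasure :=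
    inferInstanceAs (Measure.pi fun _ : DisorderIndex P N => gaussianReal 0 1).IsOpenPosMeasure
  set U : Set (Disorder P N) := {G | ∀ σ, hamiltonian γ G σ < β * mixture P γ 1 * N} with hU
  have hUo : IsOpen U := by
    have : U = ⋂ σ, {G | hamiltonian γ G σ < β * mixture P γ 1 * N} := by
      ext G
      simp [hU]
    rw [this]
    refine isOpen_iInter_of_finite fun σ => isOpen_lt ?_ continuous_const
    simp only [hamiltonian_eq_dotProduct, dotProduct]
    fun_prop
  have hU0 : (0 : Disorder P N) ∈ U := fun σ => by
    rw [hamiltonian_eq_dotProduct, dotProduct_zero]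
    positivity
  have hUpos : 0 < (disorderLaw P N).real U :=
    ENNReal.toReal_pos (hUo.measure_pos _ ⟨0, hU0⟩).ne' (measure_ne_top _ _)
  have hset : {G : Disorder P N | (superLevel γ β G).Nonempty} = Uᶜ := by
    ext G
    simp only [hU, superLevel, Set.Nonempty, Set.mem_ofPred_eq, mem_compl_iff, not_forall, not_lt]
  rw [hset, probReal_compl_eq_one_sub hUo.measurableSet]
  linarith

lemma gibbsOverlapMass_le_prob {τ : ℝ} (hτ : τ ∈ Icc (0 : ℝ) 1) (β β' qlo qhi : ℝ) :
    gibbsOverlapMass P γ N β β' τ qlo qhi ≤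
      (disorderLaw P N).real {G | (superLevel γ β' G).Nonempty} := by
  set S : Set (Disorder P N) := {G | (superLevel γ β' G).Nonempty} with hS
  have hSm : MeasurableSet S := by
    have : S = ⋃ σ, {G | β' * mixture P γ 1 * N ≤ hamiltonian γ G σ} := by
      ext G
      simp [hS, superLevel, Set.Nonempty]
    rw [this]
    exact MeasurableSet.iUnion fun σ => measurableSet_le measurable_const (measurable_hamiltonian σ)
  have hm := measurable_correlated (P := P) (N := N) τ hSm
  rw [← (measurePreserving_correlated hτ).measureReal_preimage hSm.nullMeasurableSet,
    ← integral_indicator_one hm]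
  refine integral_mono_of_nonneg (ae_of_all _ fun ω => gibbs_nonneg _ _ _)
    ((integrable_const (1 : ℝ)).indicator hm) (ae_of_all _ fun ω => ?_)
  by_cases hω : ω ∈ (fun ω : Disorder P N × Disorder P N => correlated τ ω.1 ω.2) ⁻¹' S
  · rw [indicator_of_mem hω]
    exact gibbs_le_one _ _ _
  · rw [indicator_of_notMem hω]
    have hempty : superLevel γ β' (correlated τ ω.1 ω.2) = ∅ := not_nonempty_iff_eq_empty.1 hω
    simp [hempty, gibbs_empty]

lemma fixedOverlapProb_le_prob (β qlo : ℝ) (σ : Config N) :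
    fixedOverlapProb P γ β qlo σ ≤ (disorderLaw P N).real {G | (superLevel γ β G).Nonempty} :=
  measureReal_mono fun _ ⟨σ', h, _⟩ => ⟨σ', h⟩

end SmallSystems

section Margin

variable {P : ℕ} {γ : ℕ → ℝ}

/-- An exponential bound that holds for every system size with a rate depending on the size, and
with a fixed rate for large sizes, holds with one rate for all sizes. -/
lemma exists_uniform_rate {Q : ℕ → ℝ → Prop} (hanti : ∀ N c c', c' ≤ c → Q N c → Q N c')
    (hsmall : ∀ N, 1 ≤ N → ∃ c, 0 < c ∧ Q N c) (hlarge : ∃ c, 0 < c ∧ ∀ᶠ N in atTop, Q N c) :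
    ∃ c, 0 < c ∧ ∀ N, 1 ≤ N → Q N c := by
  obtain ⟨c₀, hc₀, h⟩ := hlarge
  obtain ⟨N₀, hN₀⟩ := eventually_atTop.1 h
  have key : ∀ n : ℕ, ∃ c, 0 < c ∧ ∀ N, 1 ≤ N → N < n → Q N c := by
    intro n
    induction n with
    | zero => exact ⟨1, one_pos, fun N _ h => absurd h (by omega)⟩
    | succ n ih =>
      obtain ⟨c, hc, hQ⟩ := ih
      rcases Nat.eq_zero_or_pos n with rfl | hn
      · exact ⟨1, one_pos, fun N _ h => absurd h (by omega)⟩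
      · obtain ⟨c', hc', hQ'⟩ := hsmall n hn
        refine ⟨min c c', lt_min hc hc', fun N hN hlt => ?_⟩
        rcases Nat.lt_succ_iff_lt_or_eq.1 hlt with h | rfl
        · exact hanti _ _ _ (min_le_left _ _) (hQ N hN h)
        · exact hanti _ _ _ (min_le_right _ _) hQ'
  obtain ⟨c, hc, hQ⟩ := key N₀
  refine ⟨min c c₀, lt_min hc hc₀, fun N hN => ?_⟩
  rcases lt_or_ge N N₀ with h | h
  · exact hanti _ _ _ (min_le_left _ _) (hQ N hN h)
  · exact hanti _ _ _ (min_le_right _ _) (hN₀ N h)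

lemma exists_rate_of_lt_one {b : ℝ} (hb : b < 1) {N : ℕ} (hN : 1 ≤ N) :
    ∃ c, 0 < c ∧ b ≤ Real.exp (-(c * N)) := by
  have hN' : (0 : ℝ) < N := by positivity
  refine ⟨(1 - b) / N, by have := sub_pos.2 hb; positivity, ?_⟩
  rw [div_mul_cancel₀ _ hN'.ne']
  linarith [Real.add_one_le_exp (-(1 - b))]

/-- Polynomial factors are absorbed in exponential rates. -/
lemma eventually_poly_mul_exp_le {a b : ℝ} (ha : 0 < a) (hb : 0 < b) :
    ∃ c, 0 < c ∧ ∀ᶠ N : ℕ in atTop,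
      Real.exp (-(a * N)) + (2 * N + 1) * Real.exp (-(b * N)) ≤ Real.exp (-(c * N)) := by
  set c := min a b / 2 with hc
  have hc0 : 0 < c := by have := lt_min ha hb; positivity
  have hca : 2 * c ≤ a := by rw [hc]; linarith [min_le_left a b]
  have hcb : 2 * c ≤ b := by rw [hc]; linarith [min_le_right a b]
  refine ⟨c, hc0, ?_⟩
  have hlim : Tendsto (fun N : ℕ => (2 * (N : ℝ) + 2) * Real.exp (-(c * N))) atTop (𝓝 0) := by
    have h1 := (Real.tendsto_pow_mul_exp_neg_atTop_nhds_zero 1).comp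
      (tendsto_natCast_atTop_atTop.const_mul_atTop hc0)
    have h0 := (Real.tendsto_pow_mul_exp_neg_atTop_nhds_zero 0).comp
      (tendsto_natCast_atTop_atTop.const_mul_atTop hc0)
    have := (h1.const_mul (2 / c)).add (h0.const_mul 2)
    simp only [mul_zero, add_zero] at this
    refine this.congr fun N => ?_
    simp only [Function.comp]
    field_simp
  filter_upwards [hlim.eventually (gt_mem_nhds one_pos)] with N hN
  have hN0 : (0 : ℝ) ≤ N := Nat.cast_nonneg N
  calc _ ≤ Real.exp (-(2 * c * N)) + (2 * N + 1) * Real.exp (-(2 * c * N)) := by gcongr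
    _ = ((2 * (N : ℝ) + 2) * Real.exp (-(c * N))) * Real.exp (-(c * N)) := by
        have : Real.exp (-(2 * c * N)) = Real.exp (-(c * N)) * Real.exp (-(c * N)) := by
          rw [← Real.exp_add]
          ring_nf
        rw [this]
        ring
    _ ≤ 1 * Real.exp (-(c * N)) := by gcongr
    _ = _ := one_mul _

/-- Both exponential bounds hold as soon as the deficit `Δ` of the free energy is smaller than the
large-deviation rate `η² / (8 ξ'(1))` coming from the margin `η`. -/
theorem exists_rate_of_margin (hξ : 0 < mixture P γ 1) {β β' η Δ qlo qhi : ℝ}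
    (hβ : 0 < β) (hβ' : 0 < β') (hη : 0 < η) (hqlo : 0 ≤ qlo)
    (hband : ∀ v, qlo ≤ v → v ≤ qhi → ∃ t, 0 ≤ t ∧ η ≤ β' * mixture P γ 1 - β * mixture P γ v -
      Real.sqrt (deriv (mixture P γ) 1) * (meanAbs t - t * v))
    (hcap : ∀ v, qlo ≤ v → v ≤ 1 → ∃ t, 0 ≤ t ∧ η ≤ β * mixture P γ 1 -
      Real.sqrt (deriv (mixture P γ) 1) * (meanAbs t - t * v))
    (hΔ : Δ < η ^ 2 / (8 * deriv (mixture P γ) 1))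
    (hf : ∀ᶠ N in atTop, β ^ 2 * mixture P γ 1 / 2 + Real.log 2 - Δ ≤ freeEnergy P γ β N) :
    ∃ c, 0 < c ∧
      (∀ N : ℕ, 1 ≤ N → ∀ τ ∈ Icc (0 : ℝ) 1,
        gibbsOverlapMass P γ N β β' τ qlo qhi ≤ Real.exp (-(c * N))) ∧
      (∀ N : ℕ, 1 ≤ N → ∀ σ : Config N, fixedOverlapProb P γ β qlo σ ≤ Real.exp (-(c * N))) := by
  set d := deriv (mixture P γ) 1 with hd
  have hd0 : 0 < d := hξ.trans_le mixture_one_le_deriv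
  set κ := η ^ 2 / (8 * d) with hκ
  have hκ0 : 0 < κ := by positivity
  have hmono : ∀ (N : ℕ) (c c' : ℝ), c' ≤ c → Real.exp (-(c * N)) ≤ Real.exp (-(c' * N)) := by
    intro N c c' h
    gcongr
  obtain ⟨c₁, hc₁, h₁⟩ : ∃ c, 0 < c ∧ ∀ N : ℕ, 1 ≤ N → ∀ τ ∈ Icc (0 : ℝ) 1,
      gibbsOverlapMass P γ N β β' τ qlo qhi ≤ Real.exp (-(c * N)) := by
    refine exists_uniform_rate (fun N c c' hc h τ hτ => (h τ hτ).trans (hmono N c c' hc)) ?_ ?_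
    · intro N hN
      obtain ⟨c, hc, h⟩ := exists_rate_of_lt_one
        (prob_superLevel_nonempty_lt_one (P := P) (γ := γ) hN hξ hβ') hN
      exact ⟨c, hc, fun τ hτ => (gibbsOverlapMass_le_prob hτ _ _ _ _).trans h⟩
    · -- `r` splits the surplus `κ - Δ` between the lower tail of `Z_N(β)` and the planted bound
      set r := (κ - Δ) / 2 with hr
      have hr0 : 0 < r := by rw [hr]; linarith
      obtain ⟨c, hc, h⟩ := eventually_poly_mul_exp_le
        (a := r ^ 2 / (4 * (β ^ 2 * mixture P γ 1))) (b := r) (by positivity) hr0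
      refine ⟨c, hc, ?_⟩
      filter_upwards [h, hf, eventually_ge_atTop 1] with N hN hfN hN1 τ hτ
      refine (gibbsOverlapMass_le hN1 hξ hβ hη hr0.le hqlo hτ hband hfN).trans (le_trans ?_ hN)
      refine add_le_add le_rfl (le_of_eq ?_)
      rw [mul_left_comm, ← Real.exp_add]
      congr 2
      rw [← hd, ← hκ, hr]
      ring
  obtain ⟨c₂, hc₂, h₂⟩ : ∃ c, 0 < c ∧ ∀ N : ℕ, 1 ≤ N → ∀ σ : Config N,
      fixedOverlapProb P γ β qlo σ ≤ Real.exp (-(c * N)) := by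
    refine exists_uniform_rate (fun N c c' hc h σ => (h σ).trans (hmono N c c' hc)) ?_ ?_
    · intro N hN
      obtain ⟨c, hc, h⟩ := exists_rate_of_lt_one
        (prob_superLevel_nonempty_lt_one (P := P) (γ := γ) hN hξ hβ) hN
      exact ⟨c, hc, fun σ => (fixedOverlapProb_le_prob _ _ _).trans h⟩
    · obtain ⟨c, hc, h⟩ := eventually_poly_mul_exp_le (a := 1) (b := κ) one_pos hκ0
      refine ⟨c, hc, ?_⟩
      filter_upwards [h, eventually_ge_atTop 1] with N hN hN1 σ
      exact (fixedOverlapProb_le hN1 hξ hη hcap σ).trans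
        ((le_add_of_nonneg_left (Real.exp_pos _).le).trans hN)
  exact ⟨min c₁ c₂, lt_min hc₁ hc₂,
    fun N hN τ hτ => (h₁ N hN τ hτ).trans (hmono N _ _ (min_le_left _ _)),
    fun N hN σ => (h₂ N hN σ).trans (hmono N _ _ (min_le_right _ _))⟩

end Margin

/-! ### Monotonicity of the free energy deficit -/

section FreeEnergyDeficit

variable {P N : ℕ} {γ : ℕ → ℝ}

/-- The deficit of the free energy with respect to its annealed value is nondecreasing in `β`:
split the disorder at inverse temperature `β₁` into independent parts of strengths `β` and
`√(β₁² - β²)` and average the second one inside the logarithm. -/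
lemma freeEnergy_deficit_mono (hN : 1 ≤ N) {β β₁ : ℝ} (hβ : 0 ≤ β) (hβ₁ : 0 < β₁) (h : β ≤ β₁) :
    freeEnergy P γ β₁ N - β₁ ^ 2 * mixture P γ 1 / 2 ≤
      freeEnergy P γ β N - β ^ 2 * mixture P γ 1 / 2 := by
  have hN' : (0 : ℝ) < N := by positivity
  set ν := disorderLaw P N with hν
  -- with this `τ` the correlated disorder at `β₁` is the disorder at `β` plus an independent part
  set τ := 1 - β / β₁ with hτ
  have hτm : τ ∈ Icc (0 : ℝ) 1 := by
    have h1 : β / β₁ ≤ 1 := (div_le_one hβ₁).2 h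
    have h2 : 0 ≤ β / β₁ := by positivity
    exact ⟨by rw [hτ]; linarith, by rw [hτ]; linarith⟩
  set s := β₁ * Real.sqrt (2 * τ - τ ^ 2) with hs
  have hs2 : s ^ 2 = β₁ ^ 2 - β ^ 2 := by
    rw [hs, mul_pow, Real.sq_sqrt (by nlinarith [hτm.1, hτm.2]), hτ]
    field_simp
    ring
  have hZ : ∀ G G' : Disorder P N, partitionFunction γ β₁ (correlated τ G G') =
      ∑ σ : Config N, Real.exp (β * hamiltonian γ G σ) *
        Real.exp ((s • fieldCoeff P γ σ) ⬝ᵥ G') := by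
    intro G G'
    refine Finset.sum_congr rfl fun σ _ => ?_
    rw [← Real.exp_add]
    congr 1
    simp only [hamiltonian_eq_dotProduct, correlated, dotProduct_add, dotProduct_smul,
      smul_dotProduct, smul_eq_mul, hs, hτ]
    field_simp
    ring
  have hterm : ∀ (G : Disorder P N) (σ : Config N), Integrable (fun G' : Disorder P N =>
      Real.exp (β * hamiltonian γ G σ) * Real.exp ((s • fieldCoeff P γ σ) ⬝ᵥ G')) ν :=
    fun G σ => (integrable_exp_dotProduct _).const_mul _
  have hmean : ∀ G : Disorder P N, ∫ G', partitionFunction γ β₁ (correlated τ G G') ∂ν =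
      partitionFunction γ β G * Real.exp (N * ((β₁ ^ 2 - β ^ 2) * mixture P γ 1 / 2)) := by
    intro G
    simp_rw [hZ]
    rw [integral_finsetSum _ fun σ _ => hterm G σ, partitionFunction,
      Finset.sum_mul]
    refine Finset.sum_congr rfl fun σ _ => ?_
    rw [integral_const_mul]
    congr 1
    refine (integral_exp_dotProduct _).trans ?_
    rw [smul_fieldCoeff_dotProduct_self hN, hs2]
    congr 1
    ring
  have hmp := measurePreserving_correlated (P := P) (N := N) hτm
  have hint := integrable_log_partitionFunction (P := P) (N := N) (γ := γ) β₁
  have hintc : Integrable (fun ω : Disorder P N × Disorder P N =>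
      Real.log (partitionFunction γ β₁ (correlated τ ω.1 ω.2))) (ν.prod ν) :=
    hmp.integrable_comp_of_integrable hint
  have h1 : ∫ G, Real.log (partitionFunction γ β₁ G) ∂ν =
      ∫ G, ∫ G', Real.log (partitionFunction γ β₁ (correlated τ G G')) ∂ν ∂ν := by
    have h := integral_map (μ := ν.prod ν) hmp.measurable.aemeasurable
      (f := fun G => Real.log (partitionFunction γ β₁ G))
      (by rw [hmp.map_eq]; exact hint.aestronglyMeasurable)
    rw [hmp.map_eq] at h
    rw [← integral_prod _ hintc]
    exact h
  have h2 : ∫ G, ∫ G', Real.log (partitionFunction γ β₁ (correlated τ G G')) ∂ν ∂ν ≤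
      ∫ G, (Real.log (partitionFunction γ β G) + N * ((β₁ ^ 2 - β ^ 2) * mixture P γ 1 / 2)) ∂ν := by
    refine integral_mono_ae hintc.integral_prod_left
      ((integrable_log_partitionFunction β).add (integrable_const _)) ?_
    filter_upwards [hintc.prod_right_ae] with G hG
    have hexp : ∀ G', Real.exp (Real.log (partitionFunction γ β₁ (correlated τ G G'))) =
        partitionFunction γ β₁ (correlated τ G G') := fun G' =>
      Real.exp_log (partitionFunction_pos _ _)
    have hJ := exp_integral_le_integral_exp hG (by
      simp_rw [hexp, hZ]
      exact integrable_finsetSum _ fun σ _ => hterm G σ)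
    simp_rw [hexp] at hJ
    rw [hmean] at hJ
    rw [← Real.log_exp (N * ((β₁ ^ 2 - β ^ 2) * mixture P γ 1 / 2)),
      ← Real.log_mul (partitionFunction_pos _ _).ne' (Real.exp_pos _).ne']
    rwa [Real.le_log_iff_exp_le (mul_pos (partitionFunction_pos _ _) (Real.exp_pos _))]
  rw [integral_add (integrable_log_partitionFunction β) (integrable_const _), integral_const,
    probReal_univ, one_smul] at h2
  rw [← h1] at h2
  have h3 : freeEnergy P γ β₁ N ≤ freeEnergy P γ β N + (β₁ ^ 2 - β ^ 2) * mixture P γ 1 / 2 := by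
    rw [freeEnergy, freeEnergy, div_add' _ _ _ hN'.ne']
    gcongr
    linarith
  linarith

lemma eventually_freeEnergy_ge_of_lt_betaC {β : ℝ} (hβ : 0 < β) (h : β < betaC P γ) {Δ : ℝ}
    (hΔ : 0 < Δ) :
    ∀ᶠ N in atTop, β ^ 2 * mixture P γ 1 / 2 + Real.log 2 - Δ ≤ freeEnergy P γ β N := by
  have hne : {β : ℝ | 0 ≤ β ∧ Tendsto (freeEnergy P γ β) atTop
      (𝓝 (β ^ 2 * mixture P γ 1 / 2 + Real.log 2))}.Nonempty := by
    by_contra hempty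
    rw [not_nonempty_iff_eq_empty] at hempty
    rw [betaC, hempty, Real.sSup_empty] at h
    linarith
  obtain ⟨β₁, ⟨_, hlim⟩, hlt⟩ := exists_lt_of_lt_csSup hne h
  filter_upwards [hlim.eventually (lt_mem_nhds (sub_lt_self _ hΔ)), eventually_ge_atTop 1]
    with N hN hN1
  have := freeEnergy_deficit_mono (P := P) (γ := γ) hN1 hβ.le (hβ.trans hlt) hlt.le
  linarith

end FreeEnergyDeficit

/-! ### Gaussian quantiles -/

section Quantile

lemma continuous_cdf_gaussianReal : Continuous (cdf (gaussianReal 0 1)) := by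
  refine continuous_iff_continuousAt.2 fun x => ?_
  rw [(cdf (gaussianReal 0 1)).mono.continuousAt_iff_leftLim_eq_rightLim,
    StieltjesFunction.rightLim_eq]
  have h := (cdf (gaussianReal 0 1)).measure_singleton x
  have := nullSingletonClass_gaussianReal (μ := 0) (v := 1) one_ne_zero
  rw [measure_cdf, measure_singleton, eq_comm, ENNReal.ofReal_eq_zero] at h
  exact le_antisymm ((cdf (gaussianReal 0 1)).mono.leftLim_le le_rfl) (by linarith)

lemma cdf_gaussianReal_zero_le : cdf (gaussianReal 0 1) 0 ≤ 1 / 2 := by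
  have := nullSingletonClass_gaussianReal (μ := 0) (v := 1) one_ne_zero
  have h1 : (gaussianReal 0 1).real (Iic 0) = (gaussianReal 0 1).real (Ioi 0) := by
    have h : (gaussianReal 0 1).map (fun x => -x) (Iic 0) = gaussianReal 0 1 (Iic 0) := by
      rw [gaussianReal_map_neg, neg_zero]
    rw [Measure.map_apply (by fun_prop) measurableSet_Iic] at h
    rw [measureReal_def, measureReal_def, ← h, measure_congr Ioi_ae_eq_Ici]
    congr 2
    ext x
    simp
  have h2 := probReal_add_probReal_compl (μ := gaussianReal 0 1) (s := Iic (0 : ℝ)) measurableSet_Iic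
  rw [compl_Iic, ← h1] at h2
  rw [cdf_eq_real]
  linarith

lemma cdf_gaussianQuantile {u : ℝ} (h0 : 0 < u) (h1 : u < 1) :
    cdf (gaussianReal 0 1) (gaussianQuantile u) = u := by
  set Φ := cdf (gaussianReal 0 1) with hΦ
  set S := {x : ℝ | u ≤ Φ x} with hS
  have hne : S.Nonempty := ((tendsto_cdf_atTop (gaussianReal 0 1)).eventually (lt_mem_nhds h1)).exists.imp
    fun x hx => hx.le
  have hbdd : BddBelow S := by
    obtain ⟨x, hx⟩ := ((tendsto_cdf_atBot (gaussianReal 0 1)).eventually (gt_mem_nhds h0)).exists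
    refine ⟨x, fun y hy => ?_⟩
    by_contra hlt
    exact absurd (hx.trans_le (hy.trans (Φ.mono (not_le.1 hlt).le))) (lt_irrefl _)
  have hclosed : IsClosed S := isClosed_le continuous_const continuous_cdf_gaussianReal
  refine le_antisymm ?_ (hclosed.csInf_mem hne hbdd)
  refine le_of_tendsto (continuous_cdf_gaussianReal.continuousWithinAt (s := Iio (gaussianQuantile u))
    (x := gaussianQuantile u)) ?_
  filter_upwards [self_mem_nhdsWithin] with x hx
  by_contra hlt
  exact absurd (csInf_le hbdd (not_le.1 hlt).le) (not_le.2 hx)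

lemma gaussianQuantile_nonneg {q : ℝ} (h0 : 0 < q) (h1 : q < 1) :
    0 ≤ gaussianQuantile ((1 + q) / 2) := by
  by_contra hlt
  have h2 := (cdf (gaussianReal 0 1)).mono (not_le.1 hlt).le
  rw [cdf_gaussianQuantile (by linarith) (by linarith)] at h2
  linarith [cdf_gaussianReal_zero_le]

end Quantile

/-! ### The overlap window of a general mixture -/

section GeneralMixture

variable {P : ℕ} {γ : ℕ → ℝ}

lemma mixture_lt_one (h : ∃ k ∈ Finset.Icc 2 P, γ k ≠ 0) {q : ℝ} (h0 : 0 ≤ q) (h1 : q < 1) :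
    mixture P γ q < mixture P γ 1 := by
  obtain ⟨k, hk, hγ⟩ := h
  refine Finset.sum_lt_sum (fun j _ => by gcongr) ⟨k, hk, ?_⟩
  have hk0 : k ≠ 0 := by have := (Finset.mem_Icc.1 hk).1; omega
  have : 0 < γ k ^ 2 := by positivity
  gcongr

lemma betaBarD_nonneg : 0 ≤ betaBarD P γ := by
  refine Real.sInf_nonneg ?_
  rintro _ ⟨q, hq, rfl⟩
  have h := mixture_mono (P := P) (γ := γ) hq.1.le hq.2.le
  have := gaussianPDFReal_nonneg 0 1 (gaussianQuantile ((1 + q) / 2))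
  have : 0 ≤ mixture P γ 1 - mixture P γ q := sub_nonneg.2 h
  positivity

/-- The window of a general mixture starts at a `q` where the quotient defining `β̄_d` is below `β`.
The multiplier `t = Φ⁻¹((1 + q) / 2)` satisfies `2 Φ(t) - 1 = q`, so `E|g + t| - t v ≤ 2 φ(t)` for
`v ≥ q`. -/
theorem exists_overlap_window (h : ∃ k ∈ Finset.Icc 2 P, γ k ≠ 0) {β : ℝ}
    (hd : betaBarD P γ < β) (hc : β < betaC P γ) :
    ∃ ε c qlo qhi : ℝ, 0 < ε ∧ 0 < c ∧ 0 < qlo ∧ qlo < qhi ∧ qhi < 1 ∧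
      (∀ N : ℕ, 1 ≤ N → ∀ τ ∈ Icc (0 : ℝ) 1,
        gibbsOverlapMass P γ N β ((1 - ε) * β) τ qlo qhi ≤ Real.exp (-(c * N))) ∧
      (∀ N : ℕ, 1 ≤ N → ∀ σ : Config N,
        fixedOverlapProb P γ β qlo σ ≤ Real.exp (-(c * N))) := by
  have hξ := mixture_one_pos h
  have hβ : 0 < β := betaBarD_nonneg.trans_lt hd
  obtain ⟨_, ⟨q, hq, rfl⟩, hlt⟩ := exists_lt_of_csInf_lt
    ((nonempty_Ioo.2 (zero_lt_one (α := ℝ))).image _) hd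
  set t := gaussianQuantile ((1 + q) / 2) with ht
  have ht0 : 0 ≤ t := gaussianQuantile_nonneg hq.1 hq.2
  set d := deriv (mixture P γ) 1 with hdd
  set A := 2 * √d * gaussianPDFReal 0 1 t with hA
  have hgap : 0 < mixture P γ 1 - mixture P γ q := sub_pos.2 (mixture_lt_one h hq.1.le hq.2)
  simp only at hlt
  rw [div_lt_iff₀ hgap] at hlt
  set g := β * (mixture P γ 1 - mixture P γ q) - A with hg
  have hg0 : 0 < g := sub_pos.2 hlt
  have hmean : ∀ v, q ≤ v → √d * (meanAbs t - t * v) ≤ A := by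
    intro v hv
    rw [meanAbs_eq, ht, cdf_gaussianQuantile (by linarith [hq.1]) (by linarith [hq.2]), ← ht, hA]
    have : t * q ≤ t * v := by gcongr
    have h2 : 2 * gaussianPDFReal 0 1 t + t * (2 * ((1 + q) / 2) - 1) - t * v ≤
        2 * gaussianPDFReal 0 1 t := by linarith
    calc _ ≤ √d * (2 * gaussianPDFReal 0 1 t) := by gcongr
      _ = _ := by ring
  obtain ⟨qhi, hqhi, hqhi1, hqhi2⟩ : ∃ qhi, q < qhi ∧ qhi < 1 ∧
      β * mixture P γ qhi < β * mixture P γ q + g / 3 := by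
    have hcont : ContinuousWithinAt (fun x => β * mixture P γ x) (Ioi q) q :=
      (continuous_const.mul continuous_mixture).continuousWithinAt
    have h1 := hcont.eventually (gt_mem_nhds (lt_add_of_pos_right _ (by positivity : 0 < g / 3)))
    have h2 : ∀ᶠ x in 𝓝[>] q, x ∈ Ioo q 1 := Ioo_mem_nhdsGT hq.2
    obtain ⟨x, hx1, hx2⟩ := (h1.and h2).exists
    exact ⟨x, hx2.1, hx2.2, hx1⟩
  set ε := min (1 / 2) (g / (3 * (β * mixture P γ 1))) with hε
  have hε0 : 0 < ε := lt_min (by norm_num) (by positivity)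
  have hε1 : ε ≤ 1 / 2 := min_le_left _ _
  have hε2 : ε * (β * mixture P γ 1) ≤ g / 3 := by
    have : ε ≤ g / (3 * (β * mixture P γ 1)) := min_le_right _ _
    calc _ ≤ g / (3 * (β * mixture P γ 1)) * (β * mixture P γ 1) := by gcongr
      _ = _ := by field_simp
  have hd0 : 0 < d := hξ.trans_le mixture_one_le_deriv
  have hΔ : 0 < (g / 3) ^ 2 / (8 * d) := by positivity
  obtain ⟨c, hc0, h1, h2⟩ := exists_rate_of_margin (P := P) (γ := γ) hξ (β := β)
    (β' := (1 - ε) * β) (η := g / 3) (Δ := (g / 3) ^ 2 / (8 * d) / 2) (qlo := q) (qhi := qhi)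
    hβ (mul_pos (by linarith) hβ) (by positivity) hq.1.le
    (fun v hv hv2 => ⟨t, ht0, by
      have e1 := hmean v hv
      have e2 : β * mixture P γ v ≤ β * mixture P γ qhi :=
        mul_le_mul_of_nonneg_left (mixture_mono (hq.1.le.trans hv) hv2) hβ.le
      linarith⟩)
    (fun v hv _ => ⟨t, ht0, by
      have e1 := hmean v hv
      have e2 : 0 ≤ β * mixture P γ q := mul_nonneg hβ.le (mixture_nonneg hq.1.le)
      linarith⟩)
    (by rw [← hdd]; linarith) (eventually_freeEnergy_ge_of_lt_betaC hβ hc (by positivity))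
  exact ⟨ε, c, q, qhi, hε0, hc0, hq.1, hqhi, hqhi1, h1, h2⟩

end GeneralMixture

/-! ### Second moment method -/

section SecondMoment

variable {P N p : ℕ} {γ : ℕ → ℝ}

/-- A lower bound for the Gaussian tail, from the density on `[a, a + 1]` and `√(2 π) ≤ e`. -/
lemma gaussianReal_Ici_ge {a : ℝ} (ha : 0 ≤ a) :
    Real.exp (-((a + 1) ^ 2 / 2) - 1) ≤ (gaussianReal 0 1).real (Ici a) := by
  have hint := integrable_gaussianPDFReal 0 1
  have hpdf : ∀ x ∈ Icc a (a + 1),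
      Real.exp (-((a + 1) ^ 2 / 2) - 1) ≤ gaussianPDFReal 0 1 x := by
    intro x hx
    have h1 : √(2 * Real.pi) ≤ Real.exp 1 := by
      rw [Real.sqrt_le_left (Real.exp_pos 1).le]
      nlinarith [Real.exp_one_gt_d9, Real.pi_lt_d2]
    have h2 : Real.exp (-1) ≤ (√(2 * Real.pi))⁻¹ := by
      rw [Real.exp_neg]
      exact inv_anti₀ (by positivity) h1
    simp only [gaussianPDFReal, NNReal.coe_one, mul_one, sub_zero]
    rw [sub_eq_add_neg, Real.exp_add, mul_comm]
    refine mul_le_mul h2 (Real.exp_le_exp.2 ?_) (Real.exp_pos _).le (by positivity)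
    have : x ^ 2 ≤ (a + 1) ^ 2 := pow_le_pow_left₀ (ha.trans hx.1) hx.2 2
    linarith
  calc Real.exp (-((a + 1) ^ 2 / 2) - 1)
      = ∫ _ in Icc a (a + 1), Real.exp (-((a + 1) ^ 2 / 2) - 1) := by simp
    _ ≤ ∫ x in Icc a (a + 1), gaussianPDFReal 0 1 x :=
        setIntegral_mono_on (by simp) hint.integrableOn measurableSet_Icc hpdf
    _ ≤ ∫ x in Ici a, gaussianPDFReal 0 1 x :=
        setIntegral_mono_set hint.integrableOn (ae_of_all _ fun x => gaussianPDFReal_nonneg _ _ _)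
          (Icc_subset_Ici_self).eventuallyLE
    _ = (gaussianReal 0 1).real (Ici a) := by
        rw [measureReal_def, gaussianReal_apply_eq_integral _ one_ne_zero, ENNReal.toReal_ofReal]
        exact integral_nonneg fun x => gaussianPDFReal_nonneg _ _ _

lemma prob_level_ge (hN : 1 ≤ N) (hξ : mixture P γ 1 = 1) {β : ℝ} (hβ : 0 ≤ β) (σ : Config N) :
    Real.exp (-((β * √N + 1) ^ 2 / 2) - 1) ≤
      (disorderLaw P N).real {G | β * N ≤ hamiltonian γ G σ} := by
  have hN' : (0 : ℝ) < N := by positivity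
  have hs : 0 < √(N : ℝ) := Real.sqrt_pos.2 hN'
  have hss : √(N : ℝ) * √(N : ℝ) = N := Real.mul_self_sqrt hN'.le
  set a := (√(N : ℝ))⁻¹ • fieldCoeff P γ σ with ha
  have haa : a ⬝ᵥ a = 1 := by
    rw [ha, smul_fieldCoeff_dotProduct_self hN, hξ, inv_pow, Real.sq_sqrt hN'.le]
    field_simp
  have hm : Measurable fun G : Disorder P N => a ⬝ᵥ G := by unfold dotProduct; fun_prop
  have hlaw := map_dotProduct_gaussianPi a
  rw [haa, Real.toNNReal_one] at hlaw
  refine (gaussianReal_Ici_ge (mul_nonneg hβ hs.le)).trans (le_of_eq ?_)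
  rw [← hlaw, map_measureReal_apply hm measurableSet_Ici]
  congr 1
  ext G
  simp only [mem_preimage, mem_Ici, Set.mem_ofPred_eq, ha, smul_dotProduct, smul_eq_mul,
    ← hamiltonian_eq_dotProduct]
  rw [le_inv_mul_iff₀ hs, mul_left_comm, hss]

/-- The Chernoff bound for two configurations above the level `β N`. -/
lemma prob_level_inter_le (hN : 1 ≤ N) (hξ : ∀ x, mixture P γ x = x ^ p) {β : ℝ} (hβ : 0 ≤ β)
    (σ σ' : Config N) :
    (disorderLaw P N).real
        ({G | β * N ≤ hamiltonian γ G σ} ∩ {G | β * N ≤ hamiltonian γ G σ'}) ≤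
      Real.exp (-(N * (β ^ 2 / (1 + |overlap σ σ'| ^ p)))) := by
  have hN' : (0 : ℝ) < N := by positivity
  set ρ := |overlap σ σ'| ^ p with hρ
  have hρ0 : 0 ≤ ρ := by positivity
  set l := β / (1 + ρ) with hl
  have hl0 : 0 ≤ l := by positivity
  set a := l • (fieldCoeff P γ σ + fieldCoeff P γ σ') with ha
  have haa : a ⬝ᵥ a ≤ 2 * (N * (l ^ 2 * (1 + ρ))) := by
    have h1 : a ⬝ᵥ a = 2 * (N * (l ^ 2 * (1 + overlap σ σ' ^ p))) := by
      simp only [ha, smul_dotProduct, dotProduct_smul, add_dotProduct, dotProduct_add,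
        fieldCoeff_dotProduct hN, overlap_self hN, overlap_comm σ' σ, hξ, one_pow, smul_eq_mul]
      ring
    have h2 : overlap σ σ' ^ p ≤ ρ := by
      rw [hρ, ← abs_pow]
      exact le_abs_self _
    rw [h1]
    gcongr
  have hmarkov := mul_meas_ge_le_integral_of_nonneg (μ := disorderLaw P N)
    (f := fun G => Real.exp (a ⬝ᵥ G)) (ae_of_all _ fun _ => (Real.exp_pos _).le)
    (integrable_exp_dotProduct a) (Real.exp (2 * (N * (l * β))))
  have hset : ({G : Disorder P N | β * N ≤ hamiltonian γ G σ} ∩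
      {G | β * N ≤ hamiltonian γ G σ'}) ⊆
      {G | Real.exp (2 * (N * (l * β))) ≤ Real.exp (a ⬝ᵥ G)} := by
    rintro G ⟨h1, h2⟩
    refine Real.exp_le_exp.2 ?_
    rw [ha, smul_dotProduct, add_dotProduct, ← hamiltonian_eq_dotProduct,
      ← hamiltonian_eq_dotProduct, smul_eq_mul]
    calc 2 * (N * (l * β)) = l * (β * N + β * N) := by ring
      _ ≤ _ := mul_le_mul_of_nonneg_left (add_le_add h1 h2) hl0
  have h := (mul_le_mul_of_nonneg_left (measureReal_mono hset (measure_ne_top _ _))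
    (Real.exp_pos _).le).trans hmarkov
  have h' : ∫ G, Real.exp (a ⬝ᵥ G) ∂(disorderLaw P N) ≤ Real.exp (N * (l ^ 2 * (1 + ρ))) := by
    refine (integral_exp_dotProduct a).trans_le (Real.exp_le_exp.2 ?_)
    linarith
  have h2 := h.trans h'
  rw [mul_comm, ← le_div_iff₀ (Real.exp_pos _), ← Real.exp_sub] at h2
  refine h2.trans (Real.exp_le_exp.2 (le_of_eq ?_))
  rw [hl]
  field_simp
  ring

lemma sum_exp_mul_overlap (hN : 1 ≤ N) (l : ℝ) (σ : Config N) :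
    ∑ σ' : Config N, Real.exp (N * (l * overlap σ σ')) = (2 * Real.cosh l) ^ N := by
  have h1 : ∀ σ' : Config N, Real.exp (N * (l * overlap σ σ')) =
      ∏ i, Real.exp (l * (spin σ i * ((σ' i : ℤ) : ℝ))) := fun σ' => by
    rw [mul_left_comm, mul_overlap hN, Finset.mul_sum, Real.exp_sum]
    rfl
  simp_rw [h1]
  rw [← Fintype.prod_sum (fun i (u : ℤˣ) => Real.exp (l * (spin σ i * ((u : ℤ) : ℝ))))]
  have h2 : ∀ i : Fin N, ∑ u : ℤˣ, Real.exp (l * (spin σ i * ((u : ℤ) : ℝ))) = 2 * Real.cosh l := by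
    intro i
    have hu : (Finset.univ : Finset ℤˣ) = {1, -1} := rfl
    rw [hu, Finset.sum_pair (by decide), Real.cosh_eq]
    rcases Int.units_eq_one_or (σ i) with h | h <;> simp [spin, h] <;> ring
  simp only [h2, Finset.prod_const, Finset.card_univ, Fintype.card_fin]

/-- The Chernoff bound for the number of configurations at a given overlap. -/
lemma card_overlap_eq_le (hN : 1 ≤ N) (l v : ℝ) (σ : Config N) :
    ((Finset.univ.filter fun σ' : Config N => overlap σ σ' = v).card : ℝ) ≤
      2 ^ N * Real.exp (N * (Real.log (Real.cosh l) - l * |v|)) := by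
  obtain ⟨l', hl', hcosh⟩ : ∃ l', l' * v = l * |v| ∧ Real.cosh l' = Real.cosh l := by
    rcases abs_cases v with ⟨h, _⟩ | ⟨h, _⟩
    · exact ⟨l, by rw [h], rfl⟩
    · exact ⟨-l, by rw [h]; ring, Real.cosh_neg l⟩
  have h1 : ((Finset.univ.filter fun σ' : Config N => overlap σ σ' = v).card : ℝ) *
      Real.exp (N * (l * |v|)) ≤ (2 * Real.cosh l) ^ N := by
    rw [← hcosh, ← sum_exp_mul_overlap hN l' σ, ← nsmul_eq_mul]
    refine (Finset.card_nsmul_le_sum _ (fun σ' => Real.exp (N * (l' * overlap σ σ'))) _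
      fun σ' hσ' => ?_).trans (Finset.sum_le_sum_of_subset_of_nonneg (Finset.filter_subset _ _)
        fun _ _ _ => (Real.exp_pos _).le)
    rw [(Finset.mem_filter.1 hσ').2, hl']
  rw [← le_div_iff₀ (Real.exp_pos _)] at h1
  refine h1.trans (le_of_eq ?_)
  have h2 : Real.exp (N * Real.log (Real.cosh l)) = Real.cosh l ^ N := by
    rw [Real.exp_nat_mul, Real.exp_log (Real.cosh_pos l)]
  rw [mul_pow, mul_sub, Real.exp_sub, h2]
  ring

/-- The exponential sum over overlaps: each overlap value is counted with a Chernoff bound whose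
parameter `l` may depend on the value. -/
lemma sum_exp_overlap_le (hN : 1 ≤ N) {f : ℝ → ℝ} {Δ : ℝ}
    (hf : ∀ q ∈ Icc (0 : ℝ) 1, ∃ l, f q ≤ l * q - Real.log (Real.cosh l) + Δ) (σ : Config N) :
    ∑ σ' : Config N, Real.exp (N * f |overlap σ σ'|) ≤
      2 ^ N * ((2 * N + 1) * Real.exp (N * Δ)) := by
  classical
  rw [← Finset.sum_fiberwise_of_maps_to (s := Finset.univ) (t := Finset.univ.image (overlap σ))
    (fun σ' _ => Finset.mem_image_of_mem _ (Finset.mem_univ σ'))]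
  have hcard : ((Finset.univ.image (overlap σ)).card : ℝ) ≤ 2 * N + 1 := by
    exact_mod_cast card_image_overlap_le hN σ Finset.univ
  calc _ ≤ ∑ v ∈ Finset.univ.image (overlap σ), 2 ^ N * Real.exp (N * Δ) := by
        refine Finset.sum_le_sum fun v hv => ?_
        obtain ⟨σ₀, _, rfl⟩ := Finset.mem_image.1 hv
        obtain ⟨l, hl⟩ := hf |overlap σ σ₀| ⟨abs_nonneg _, abs_overlap_le_one hN σ σ₀⟩
        have h1 : ∀ σ' ∈ Finset.univ.filter (fun σ' => overlap σ σ' = overlap σ σ₀),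
            Real.exp (N * f |overlap σ σ'|) = Real.exp (N * f |overlap σ σ₀|) := fun σ' hσ' => by
          rw [(Finset.mem_filter.1 hσ').2]
        rw [Finset.sum_congr rfl h1, Finset.sum_const, nsmul_eq_mul]
        calc _ ≤ 2 ^ N * Real.exp (N * (Real.log (Real.cosh l) - l * |overlap σ σ₀|)) *
              Real.exp (N * f |overlap σ σ₀|) := by
              gcongr
              exact card_overlap_eq_le hN l _ σ
          _ ≤ _ := by
              rw [mul_assoc, ← Real.exp_add, ← mul_add]
              gcongr
              linarith
    _ ≤ _ := by
        rw [Finset.sum_const, nsmul_eq_mul, mul_left_comm]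
        gcongr

/-- A form of the Paley–Zygmund inequality. -/
lemma paley_zygmund {Ω : Type*} [MeasurableSpace Ω] {μ : Measure Ω} [IsProbabilityMeasure μ]
    {W : Ω → ℝ} {w M : ℝ} (hWm : Measurable W) (hW : Integrable W μ)
    (hW2 : Integrable (fun ω => W ω ^ 2) μ) (hw : 0 < w) (hwW : w ≤ ∫ ω, W ω ∂μ)
    (hM : ∫ ω, W ω ^ 2 ∂μ ≤ M) : w ^ 2 / (4 * M) ≤ μ.real {ω | w / 2 ≤ W ω} := by
  set B := {ω | w / 2 ≤ W ω} with hB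
  have hBm : MeasurableSet B := measurableSet_le measurable_const hWm
  have hM0 : 0 < M := by
    have h1 : 0 ≤ ∫ ω, (W ω - ∫ ω, W ω ∂μ) ^ 2 ∂μ := integral_nonneg fun _ => sq_nonneg _
    have h2 : ∫ ω, (W ω - ∫ ω, W ω ∂μ) ^ 2 ∂μ = ∫ ω, W ω ^ 2 ∂μ - (∫ ω, W ω ∂μ) ^ 2 := by
      set m := ∫ ω, W ω ∂μ with hm
      have : ∀ ω, (W ω - m) ^ 2 = W ω ^ 2 - (2 * m * W ω - m ^ 2) := fun ω => by ring
      simp_rw [this]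
      have hi : Integrable (fun ω => 2 * m * W ω - m ^ 2) μ :=
        (hW.const_mul _).sub (integrable_const _)
      rw [integral_sub hW2 hi, integral_sub (hW.const_mul _) (integrable_const _),
        integral_const_mul, integral_const, probReal_univ, one_smul, ← hm]
      ring
    have h3 : w ^ 2 ≤ (∫ ω, W ω ∂μ) ^ 2 := by gcongr
    have h4 : 0 < w ^ 2 := by positivity
    linarith
  -- the parameter for which `s / 2 * M` is a quarter of `w` in the pointwise bound below
  set s := w / (2 * M) with hs
  have hs0 : 0 < s := by positivity
  have hpt : ∀ ω, W ω ≤ w / 2 + s / 2 * W ω ^ 2 + 1 / (2 * s) * B.indicator 1 ω := by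
    intro ω
    by_cases hω : ω ∈ B
    · rw [indicator_of_mem hω, Pi.one_apply]
      have h : 0 ≤ s / 2 * (W ω - 1 / s) ^ 2 := by positivity
      have e : s / 2 * (W ω - 1 / s) ^ 2 = s / 2 * W ω ^ 2 - W ω + 1 / (2 * s) := by
        field_simp
        ring
      linarith
    · rw [indicator_of_notMem hω, mul_zero]
      have h : W ω < w / 2 := not_le.1 hω
      have : 0 ≤ s / 2 * W ω ^ 2 := by positivity
      linarith
  have hBi : Integrable (B.indicator (1 : Ω → ℝ)) μ := (integrable_const (1 : ℝ)).indicator hBm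
  have h := integral_mono hW (((integrable_const (w / 2)).add (hW2.const_mul (s / 2))).add
    (hBi.const_mul (1 / (2 * s)))) hpt
  have hsplit : ∫ ω, (w / 2 + s / 2 * W ω ^ 2 + 1 / (2 * s) * B.indicator 1 ω) ∂μ =
      w / 2 + s / 2 * ∫ ω, W ω ^ 2 ∂μ + 1 / (2 * s) * μ.real B := by
    have hadd : Integrable (fun ω => w / 2 + s / 2 * W ω ^ 2) μ :=
      (integrable_const _).add (hW2.const_mul _)
    rw [integral_add hadd (hBi.const_mul (1 / (2 * s))), integral_add (integrable_const _) (hW2.const_mul _),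
      integral_const_mul, integral_const_mul, integral_indicator_one hBm, integral_const,
      probReal_univ, one_smul]
  have h2 : w ≤ w / 2 + s / 2 * M + 1 / (2 * s) * μ.real B := by
    refine hwW.trans (h.trans (hsplit.trans_le ?_))
    gcongr
  have e1 : s / 2 * M = w / 4 := by rw [hs]; field_simp; norm_num
  have e2 : 1 / (2 * s) = M / w := by rw [hs]; field_simp
  rw [e1, e2] at h2
  have h3 : w / 4 ≤ M / w * μ.real B := by linarith
  calc w ^ 2 / (4 * M) = w / M * (w / 4) := by field_simp
    _ ≤ w / M * (M / w * μ.real B) := by gcongr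
    _ = μ.real B := by field_simp

/-- The second moment method for the number of configurations above the level `β N`: the partition
function is, up to `e^{O(√N)}`, at least its annealed value with probability not smaller than
`e^{-N Δ - O(√N)}`. -/
lemma prob_log_partitionFunction_ge (hN : 1 ≤ N) (hξ : ∀ x, mixture P γ x = x ^ p) {β Δ : ℝ}
    (hβ : 0 ≤ β)
    (hΔ : ∀ q ∈ Icc (0 : ℝ) 1, ∃ l,
      β ^ 2 * (q ^ p / (1 + q ^ p)) ≤ l * q - Real.log (Real.cosh l) + Δ) :
    Real.exp (-(N * Δ) - 2 * β * √N - 3) / (4 * (2 * N + 1)) ≤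
      (disorderLaw P N).real {G | N * (β ^ 2 / 2 + Real.log 2) - (β * √N + 3) ≤
        Real.log (partitionFunction γ β G)} := by
  have hN' : (0 : ℝ) < N := by positivity
  have hss : √(N : ℝ) ^ 2 = N := Real.sq_sqrt hN'.le
  set ν := disorderLaw P N with hν
  set S : Config N → Set (Disorder P N) := fun σ => {G | β * N ≤ hamiltonian γ G σ} with hS
  have hSm : ∀ σ, MeasurableSet (S σ) := fun σ =>
    measurableSet_le measurable_const (measurable_hamiltonian σ)
  have hSi : ∀ σ, Integrable ((S σ).indicator (1 : Disorder P N → ℝ)) ν := fun σ =>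
    (integrable_const (1 : ℝ)).indicator (hSm σ)
  have hSSi : ∀ σ σ', Integrable ((S σ ∩ S σ').indicator (1 : Disorder P N → ℝ)) ν := fun σ σ' =>
    (integrable_const (1 : ℝ)).indicator ((hSm σ).inter (hSm σ'))
  set W : Disorder P N → ℝ := fun G => ∑ σ, (S σ).indicator 1 G with hW
  have hWm : Measurable W := Finset.measurable_sum _ fun σ _ => measurable_one.indicator (hSm σ)
  have hWi : Integrable W ν := integrable_finsetSum _ fun σ _ => hSi σ
  have hWsq : ∀ G, W G ^ 2 = ∑ σ, ∑ σ', (S σ ∩ S σ').indicator (1 : Disorder P N → ℝ) G := by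
    intro G
    rw [sq, hW, Finset.sum_mul_sum]
    refine Finset.sum_congr rfl fun σ _ => Finset.sum_congr rfl fun σ' _ => ?_
    rw [inter_indicator_one]
    rfl
  have hW2i : Integrable (fun G => W G ^ 2) ν := by
    simp_rw [hWsq]
    exact integrable_finsetSum _ fun σ _ => integrable_finsetSum _ fun σ' _ => hSSi σ σ'
  set w := (2 : ℝ) ^ N * Real.exp (-((β * √N + 1) ^ 2 / 2) - 1) with hw
  have hw0 : 0 < w := by positivity
  have hcard : ((Finset.univ : Finset (Config N)).card : ℝ) = 2 ^ N := by
    rw [Finset.card_univ, Fintype.card_fun, Fintype.card_units_int, Fintype.card_fin]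
    norm_num
  have hwW : w ≤ ∫ G, W G ∂ν := by
    rw [hW, integral_finsetSum _ fun σ _ => hSi σ]
    simp_rw [integral_indicator_one (hSm _)]
    rw [hw, ← hcard, ← nsmul_eq_mul]
    exact Finset.card_nsmul_le_sum _ _ _ fun σ _ =>
      prob_level_ge hN (by rw [hξ, one_pow]) hβ σ
  set M := (2 : ℝ) ^ N * (2 ^ N * ((2 * N + 1) * Real.exp (N * (Δ - β ^ 2)))) with hM
  have hM0 : 0 < M := by positivity
  have hWM : ∫ G, W G ^ 2 ∂ν ≤ M := by
    simp_rw [hWsq]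
    rw [integral_finsetSum _ fun σ _ => integrable_finsetSum _ fun σ' _ => hSSi σ σ']
    rw [hM, ← hcard, ← nsmul_eq_mul, hcard]
    refine Finset.sum_le_card_nsmul _ _ _ fun σ _ => ?_
    rw [integral_finsetSum _ fun σ' _ => hSSi σ σ']
    simp_rw [integral_indicator_one ((hSm σ).inter (hSm _))]
    calc _ ≤ ∑ σ' : Config N, Real.exp (N * (β ^ 2 * (|overlap σ σ'| ^ p /
          (1 + |overlap σ σ'| ^ p)) - β ^ 2)) := by
          refine Finset.sum_le_sum fun σ' _ => (prob_level_inter_le hN hξ hβ σ σ').trans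
            (le_of_eq ?_)
          have : 0 < 1 + |overlap σ σ'| ^ p := by positivity
          congr 1
          field_simp
          ring
      _ ≤ _ := sum_exp_overlap_le hN (f := fun q => β ^ 2 * (q ^ p / (1 + q ^ p)) - β ^ 2)
          (Δ := Δ - β ^ 2) (fun q hq => by
            obtain ⟨l, hl⟩ := hΔ q hq
            exact ⟨l, by linarith⟩) σ
  have hPZ := paley_zygmund hWm hWi hW2i hw0 hwW hWM
  have e : w ^ 2 / (4 * M) = Real.exp (-(N * Δ) - 2 * β * √N - 3) / (4 * (2 * N + 1)) := by
    have e1 : Real.exp (-((β * √N + 1) ^ 2 / 2) - 1) ^ 2 =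
        Real.exp (-(N * Δ) - 2 * β * √N - 3) * Real.exp (N * (Δ - β ^ 2)) := by
      rw [← Real.exp_nat_mul, ← Real.exp_add]
      congr 1
      push_cast
      linear_combination (-β ^ 2) * hss
    rw [hw, hM, mul_pow, e1]
    field_simp
  rw [e] at hPZ
  refine hPZ.trans (measureReal_mono (fun G hG => ?_) (measure_ne_top _ _))
  have hG' : w / 2 ≤ W G := hG
  have h1 : Real.exp (β * (β * N)) * W G ≤ partitionFunction γ β G := by
    rw [hW, Finset.mul_sum, partitionFunction]
    refine Finset.sum_le_sum fun σ _ => ?_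
    by_cases h : G ∈ S σ
    · rw [indicator_of_mem h, Pi.one_apply, mul_one]
      exact Real.exp_le_exp.2 (mul_le_mul_of_nonneg_left h hβ)
    · rw [indicator_of_notMem h, mul_zero]
      exact (Real.exp_pos _).le
  have h2 : Real.exp (N * (β ^ 2 / 2 + Real.log 2) - (β * √N + 3)) ≤
      Real.exp (β * (β * N)) * (w / 2) := by
    have e2 : (2 : ℝ) ^ N = Real.exp (N * Real.log 2) := by
      rw [Real.exp_nat_mul, Real.exp_log (by norm_num)]
    have e3 : Real.exp (-1) ≤ 1 / 2 := by
      rw [Real.exp_neg, ← one_div]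
      exact one_div_le_one_div_of_le (by norm_num) (by linarith [Real.exp_one_gt_d9])
    calc _ ≤ Real.exp (β * (β * N)) * (Real.exp (N * Real.log 2) *
          Real.exp (-((β * √N + 1) ^ 2 / 2) - 1) * Real.exp (-1)) := by
          rw [← Real.exp_add, ← Real.exp_add, ← Real.exp_add]
          refine Real.exp_le_exp.2 ?_
          have : (β * √N + 1) ^ 2 / 2 = β ^ 2 * N / 2 + β * √N + 1 / 2 := by
            linear_combination (β ^ 2 / 2) * hss
          rw [this]
          linarith
      _ ≤ Real.exp (β * (β * N)) * (Real.exp (N * Real.log 2) *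
          Real.exp (-((β * √N + 1) ^ 2 / 2) - 1) * (1 / 2)) := by gcongr
      _ = _ := by rw [hw, e2]; ring
  change N * (β ^ 2 / 2 + Real.log 2) - (β * √N + 3) ≤ Real.log (partitionFunction γ β G)
  rw [Real.le_log_iff_exp_le (partitionFunction_pos β G)]
  refine h2.trans (le_trans ?_ h1)
  gcongr

/-- The free energy is within `Δ` of its annealed value when `Δ² / (4 β²)` exceeds the exponential
loss `Δ'` of the second moment method: a larger deficit would contradict the concentration of
`log Z_N(β)`. -/
lemma eventually_freeEnergy_ge (hξ : ∀ x, mixture P γ x = x ^ p) {β Δ Δ' : ℝ} (hβ : 0 < β)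
    (hΔ0 : 0 < Δ) (hΔ : Δ' < Δ ^ 2 / (4 * β ^ 2))
    (hΔ' : ∀ q ∈ Icc (0 : ℝ) 1, ∃ l,
      β ^ 2 * (q ^ p / (1 + q ^ p)) ≤ l * q - Real.log (Real.cosh l) + Δ') :
    ∀ᶠ N in atTop, β ^ 2 * mixture P γ 1 / 2 + Real.log 2 - Δ ≤ freeEnergy P γ β N := by
  have hξ1 : mixture P γ 1 = 1 := by rw [hξ, one_pow]
  -- a smaller deficit `Δ₁` that still beats the second moment loss absorbs the `O(√N)` terms
  obtain ⟨Δ₁, h10, h1Δ, h1⟩ : ∃ Δ₁, 0 < Δ₁ ∧ Δ₁ < Δ ∧ Δ' < Δ₁ ^ 2 / (4 * β ^ 2) := by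
    have hcont : ContinuousWithinAt (fun x => x ^ 2 / (4 * β ^ 2)) (Iio Δ) Δ :=
      (by fun_prop : Continuous fun x : ℝ => x ^ 2 / (4 * β ^ 2)).continuousWithinAt
    have h2 : ∀ᶠ x in 𝓝[<] Δ, x ∈ Ioo 0 Δ := Ioo_mem_nhdsLT hΔ0
    obtain ⟨x, hx1, hx2⟩ := ((hcont.eventually (lt_mem_nhds hΔ)).and h2).exists
    exact ⟨x, hx2.1, hx2.2, hx1⟩
  set κ := Δ₁ ^ 2 / (4 * β ^ 2) - Δ' with hκ
  have hκ0 : 0 < κ := sub_pos.2 h1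
  have hsqrt : Tendsto (fun N : ℕ => √(N : ℝ)) atTop atTop :=
    Real.tendsto_sqrt_atTop.comp tendsto_natCast_atTop_atTop
  have hA : ∀ᶠ N : ℕ in atTop, β * √(N : ℝ) + 3 ≤ N * (Δ - Δ₁) := by
    have hlim : Tendsto (fun N : ℕ => √(N : ℝ) * (√(N : ℝ) * (Δ - Δ₁) - β)) atTop atTop :=
      hsqrt.atTop_mul_atTop₀ (tendsto_atTop_add_const_right _ _
        (hsqrt.atTop_mul_const (sub_pos.2 h1Δ)))
    filter_upwards [hlim.eventually_ge_atTop 3] with N hN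
    have : √(N : ℝ) * √(N : ℝ) = N := Real.mul_self_sqrt (Nat.cast_nonneg N)
    nlinarith
  have hB : ∀ᶠ N : ℕ in atTop,
      Real.exp (-(κ * N)) * (4 * (2 * N + 1)) < Real.exp (-(2 * β * √N) - 3) := by
    have hlim : Tendsto (fun N : ℕ => √(N : ℝ) * (√(N : ℝ) * (κ / 2) - 2 * β)) atTop atTop :=
      hsqrt.atTop_mul_atTop₀ (tendsto_atTop_add_const_right _ _
        (hsqrt.atTop_mul_const (by positivity)))
    obtain ⟨c, hc, hev⟩ := eventually_poly_mul_exp_le (a := κ / 2) (b := κ / 2) (by positivity)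
      (by positivity)
    filter_upwards [hlim.eventually_ge_atTop 5, hev] with N hN hN2
    have hs : √(N : ℝ) * √(N : ℝ) = N := Real.mul_self_sqrt (Nat.cast_nonneg N)
    have hle1 : (2 * (N : ℝ) + 1) * Real.exp (-(κ / 2 * N)) < 1 := by
      have h1 : Real.exp (-(c * N)) ≤ 1 := Real.exp_le_one_iff.2 (by
        have : (0 : ℝ) ≤ c * N := by positivity
        linarith)
      have := Real.exp_pos (-(κ / 2 * N))
      linarith
    have e4 : (4 : ℝ) ≤ Real.exp 2 := by
      have : Real.exp 2 = Real.exp 1 * Real.exp 1 := by rw [← Real.exp_add]; norm_num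
      nlinarith [Real.exp_one_gt_d9]
    calc Real.exp (-(κ * N)) * (4 * (2 * N + 1))
        = 4 * Real.exp (-(κ / 2 * N)) * ((2 * N + 1) * Real.exp (-(κ / 2 * N))) := by
          have : Real.exp (-(κ * N)) = Real.exp (-(κ / 2 * N)) * Real.exp (-(κ / 2 * N)) := by
            rw [← Real.exp_add]
            ring_nf
          rw [this]
          ring
      _ < 4 * Real.exp (-(κ / 2 * N)) * 1 := by gcongr
      _ ≤ Real.exp 2 * Real.exp (-(κ / 2 * N)) := by rw [mul_one]; gcongr
      _ ≤ _ := by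
          rw [← Real.exp_add]
          refine Real.exp_le_exp.2 ?_
          nlinarith
  filter_upwards [hA, hB, eventually_ge_atTop 1] with N hAN hBN hN
  by_contra hlt
  rw [not_le, hξ1, mul_one] at hlt
  have hN' : (0 : ℝ) < N := by positivity
  have hge := prob_log_partitionFunction_ge (P := P) (γ := γ) hN hξ hβ.le hΔ'
  have hconc := prob_le_integral_sub_le (logPartitionLip_nonneg (P := P) (N := N) (γ := γ) β)
    (abs_log_partitionFunction_sub_le β) (sum_logPartitionLip_sq hN β)
    (by rw [hξ1]; positivity) (r := N * Δ₁) (by positivity)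
  have hsub : {G : Disorder P N | N * (β ^ 2 / 2 + Real.log 2) - (β * √N + 3) ≤
        Real.log (partitionFunction γ β G)} ⊆
      {G | ∫ G, Real.log (partitionFunction γ β G) ∂(gaussianPi (DisorderIndex P N)) + N * Δ₁ ≤
        Real.log (partitionFunction γ β G)} := by
    intro G hG
    have hG' : N * (β ^ 2 / 2 + Real.log 2) - (β * √N + 3) ≤
      Real.log (partitionFunction γ β G) := hG
    rw [freeEnergy, div_lt_iff₀ hN'] at hlt
    change ∫ G, Real.log (partitionFunction γ β G) ∂(disorderLaw P N) + N * Δ₁ ≤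
      Real.log (partitionFunction γ β G)
    linarith
  have h := hge.trans ((measureReal_mono hsub (measure_ne_top _ _)).trans hconc)
  rw [div_le_iff₀ (by positivity)] at h
  have e : Real.exp (-((N * Δ₁) ^ 2 / (4 * (N * (β ^ 2 * mixture P γ 1))))) =
      Real.exp (-(N * Δ')) * Real.exp (-(κ * N)) := by
    rw [← Real.exp_add, hξ1, hκ]
    congr 1
    field_simp
    ring
  have e' : Real.exp (-(N * Δ') - 2 * β * √N - 3) =
      Real.exp (-(N * Δ')) * Real.exp (-(2 * β * √N) - 3) := by
    rw [← Real.exp_add]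
    ring_nf
  rw [e, e', mul_assoc (Real.exp (-(N * Δ')))] at h
  exact absurd (le_of_mul_le_mul_left h (Real.exp_pos _)) (not_le.2 hBN)

end SecondMoment

/-! ### The pure model for large `p` -/

section LargeP

lemma one_sub_pow_mul_le_one {x : ℝ} (h0 : 0 ≤ x) (h1 : x ≤ 1) (n : ℕ) :
    (1 - x) ^ n * (1 + n * x) ≤ 1 :=
  calc (1 - x) ^ n * (1 + n * x) ≤ (1 - x) ^ n * (1 + x) ^ n := by
        have : 0 ≤ (1 - x) ^ n := pow_nonneg (sub_nonneg.2 h1) n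
        gcongr
        exact one_add_mul_le_pow (by linarith) n
    _ = (1 - x ^ 2) ^ n := by rw [← mul_pow]; ring_nf
    _ ≤ 1 := pow_le_one₀ (by nlinarith) (by nlinarith)

lemma mul_one_sub_le_one_sub_pow {x δ : ℝ} (h0 : 0 ≤ x) (h1 : x ≤ 1) (hδ0 : 0 ≤ δ) {n : ℕ}
    (hδ : n * x ≤ δ) : n * x * (1 - δ) ≤ 1 - (1 - x) ^ n := by
  have hb := one_sub_pow_mul_le_one h0 h1 n
  have hnx : 0 ≤ n * x := by positivity
  have h2 : 0 ≤ n * x * (δ - n * x + δ * (n * x)) :=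
    mul_nonneg hnx (add_nonneg (sub_nonneg.2 hδ) (mul_nonneg hδ0 hnx))
  have h3 : n * x * (1 - δ) * (1 + n * x) ≤ (1 - (1 - x) ^ n) * (1 + n * x) := by linarith
  exact le_of_mul_le_mul_right h3 (by positivity)

lemma log_cosh_le_sub_log_two (l : ℝ) :
    Real.log (Real.cosh l) ≤ l - Real.log 2 + Real.exp (-(2 * l)) := by
  have h : Real.cosh l = Real.exp l / 2 * (1 + Real.exp (-(2 * l))) := by
    have h' : Real.exp (-l) = Real.exp l * Real.exp (-(2 * l)) := by
      rw [← Real.exp_add]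
      ring_nf
    rw [Real.cosh_eq, h']
    ring
  have hpos : 0 < 1 + Real.exp (-(2 * l)) := by positivity
  rw [h, Real.log_mul (by positivity) hpos.ne', Real.log_div (Real.exp_pos l).ne' two_ne_zero,
    Real.log_exp]
  linarith [Real.log_le_sub_one_of_pos hpos]

/-- The second moment method loses only `p⁻⁶` per site below `√(2 log 2)`. Away from overlap `1`
the Chernoff parameter `l = q` suffices, since `q ^ p` is small; within `1 / (10 log p)` of overlap
`1` it is `l = 3 log p`, where `log (cosh l)` is within `e^{-2 l} = p⁻⁶` of `l - log 2`. -/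
lemma secondMoment_loss_le {p : ℕ} (hp : 3 ≤ p) (hL : 30 * Real.log p + 2 ≤ p) {β : ℝ}
    (hβ : β ^ 2 ≤ 2 * Real.log 2) (q : ℝ) (hq : q ∈ Icc (0 : ℝ) 1) :
    ∃ l, β ^ 2 * (q ^ p / (1 + q ^ p)) ≤ l * q - Real.log (Real.cosh l) + 1 / (p : ℝ) ^ 6 := by
  have hp0 : (0 : ℝ) < p := by positivity
  have hL0 : 0 < Real.log p := Real.log_pos (by exact_mod_cast (by omega : 1 < p))
  have hρ0 : 0 ≤ q ^ p := pow_nonneg hq.1 p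
  have hlog2 := Real.log_two_gt_d9
  have hlog2' := Real.log_two_lt_d9
  obtain ⟨x, rfl⟩ : ∃ x, q = 1 - x := ⟨1 - q, by ring⟩
  have hx0 : 0 ≤ x := by linarith [hq.2]
  have hx1 : x ≤ 1 := by linarith [hq.1]
  rcases le_or_gt (x * Real.log p) (1 / 10) with hx | hx
  · refine ⟨3 * Real.log p, ?_⟩
    have hb := one_sub_pow_mul_le_one hx0 hx1 p
    set ρ := (1 - x) ^ p
    have hcosh := log_cosh_le_sub_log_two (3 * Real.log p)
    have hexp : Real.exp (-(2 * (3 * Real.log p))) = 1 / (p : ℝ) ^ 6 := by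
      rw [Real.exp_neg, one_div]
      congr 1
      rw [show 2 * (3 * Real.log (p : ℝ)) = (6 : ℕ) * Real.log p by push_cast; ring,
        Real.exp_nat_mul, Real.exp_log hp0]
    rw [hexp] at hcosh
    have h1 : β ^ 2 * (ρ / (1 + ρ)) ≤ 2 * Real.log 2 * (ρ / (1 + ρ)) := by gcongr
    have h2 : 2 * Real.log 2 * (ρ / (1 + ρ)) ≤ Real.log 2 - 3 * Real.log p * x := by
      rw [mul_div_assoc', div_le_iff₀ (by positivity)]
      have hpx : 0 ≤ p * x := by positivity
      have h3 : 3 * Real.log p * (2 + p * x) ≤ Real.log 2 * p := by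
        have : p * (x * Real.log p) ≤ p * (1 / 10) := by gcongr
        nlinarith
      -- `ρ (1 + p x) ≤ 1` gives `(1 - ρ) (2 + p x) ≥ (1 + ρ) p x`
      have h4 : (1 + ρ) * (p * x) ≤ (1 - ρ) * (2 + p * x) := by linarith
      have h5 : 3 * Real.log p * x * (1 + ρ) * (2 + p * x) ≤
          Real.log 2 * (1 - ρ) * (2 + p * x) := by
        calc _ = 3 * Real.log p * (2 + p * x) * (x * (1 + ρ)) := by ring
          _ ≤ Real.log 2 * p * (x * (1 + ρ)) := by gcongr
          _ = Real.log 2 * ((1 + ρ) * (p * x)) := by ring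
          _ ≤ Real.log 2 * ((1 - ρ) * (2 + p * x)) := by gcongr
          _ = _ := by ring
      have h6 := le_of_mul_le_mul_right h5 (by positivity)
      linarith
    linarith
  · refine ⟨1 - x, ?_⟩
    have hq0 : 0 ≤ 1 - x := hq.1
    obtain ⟨n, rfl⟩ : ∃ n, p = n + 2 := ⟨p - 2, by omega⟩
    have hb := one_sub_pow_mul_le_one hx0 hx1 n
    have hn : 3 ≤ n * x := by
      have h1 : 30 * Real.log ((n + 2 : ℕ) : ℝ) ≤ n := by
        have := hL
        push_cast at this ⊢
        linarith
      nlinarith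
    have hn4 : (1 - x) ^ n * 4 ≤ 1 := by
      refine le_trans ?_ hb
      have := pow_nonneg hq0 n
      gcongr
      linarith
    have hcosh : Real.log (Real.cosh (1 - x)) ≤ (1 - x) ^ 2 / 2 := by
      rw [Real.log_le_iff_le_exp (Real.cosh_pos _)]
      exact Real.cosh_le_exp_half_sq _
    have h1 : β ^ 2 * ((1 - x) ^ (n + 2) / (1 + (1 - x) ^ (n + 2))) ≤ 2 * (1 - x) ^ (n + 2) := by
      refine mul_le_mul (by linarith) (div_le_self hρ0 (by linarith)) (by positivity) (by norm_num)
    have h2 : 2 * (1 - x) ^ (n + 2) ≤ (1 - x) ^ 2 / 2 := by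
      rw [pow_add]
      have := mul_le_mul_of_nonneg_right hn4 (sq_nonneg (1 - x))
      linarith
    have h3 : 0 ≤ 1 / ((n + 2 : ℕ) : ℝ) ^ 6 := by positivity
    nlinarith

lemma meanAbs_sub_le {t : ℝ} (ht : 0 ≤ t) (v : ℝ) :
    meanAbs t - t * v ≤ Real.exp (-(t ^ 2 / 2)) + t * (1 - v) := by
  have h1 : 2 * gaussianPDFReal 0 1 t ≤ Real.exp (-(t ^ 2 / 2)) := by
    have h2 : (2 : ℝ) ≤ √(2 * Real.pi) := by
      refine Real.le_sqrt_of_sq_le ?_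
      linarith [Real.pi_gt_three]
    simp only [gaussianPDFReal, NNReal.coe_one, mul_one, sub_zero]
    rw [← mul_assoc, ← div_eq_mul_inv, neg_div]
    exact mul_le_of_le_one_left (Real.exp_pos _).le ((div_le_one (by positivity)).2 h2)
  have h2 := mul_le_mul_of_nonneg_left (cdf_le_one (gaussianReal 0 1) t) ht
  rw [meanAbs_eq]
  linarith

/-- With `b = β √p` and `L = log p`, the lower bound on `β` and the size of `log p` leave room for the
cost `1 + t` of the linear field with multiplier `t = √(2 (1 + δ) log p)`. -/
lemma one_add_sqrt_le {δ e L b : ℝ} (hδ0 : 0 < δ) (hδ : δ ≤ 1 / 10) (he : 10 * δ ≤ e)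
    (hL : 0 ≤ L) (hK : 1 ≤ 5 * δ * √(2 * L)) (hb : (1 + e) * √(2 * L) ≤ b) :
    1 + √(2 * (1 + δ) * L) ≤ (1 - 2 * δ) * b := by
  set K := √(2 * L) with hKdef
  have hK0 : 0 ≤ K := Real.sqrt_nonneg _
  have htK : √(2 * (1 + δ) * L) ≤ (1 + δ) * K := by
    refine Real.sqrt_le_iff.2 ⟨by positivity, ?_⟩
    rw [mul_pow, hKdef, Real.sq_sqrt (by positivity)]
    have : 0 ≤ δ * L * (1 + δ) := by positivity
    linarith
  have h1 : (1 + 10 * δ) * K ≤ b := le_trans (by gcongr) hb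
  have h2 : (1 - 2 * δ) * ((1 + 10 * δ) * K) ≤ (1 - 2 * δ) * b :=
    mul_le_mul_of_nonneg_left h1 (by linarith)
  have h3 : 0 ≤ δ * (1 / 10 - δ) * K := by
    have : 0 ≤ 1 / 10 - δ := by linarith
    positivity
  linarith

/-- The margin at overlap `1 - x` in the window. The linear field with multiplier `t`
costs at most `√p x (1 + t)` there, while the energy gap between `1` and `(1 - x) ^ p` gains almost `β p x`. -/
lemma band_margin_le {p : ℕ} {s β δ r t x m ε : ℝ} (hδ0 : 0 ≤ δ) (hr0 : 0 ≤ r)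
    (hβ : 0 ≤ β) (hs0 : 0 ≤ s) (hss : s * s = p) (hmain : 1 + t ≤ (1 - 2 * δ) * (β * s))
    (hrx : r ≤ x) (hx1 : x ≤ 1) (hxδ : p * x ≤ δ) (hm : m ≤ r + t * x)
    (hε : ε ≤ δ * (p * r) / 2) :
    β * (δ * (p * r) / 2) ≤ (1 - 1 * ε) * β * 1 - β * (1 - x) ^ p - s * m := by
  have hx0 : 0 ≤ x := hr0.trans hrx
  have hpow := mul_one_sub_le_one_sub_pow hx0 hx1 hδ0 hxδ
  have h1 : s * m ≤ (1 - 2 * δ) * β * (p * x) := by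
    calc s * m ≤ s * (x * (1 + t)) := by
          gcongr
          linarith
      _ = s * x * (1 + t) := by ring
      _ ≤ s * x * ((1 - 2 * δ) * (β * s)) := by gcongr
      _ = (1 - 2 * δ) * β * (s * s * x) := by ring
      _ = _ := by rw [hss]
  have h2 : β * (p * x * (1 - δ)) ≤ β * (1 - (1 - x) ^ p) := by gcongr
  have h3 : β * ε ≤ β * (δ * (p * r) / 2) := by gcongr
  have h4 : β * (δ * (p * r)) ≤ β * (δ * (p * x)) := by gcongr
  linarith

/-- Without signal, the bound from the linear field with multiplier `t` stays below `β / 2` throughout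
the overlaps `1 - x` with `p x ≤ δ`. -/
lemma cap_margin_le {p : ℕ} {s β δ r t x m : ℝ} (hδ : δ ≤ 1 / 10) (hr0 : 0 ≤ r)
    (hβ : 0 ≤ β) (hs0 : 0 < s) (hss : s * s = p) (hpr : p * r ≤ 1) (ht : 2 ≤ t)
    (hβs : 1 + t ≤ β * s) (hxδ : p * x ≤ δ) (hm : m ≤ r + t * x) :
    β * (δ * (p * r) / 2) ≤ β * 1 - s * m := by
  have hpr0 : 0 ≤ p * r := by positivity
  have h1 : s * m ≤ β / 2 := by
    have h2 : p * m ≤ β * s / 2 := by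
      calc p * m ≤ p * (r + t * x) := by gcongr
        _ = p * r + t * (p * x) := by ring
        _ ≤ 1 + t * (1 / 10) := by
          gcongr
          linarith
        _ ≤ β * s / 2 := by linarith
    rw [← hss] at h2
    refine le_of_mul_le_mul_right (a := s) ?_ hs0
    linarith
  have h2 : β * (δ * (p * r) / 2) ≤ β * (1 / 2) := by
    have h3 : δ * (p * r) ≤ 1 * 1 := by
      gcongr
      linarith
    gcongr
    linarith
  linarith

/-- The loss `p⁻⁶` of the second moment method is affordable for the deficit `η² / (16 p)`. -/
lemma inv_pow_six_lt {p β η L : ℝ} (hβ : 0 < β) (hβp : 1 ≤ β ^ 2 * p) (hp : 1024 < p)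
    (hL : 1 ≤ L) (hη : β * √(L / p) ≤ η) :
    1 / p ^ 6 < (η ^ 2 / (16 * p)) ^ 2 / (4 * β ^ 2) := by
  have hp0 : 0 < p := by linarith
  have hη4 : β ^ 4 * (L / p) ^ 2 ≤ η ^ 4 := by
    have hsq : √(L / p) ^ 2 = L / p := Real.sq_sqrt (by positivity)
    calc β ^ 4 * (L / p) ^ 2 = (β * √(L / p)) ^ 4 := by
          rw [mul_pow]
          congr 1
          nth_rewrite 1 [← hsq]
          ring
      _ ≤ η ^ 4 := by gcongr
  have h1 : (η ^ 2 / (16 * p)) ^ 2 / (4 * β ^ 2) = η ^ 4 / (1024 * p ^ 2 * β ^ 2) := by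
    field_simp
    ring
  rw [h1, div_lt_div_iff₀ (by positivity) (by positivity), one_mul]
  calc 1024 * p ^ 2 * β ^ 2 < p * p ^ 2 * β ^ 2 := by gcongr
    _ ≤ p * p ^ 2 * β ^ 2 * (β ^ 2 * p) * L ^ 2 := by
        refine (le_mul_of_one_le_right (by positivity) hβp).trans
          (le_mul_of_one_le_right (by positivity) (one_le_pow₀ hL))
    _ = β ^ 4 * (L / p) ^ 2 * p ^ 6 := by field_simp
    _ ≤ η ^ 4 * p ^ 6 := by gcongr

/-- The overlap window for the pure model at one `p`, under explicit largeness conditions. The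
Lagrange multiplier is `t = √(2 (1 + δ) log p)`, for which the density term of
`meanAbs t` is at most `p^{-(1+δ)}`, the distance from `1` of the upper end of the window. -/
lemma exists_rate_pure {P p : ℕ} {γ : ℕ → ℝ} (hξ : ∀ x, mixture P γ x = x ^ p) {e δ β : ℝ}
    (hδ0 : 0 < δ) (hδ : δ ≤ 1 / 10) (he : 10 * δ ≤ e) (hp : 1024 < p)
    (hL : 30 * Real.log p + 2 ≤ p) (hK : 1 ≤ 5 * δ * √(2 * Real.log p))
    (hε : √(Real.log p / p) ≤ δ * (p * (1 / (p : ℝ) ^ (1 + δ))) / 2)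
    (hβ : (1 + e) * √(2 * Real.log p / p) < β) (hβ2 : β < √(2 * Real.log 2)) :
    ∃ c : ℝ, 0 < c ∧
      (∀ N : ℕ, 1 ≤ N → ∀ τ ∈ Set.Icc (0 : ℝ) 1,
        gibbsOverlapMass P γ N β ((1 - 1 * √(Real.log p / p)) * β) τ
          (1 - δ / p) (1 - 1 / (p : ℝ) ^ (1 + δ)) ≤ Real.exp (-(c * N))) ∧
      (∀ N : ℕ, 1 ≤ N → ∀ σ : Config N,
        fixedOverlapProb P γ β (1 - δ / p) σ ≤ Real.exp (-(c * N))) := by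
  have hp1024 : (1024 : ℝ) < p := by exact_mod_cast hp
  have hp0 : (0 : ℝ) < p := by linarith
  set L := Real.log p with hLdef
  have hL1 : 1 ≤ L := by
    rw [hLdef, Real.le_log_iff_exp_le hp0]
    linarith [Real.exp_one_lt_d9]
  set r := 1 / (p : ℝ) ^ (1 + δ) with hr
  have hr0 : 0 < r := by positivity
  have hrexp : r = Real.exp (-((1 + δ) * L)) := by
    rw [hr, Real.rpow_def_of_pos hp0, Real.exp_neg, one_div, mul_comm]
  have hpr : p * r ≤ 1 := by
    rw [hr, mul_one_div, div_le_one (by positivity)]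
    exact Real.self_le_rpow_of_one_le (by linarith) (by linarith)
  set K := √(2 * L) with hKdef
  have hK2 : 2 ≤ K := by
    have h1 : 5 * δ * K ≤ 1 / 2 * K := mul_le_mul_of_nonneg_right (by linarith)
      (Real.sqrt_nonneg _)
    linarith
  set s := √(p : ℝ) with hs
  have hs0 : 0 < s := Real.sqrt_pos.2 hp0
  have hss : s * s = p := Real.mul_self_sqrt hp0.le
  have hβK : (1 + e) * K < β * s := by
    rw [Real.sqrt_div (by positivity), mul_div_assoc', div_lt_iff₀ hs0] at hβ
    exact hβ
  set t := √(2 * (1 + δ) * L) with ht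
  have ht2 : t ^ 2 = 2 * (1 + δ) * L := Real.sq_sqrt (by positivity)
  have hKt : K ≤ t := Real.sqrt_le_sqrt (by
    have : 0 ≤ δ * L := by positivity
    linarith)
  have ht0 : 0 ≤ t := Real.sqrt_nonneg _
  have hmain : 1 + t ≤ (1 - 2 * δ) * (β * s) :=
    one_add_sqrt_le hδ0 hδ he (by linarith) hK hβK.le
  have hβs0 : 0 < β * s := pos_of_mul_pos_right (by linarith : 0 < (1 - 2 * δ) * (β * s))
    (by linarith)
  have hβs : 1 + t ≤ β * s := hmain.trans (mul_le_of_le_one_left hβs0.le (by linarith))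
  have hβ0 : 0 < β := pos_of_mul_pos_left hβs0 hs0.le
  have hβsq : 1 ≤ β ^ 2 * p := by
    have : 1 ≤ (β * s) ^ 2 := one_le_pow₀ (by linarith)
    rwa [mul_pow, sq s, hss] at this
  have hβlog : β ^ 2 ≤ 2 * Real.log 2 := by
    have : 0 ≤ 2 * Real.log 2 := by have := Real.log_two_gt_d9; linarith
    rw [← Real.sq_sqrt this]
    gcongr
  set ε := √(L / p) with hεdef
  have hε0 : 0 ≤ ε := Real.sqrt_nonneg _
  have hεsq : ε ^ 2 = L / p := Real.sq_sqrt (by positivity)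
  set η := β * (δ * (p * r) / 2) with hη
  have hη0 : 0 < η := by positivity
  have hξ1 : mixture P γ 1 = 1 := by rw [hξ, one_pow]
  have hderiv : deriv (mixture P γ) 1 = p := by
    rw [show mixture P γ = fun x => x ^ p from funext hξ]
    simp
  have hmean : ∀ v, meanAbs t - t * v ≤ r + t * (1 - v) := fun v => by
    refine (meanAbs_sub_le ht0 v).trans_eq ?_
    rw [ht2, hrexp]
    ring_nf
  have hδp : δ / p ≤ 1 := (div_le_one hp0).2 (by linarith)
  have hε1 : ε < 1 := by
    have : δ * (p * r) ≤ 1 * 1 := by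
      gcongr
      linarith
    linarith
  refine exists_rate_of_margin (η := η) (Δ := η ^ 2 / (16 * p)) (by rw [hξ1]; norm_num) hβ0
    (mul_pos (by linarith) hβ0) hη0 (by linarith) ?_ ?_ ?_ ?_
  · intro v hv1 hv2
    refine ⟨t, ht0, ?_⟩
    obtain ⟨x, rfl⟩ : ∃ x, v = 1 - x := ⟨1 - v, by ring⟩
    have hx : x ≤ δ / p := by linarith
    rw [hξ1, hξ, hderiv]
    refine band_margin_le hδ0.le hr0.le hβ0.le hs0.le hss hmain (by linarith)
      (by linarith) ?_ ((hmean _).trans_eq (by ring)) hε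
    rwa [le_div_iff₀ hp0, mul_comm] at hx
  · intro v hv1 hv2
    refine ⟨t, ht0, ?_⟩
    have hx : 1 - v ≤ δ / p := by linarith
    rw [le_div_iff₀ hp0, mul_comm] at hx
    rw [hξ1, hderiv]
    exact cap_margin_le hδ hr0.le hβ0.le hs0 hss hpr (hK2.trans hKt) hβs hx (hmean v)
  · rw [hderiv]
    exact div_lt_div_of_pos_left (by positivity) (by positivity) (by linarith)
  · refine eventually_freeEnergy_ge (Δ' := 1 / (p : ℝ) ^ 6) hξ hβ0 (by positivity) ?_
      (secondMoment_loss_le (by omega) hL hβlog)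
    refine inv_pow_six_lt hβ0 hβsq hp1024 hL1 ?_
    rw [hη]
    gcongr

lemma eventually_large_log {δ : ℝ} (hδ0 : 0 < δ) (hδ : δ ≤ 1 / 10) : ∀ᶠ p : ℕ in atTop,
    1024 < p ∧ 30 * Real.log p + 2 ≤ p ∧ 1 ≤ 5 * δ * √(2 * Real.log p) ∧
      √(Real.log p / p) ≤ δ * (p * (1 / (p : ℝ) ^ (1 + δ))) / 2 ∧
      1 / (p : ℝ) ^ (1 + δ) < δ / p := by
  have hcast := tendsto_natCast_atTop_atTop (R := ℝ)
  have h1 := hcast.eventually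
    ((isLittleO_log_rpow_atTop one_pos).bound (by norm_num : (0 : ℝ) < 1 / 60))
  have h2 : Tendsto (fun p : ℕ => 5 * δ * √(2 * Real.log p)) atTop atTop :=
    (Real.tendsto_sqrt_atTop.comp ((Real.tendsto_log_atTop.comp hcast).const_mul_atTop
      two_pos)).const_mul_atTop (by positivity)
  have h3 := hcast.eventually
    ((isLittleO_log_rpow_atTop (by linarith : 0 < 1 - 2 * δ)).bound
      (by positivity : 0 < δ ^ 2 / 4))
  have h4 : Tendsto (fun p : ℕ => δ * (p : ℝ) ^ δ) atTop atTop :=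
    ((tendsto_rpow_atTop hδ0).comp hcast).const_mul_atTop hδ0
  filter_upwards [eventually_gt_atTop 1024, h1, h2.eventually_ge_atTop 1, h3,
    h4.eventually_gt_atTop 1] with p hp h1 h2 h3 h4
  have hp1 : (1024 : ℝ) < p := by exact_mod_cast hp
  have hp0 : (0 : ℝ) < p := by linarith
  have hL : 0 ≤ Real.log p := Real.log_nonneg (by linarith)
  rw [Real.norm_of_nonneg hL, Real.norm_of_nonneg (by positivity)] at h1 h3
  rw [Real.rpow_one] at h1
  have hr : 1 / (p : ℝ) ^ (1 + δ) = 1 / (p * (p : ℝ) ^ δ) := by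
    rw [Real.rpow_add hp0, Real.rpow_one]
  have hd : (0 : ℝ) < (p : ℝ) ^ δ := by positivity
  refine ⟨hp, by linarith, h2, ?_, ?_⟩
  · refine Real.sqrt_le_iff.2 ⟨by positivity, ?_⟩
    have e : (p : ℝ) ^ (1 - 2 * δ) = p / ((p : ℝ) ^ δ) ^ 2 := by
      rw [Real.rpow_sub hp0, Real.rpow_one, mul_comm, Real.rpow_mul hp0.le, Real.rpow_two]
    rw [div_le_iff₀ hp0, hr]
    refine h3.trans (le_of_eq ?_)
    rw [e]
    field_simp
    norm_num
  · rw [hr, div_lt_div_iff₀ (by positivity) hp0]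
    nlinarith

end LargeP

end PSpin

end

theorem theorem4 :
    -- general mixtures
    (∀ (P : ℕ) (γ : ℕ → ℝ), (∃ k ∈ Finset.Icc 2 P, γ k ≠ 0) →
      ∀ β : ℝ, PSpin.betaBarD P γ < β → β < PSpin.betaC P γ →
        ∃ ε c qlo qhi : ℝ, 0 < ε ∧ 0 < c ∧ 0 < qlo ∧ qlo < qhi ∧ qhi < 1 ∧
          (∀ N : ℕ, 1 ≤ N → ∀ τ ∈ Set.Icc (0 : ℝ) 1,
            PSpin.gibbsOverlapMass P γ N β ((1 - ε) * β) τ qlo qhi ≤ Real.exp (-(c * N))) ∧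
          (∀ N : ℕ, 1 ≤ N → ∀ σ : PSpin.Config N,
            PSpin.fixedOverlapProb P γ β qlo σ ≤ Real.exp (-(c * N)))) ∧
    -- the pure `p`-spin model
    (∀ ε' : ℝ, 0 < ε' → ∃ (p₀ : ℕ) (δ c' : ℝ), 0 < δ ∧ 0 < c' ∧
      ∀ p : ℕ, p₀ ≤ p → ∀ (P : ℕ) (γ : ℕ → ℝ), (∀ x : ℝ, PSpin.mixture P γ x = x ^ p) →
        0 < 1 - δ / p ∧ 1 - δ / p < 1 - 1 / (p : ℝ) ^ (1 + δ) ∧ 1 - 1 / (p : ℝ) ^ (1 + δ) < 1 ∧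
        ∀ β : ℝ, (1 + ε') * Real.sqrt (2 * Real.log p / p) < β → β < Real.sqrt (2 * Real.log 2) →
          ∃ c : ℝ, 0 < c ∧
            (∀ N : ℕ, 1 ≤ N → ∀ τ ∈ Set.Icc (0 : ℝ) 1,
              PSpin.gibbsOverlapMass P γ N β ((1 - c' * Real.sqrt (Real.log p / p)) * β) τ
                (1 - δ / p) (1 - 1 / (p : ℝ) ^ (1 + δ)) ≤ Real.exp (-(c * N))) ∧
            (∀ N : ℕ, 1 ≤ N → ∀ σ : PSpin.Config N,
              PSpin.fixedOverlapProb P γ β (1 - δ / p) σ ≤ Real.exp (-(c * N)))) := by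
  refine ⟨fun P γ h β hd hc => PSpin.exists_overlap_window h hd hc, fun ε' hε' => ?_⟩
  -- `δ = min ε' 1 / 10` and `c' = 1`
  have hδ0 : 0 < min ε' 1 / 10 := div_pos (lt_min hε' one_pos) (by norm_num)
  have hδ : min ε' 1 / 10 ≤ 1 / 10 := by
    have := min_le_right ε' 1
    gcongr
  have he : 10 * (min ε' 1 / 10) ≤ ε' := by linarith [min_le_left ε' 1]
  obtain ⟨p₀, hp₀⟩ := Filter.eventually_atTop.1 (PSpin.eventually_large_log hδ0 hδ)
  refine ⟨p₀, min ε' 1 / 10, 1, hδ0, one_pos, fun p hp P γ hξ => ?_⟩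
  obtain ⟨h1, h2, h3, h4, h5⟩ := hp₀ p hp
  have hp1 : (1 : ℝ) < p := by exact_mod_cast (by omega : 1 < p)
  have hδp : min ε' 1 / 10 / p < 1 := (div_lt_one (by linarith)).2 (by linarith)
  have hr : 0 < 1 / (p : ℝ) ^ (1 + min ε' 1 / 10) := by positivity
  exact ⟨by linarith, by linarith, by linarith, fun β hβ hβ2 =>
    PSpin.exists_rate_pure hξ hδ0 hδ he h1 h2 h3 h4 hβ hβ2⟩
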